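/- Let $(a_n)_{n\ge 1}$ be a sequence of positive real numbers. Let $T_1$ be a segment of length $a_1$, rooted at one of its two ends, and for $n\ge 2$ let $T_n$ be the tree obtained by gluing a segment of length $a_n$, by one of its ends, on a point of $T_{n-1}$ chosen uniformly at random (i.e. according to the normalized length measure of $T_{n-1}$), independently of the previous choices. Let $d$ be the length metric of $T_n$. The sequence $(a_n)$ is called regularly varying with index $\alpha$ if $a_{\lfloor cn\rfloor}/a_n\to c^{\alpha}$ as $n\to\infty$ for every $c>0$. Fix an integer $\ell\ge 1$ and, given $T_n$, let $X_n^{(1)},\dots,X_n^{(\ell)}$ be independent uniform random points of $T_n$. For $i\ne j$ let $B_n^{(i,j)}$ be the point at which the paths from the root to $X_n^{(i)}$ and from the root to $X_n^{(j)}$ separate, that is, the point common to both paths which is the farthest from the root. Put $M_n=\max_{1\le i\ne j\le \ell} d(B_n^{(i,j)},\mathrm{root})$ (with $M_n=0$ if $\ell=1$) and $S_n=\sum_{i=1}^n i^{-1}a_i$. (i) Assume that $(a_n)$ is regularly varying with index $\alpha>0$. There is a unique probability law on $\mathbb R$, that of a random variable denoted by $\xi_{(\alpha)}$, such that $$\mathbb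 E\big[e^{\lambda \xi_{(\alpha)}}\big]=\exp\Big(\frac{\alpha+1}{\alpha}\int_0^1\big(e^{\lambda u}-1\big)\frac{1-u}{u}\,\mathrm du\Big)\qquad\text{for all }\lambda\in\mathbb R,$$ and, as $n\to\infty$, $$\left(\Big(\frac{d(X_n^{(i)},\mathrm{root})}{a_n}\Big)_{1\le i\le \ell},\ \frac{M_n}{a_n}\right)\ \longrightarrow\ \left(\big(\xi^{(i)}_{(\alpha)}\big)_{1\le i\le \ell},\ 0\right)\quad\text{in distribution},$$ where $\xi^{(1)}_{(\alpha)},\dots,\xi^{(\ell)}_{(\alpha)}$ are i.i.d. copies of $\xi_{(\alpha)}$. (ii) Assume that $(a_n)$ is regularly varying with index $0$ and that $\sum_{i\ge 1} i^{-1}a_i=\infty$. Then, as $n\to\infty$, $$\left(\Big(\frac{d(X_n^{(i)},\mathrm{root})}{S_n}\Big)_{1\le i\le \ell},\ \frac{M_n}{S_n}\right)\ \longrightarrow\ \left(\Big(\frac12,\dots,\frac12\Big),\ 0\right)\quad\text{in probability}.$$ If moreover $a_n\to\infty$, then also $$\left(\Big(\frac{d(X_n^{(i)},\mathrm{root})}{S_n}\Big)_{1\le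 i\le \ell},\ \frac{M_n}{a_n}\right)\ \longrightarrow\ \left(\Big(\frac12,\dots,\frac12\Big),\ 0\right)\quad\text{in probability}.$$ -/

import Mathlib

open MeasureTheory ProbabilityTheory Filter Topology

/-- The sequence `(a n)`, `n ≥ 1`, is regularly varying with index `α`
(the value `a 0` plays no role). -/
def RegularlyVarying (a : ℕ → ℝ) (α : ℝ) : Prop :=
  ∀ c : ℝ, 0 < c → Tendsto (fun n : ℕ => a ⌊c * n⌋₊ / a n) atTop (𝓝 (c ^ α))

/-- The points of the tree `T_n` built from the segments `b_1, …, b_n` of lengths `a 1, …, a n`: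
the pair `(i, x)` is the point of the closed segment `b_i` at distance `x` from the end of `b_i`
which is glued (from the end chosen as the root when `i = 1`). A glued end `(i, 0)`, `i ≥ 2`, and
the point it is glued on are two names of one point: `treeDist` puts them at distance `0`. -/
def treePts (a : ℕ → ℝ) (n : ℕ) : Set (ℕ × ℝ) :=
  {p | 1 ≤ p.1 ∧ p.1 ≤ n ∧ 0 ≤ p.2 ∧ p.2 ≤ a p.1}

/-- The root: an end of the first segment. -/
def treeRoot : ℕ × ℝ := (1, 0)

/-- The length metric of `T_n` when, for every `2 ≤ i ≤ n`, the end `(i, 0)` of the segment `b_i`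
is glued on the point `g i` of `T_(i-1)`: two points of `b_n` are at their distance in `b_n`, a path
from a point of `b_n` to a point of `T_(n-1)` goes through the gluing point `g n`, and the metric
on `T_(n-1)` is unchanged. -/
def treeDist (g : ℕ → ℕ × ℝ) : ℕ → ℕ × ℝ → ℕ × ℝ → ℝ
  | 0, _, _ => 0
  | n + 1, p, q =>
    if p.1 = n + 1 then
      if q.1 = n + 1 then |p.2 - q.2| else p.2 + treeDist g n (g (n + 1)) q
    else
      if q.1 = n + 1 then q.2 + treeDist g n p (g (n + 1)) else treeDist g n p q

/-- The path in `T_n` from the root to `p`. -/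
def rootPath (a : ℕ → ℝ) (g : ℕ → ℕ × ℝ) (n : ℕ) (p : ℕ × ℝ) : Set (ℕ × ℝ) :=
  {z ∈ treePts a n |
    treeDist g n treeRoot z + treeDist g n z p = treeDist g n treeRoot p}

/-- The distance to the root of the point at which the paths in `T_n` from the root to `p` and from
the root to `q` separate, i.e. of the point of both paths that is the farthest from the root (this
point is `p` when `p` lies on the path to `q`). -/
noncomputable def branchHeight (a : ℕ → ℝ) (g : ℕ → ℕ × ℝ) (n : ℕ) (p q : ℕ × ℝ) : ℝ :=
  sSup (treeDist g n treeRoot '' (rootPath a g n p ∩ rootPath a g n q))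

/-- The largest height of a branch point of two distinct marked points among `x 1, …, x ℓ`
(it is `0` if there is only one marked point). -/
noncomputable def maxBranchHeight {ℓ : ℕ} (a : ℕ → ℝ) (g : ℕ → ℕ × ℝ) (n : ℕ)
    (x : Fin ℓ → ℕ × ℝ) : ℝ :=
  ⨆ e : {e : Fin ℓ × Fin ℓ // e.1 ≠ e.2}, branchHeight a g n (x e.1.1) (x e.1.2)

/-- Length measure on the disjoint union of the segments. -/
noncomputable def segLength : Measure (ℕ × ℝ) := (Measure.count : Measure ℕ).prod volume

/-- The random trees with marked points. For `i ≥ 2` the segment `b_i` is glued on a uniform point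
`glue i` of `T_(i-1)`, independent of the previous gluings; given `T_n`, the points
`X n 1, …, X n ℓ` are independent and uniform in `T_n`. (Nothing is imposed on the joint law of the
marked points for different `n`.) Uniform means: distributed according to the normalized length
measure, which does not depend on the gluing points. -/
structure IsMarkedGluing {Ω : Type*} [MeasurableSpace Ω] (P : Measure Ω) (a : ℕ → ℝ) (ℓ : ℕ)
    (glue : ℕ → Ω → ℕ × ℝ) (X : ℕ → Fin ℓ → Ω → ℕ × ℝ) : Prop where
  measurable_glue : ∀ i, Measurable (glue i)
  measurable_mark : ∀ n j, Measurable (X n j)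
  glue_uniform : ∀ i, 2 ≤ i → pdf.IsUniform (glue i) (treePts a (i - 1)) P segLength
  mark_uniform : ∀ n, 1 ≤ n → ∀ j, pdf.IsUniform (X n j) (treePts a n) P segLength
  indep : ∀ n, 1 ≤ n →
    iIndepFun (Sum.elim (fun i : Finset.Icc 2 n => glue i) (X n)) P

/-- The exponent `φ_(α)(t) = (α+1)/α ∫₀¹ (exp(t u) - 1) (1 - u)/u du`. -/
noncomputable def xiExponent (α t : ℝ) : ℝ :=
  (α + 1) / α * ∫ u in (0 : ℝ)..1, (Real.exp (t * u) - 1) * ((1 - u) / u)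

/-- `ν` is the law of `ξ_(α)`: `E[exp(t ξ)] = exp(φ_(α)(t))` for all real `t`. (As the right-hand
side is not `0`, the equation contains the finiteness of the exponential moment.) -/
def IsXiLaw (α : ℝ) (ν : ProbabilityMeasure ℝ) : Prop :=
  ∀ t : ℝ, mgf id (ν : Measure ℝ) t = Real.exp (xiExponent α t)

/-- The sum `∑_{i=1}^n a i / i`. -/
noncomputable def harmonicSum (a : ℕ → ℝ) (n : ℕ) : ℝ :=
  ∑ i ∈ Finset.Icc 1 n, (i : ℝ)⁻¹ * a i

/-! Write p_i for `segProb a i`, the share of b_i in the length of T_i. A uniform point of T_(n+1)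
is uniform in T_n with probability 1 - p_(n+1); otherwise it is uniform on b_(n+1), whose foot is
again uniform in T_n (`unifLaw_succ`).

Heights. Let K_n(t) be the characteristic function of the height of a uniform point given T_n. If y
is the next gluing point and w the characteristic function, at t, of a uniform point of [0,
a_(n+1)], then K_(n+1) = (1 - p) K_n + p w exp(i t height(y)) with p = p_(n+1). Given T_n, the last
exponential has mean K_n, so the mean of K_n is the explicit product `heightProd`. The fluctuation
added at each level is centred given the past, so its mean square is at most p² times a bounded
quantity, which is small on early levels once t is divided by N_n → ∞. Since ∑ p_i² < ∞, K_n(t /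
N_n) concentrates around its mean (`tendsto_heightVar`). Given T_n the marked points are
independent, so the joint characteristic function is the mean of a product of such K_n and splits in
the limit (`tendsto_integral_prod_heightCharFun_sub`).

Limit law. Regular variation gives n p_n → α + 1. The product of the 1 + w_i behaves like exp(∑
w_i), because ∑ |w_i|² → 0. For α > 0, ∑ w_i is a Riemann sum, dominated through Potter's bound
(`exists_potter`); a power substitution and an integration by parts turn its limit into
`xiExponent`. For α = 0, a_n / S_n → 0, so only the first-order term z a_i / (2 S_n) survives; its
sum tends to z / 2, which is the Dirac mass at 1/2. The law of ξ is obtained as a weak limit of the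
heights themselves: characteristic functions give tightness, and convergence of all real exponential
moments identifies its moment generating function, which determines it.

Branch points. When at most one of two uniform points falls on b_(n+1), their branch point is
distributed as that of two uniform points of T_n. Hence passing from n to n + 1 raises the
probability of a branch point above a given height by at most p_(n+1)² (`branchProb_succ_le`). Since
T_m has height at most its total length, a branch point exceeds that length with probability at most
the tail of ∑ p_i², uniformly in n. Branch heights are therefore tight, and negligible after
division by any N_n → ∞. -/

/-- The total length of `T_n`. -/
noncomputable def totalLength (a : ℕ → ℝ) (n : ℕ) : ℝ := ∑ i ∈ Finset.Icc 1 n, a i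

/-- Every gluing point up to level `n` is a point of the tree on which it is glued. -/
def ValidGluing (a : ℕ → ℝ) (g : ℕ → ℕ × ℝ) (n : ℕ) : Prop :=
  ∀ i, 2 ≤ i → i ≤ n → g i ∈ treePts a (i - 1)

/-- The height of the branch point of `p` and `q`, as a Gromov product. -/
noncomputable def gromovHeight (g : ℕ → ℕ × ℝ) (n : ℕ) (p q : ℕ × ℝ) : ℝ :=
  (treeDist g n p treeRoot + treeDist g n q treeRoot - treeDist g n p q) / 2

/-! ### The tree metric and Gromov products -/

section Geometry

variable {a : ℕ → ℝ} {g : ℕ → ℕ × ℝ} {n : ℕ} {p q r : ℕ × ℝ}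

lemma ValidGluing.of_succ (h : ValidGluing a g (n + 1)) : ValidGluing a g n :=
  fun i hi hn => h i hi (by omega)

lemma ValidGluing.glue_mem (h : ValidGluing a g (n + 1)) (hn : 1 ≤ n) :
    g (n + 1) ∈ treePts a n := by simpa using h (n + 1) (by omega) le_rfl

lemma mem_treePts_succ : p ∈ treePts a (n + 1) ↔
    p ∈ treePts a n ∨ (p.1 = n + 1 ∧ 0 ≤ p.2 ∧ p.2 ≤ a (n + 1)) := by
  obtain ⟨i, x⟩ := p
  simp only [treePts, Set.mem_ofPred_eq]
  constructor
  · rintro ⟨h1, h2, h3, h4⟩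
    rcases eq_or_lt_of_le h2 with rfl | h
    · exact Or.inr ⟨rfl, h3, h4⟩
    · exact Or.inl ⟨h1, by omega, h3, h4⟩
  · rintro (⟨h1, h2, h3, h4⟩ | ⟨rfl, h3, h4⟩)
    · exact ⟨h1, by omega, h3, h4⟩
    · exact ⟨by omega, le_rfl, h3, h4⟩

lemma fst_ne_of_mem_treePts (h : p ∈ treePts a n) : p.1 ≠ n + 1 := by
  have := h.2.1; omega

lemma one_le_of_mem_treePts (h : p ∈ treePts a n) : 1 ≤ n := h.1.trans h.2.1

lemma treeDist_succ_of_eq_of_eq (hp : p.1 = n + 1) (hq : q.1 = n + 1) :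
    treeDist g (n + 1) p q = |p.2 - q.2| := by simp [treeDist, hp, hq]

lemma treeDist_succ_of_eq_of_ne (hp : p.1 = n + 1) (hq : q.1 ≠ n + 1) :
    treeDist g (n + 1) p q = p.2 + treeDist g n (g (n + 1)) q := by simp [treeDist, hp, hq]

lemma treeDist_succ_of_ne_of_eq (hp : p.1 ≠ n + 1) (hq : q.1 = n + 1) :
    treeDist g (n + 1) p q = q.2 + treeDist g n p (g (n + 1)) := by simp [treeDist, hp, hq]

lemma treeDist_succ_of_ne_of_ne (hp : p.1 ≠ n + 1) (hq : q.1 ≠ n + 1) :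
    treeDist g (n + 1) p q = treeDist g n p q := by simp [treeDist, hp, hq]

lemma treeDist_comm (g : ℕ → ℕ × ℝ) (n : ℕ) (p q : ℕ × ℝ) :
    treeDist g n p q = treeDist g n q p := by
  induction n generalizing p q with
  | zero => rfl
  | succ n ih =>
    simp only [treeDist]
    split_ifs
    · exact abs_sub_comm _ _
    · rw [ih]
    · rw [ih]
    · exact ih _ _

lemma treeDist_congr {g' : ℕ → ℕ × ℝ} (h : ∀ i, 2 ≤ i → i ≤ n → g i = g' i) (p q : ℕ × ℝ) :
    treeDist g n p q = treeDist g' n p q := by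
  induction n generalizing p q with
  | zero => rfl
  | succ n ih =>
    have ih := ih fun i hi hn => h i hi (by omega)
    -- At level 1 the entry `g 1` occurs only as an argument of `treeDist g 0`, which is 0; so no
    -- agreement is required at index 1.
    rcases Nat.eq_zero_or_pos n with rfl | hn
    · simp [treeDist]
    · simp only [treeDist, ih, h (n + 1) (by omega) le_rfl]

lemma treeRoot_mem (ha : 0 < a 1) (hn : 1 ≤ n) : treeRoot ∈ treePts a n :=
  ⟨le_rfl, hn, le_rfl, ha.le⟩

lemma treeRoot_fst_ne (hn : 1 ≤ n) : treeRoot.1 ≠ n + 1 := by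
  show 1 ≠ n + 1
  omega

lemma treeDist_nonneg (hg : ValidGluing a g n) (hp : p ∈ treePts a n) (hq : q ∈ treePts a n) :
    0 ≤ treeDist g n p q := by
  induction n generalizing p q with
  | zero => exact le_rfl
  | succ n ih =>
    have ih := fun {p q} => @ih p q hg.of_succ
    rcases mem_treePts_succ.1 hp with hp | ⟨hp, hp0, -⟩ <;>
    rcases mem_treePts_succ.1 hq with hq | ⟨hq, hq0, -⟩
    · rw [treeDist_succ_of_ne_of_ne (fst_ne_of_mem_treePts hp) (fst_ne_of_mem_treePts hq)]
      exact ih hp hq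
    · rw [treeDist_succ_of_ne_of_eq (fst_ne_of_mem_treePts hp) hq]
      exact add_nonneg hq0 (ih hp (hg.glue_mem (one_le_of_mem_treePts hp)))
    · rw [treeDist_succ_of_eq_of_ne hp (fst_ne_of_mem_treePts hq)]
      exact add_nonneg hp0 (ih (hg.glue_mem (one_le_of_mem_treePts hq)) hq)
    · rw [treeDist_succ_of_eq_of_eq hp hq]
      exact abs_nonneg _

lemma treeDist_triangle (hg : ValidGluing a g n) (hp : p ∈ treePts a n) (hq : q ∈ treePts a n)
    (hr : r ∈ treePts a n) : treeDist g n p r ≤ treeDist g n p q + treeDist g n q r := by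
  induction n generalizing p q r with
  | zero => simp [treeDist]
  | succ n ih =>
    have ih := fun {p q r} => @ih p q r hg.of_succ
    have nn := fun {p q} => @treeDist_nonneg a g n p q hg.of_succ
    rcases mem_treePts_succ.1 hp with hp | ⟨hp, hp0, -⟩ <;>
    rcases mem_treePts_succ.1 hq with hq | ⟨hq, hq0, -⟩ <;>
    rcases mem_treePts_succ.1 hr with hr | ⟨hr, hr0, -⟩
    · rw [treeDist_succ_of_ne_of_ne (fst_ne_of_mem_treePts hp) (fst_ne_of_mem_treePts hr),
        treeDist_succ_of_ne_of_ne (fst_ne_of_mem_treePts hp) (fst_ne_of_mem_treePts hq),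
        treeDist_succ_of_ne_of_ne (fst_ne_of_mem_treePts hq) (fst_ne_of_mem_treePts hr)]
      exact ih hp hq hr
    · rw [treeDist_succ_of_ne_of_eq (fst_ne_of_mem_treePts hp) hr,
        treeDist_succ_of_ne_of_ne (fst_ne_of_mem_treePts hp) (fst_ne_of_mem_treePts hq),
        treeDist_succ_of_ne_of_eq (fst_ne_of_mem_treePts hq) hr]
      linarith [ih hp hq (hg.glue_mem (one_le_of_mem_treePts hp))]
    · have hG := hg.glue_mem (one_le_of_mem_treePts hp)
      rw [treeDist_succ_of_ne_of_ne (fst_ne_of_mem_treePts hp) (fst_ne_of_mem_treePts hr),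
        treeDist_succ_of_ne_of_eq (fst_ne_of_mem_treePts hp) hq,
        treeDist_succ_of_eq_of_ne hq (fst_ne_of_mem_treePts hr)]
      linarith [ih hp hG hr]
    · have hG := hg.glue_mem (one_le_of_mem_treePts hp)
      rw [treeDist_succ_of_ne_of_eq (fst_ne_of_mem_treePts hp) hr,
        treeDist_succ_of_ne_of_eq (fst_ne_of_mem_treePts hp) hq,
        treeDist_succ_of_eq_of_eq hq hr]
      linarith [neg_abs_le (q.2 - r.2)]
    · have hG := hg.glue_mem (one_le_of_mem_treePts hq)
      rw [treeDist_succ_of_eq_of_ne hp (fst_ne_of_mem_treePts hr),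
        treeDist_succ_of_eq_of_ne hp (fst_ne_of_mem_treePts hq),
        treeDist_succ_of_ne_of_ne (fst_ne_of_mem_treePts hq) (fst_ne_of_mem_treePts hr)]
      linarith [ih hG hq hr]
    · have hG := hg.glue_mem (one_le_of_mem_treePts hq)
      rw [treeDist_succ_of_eq_of_eq hp hr,
        treeDist_succ_of_eq_of_ne hp (fst_ne_of_mem_treePts hq),
        treeDist_succ_of_ne_of_eq (fst_ne_of_mem_treePts hq) hr]
      -- Between two points of the new segment, a detour through T_n must pass twice through the
      -- glued end.
      have := abs_sub_le p.2 0 r.2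
      simp only [sub_zero, zero_sub, abs_neg, abs_of_nonneg hp0, abs_of_nonneg hr0] at this
      linarith [nn hG hq, nn hq hG]
    · have hG := hg.glue_mem (one_le_of_mem_treePts hr)
      rw [treeDist_succ_of_eq_of_ne hp (fst_ne_of_mem_treePts hr),
        treeDist_succ_of_eq_of_eq hp hq,
        treeDist_succ_of_eq_of_ne hq (fst_ne_of_mem_treePts hr)]
      linarith [le_abs_self (p.2 - q.2)]
    · rw [treeDist_succ_of_eq_of_eq hp hr, treeDist_succ_of_eq_of_eq hp hq,
        treeDist_succ_of_eq_of_eq hq hr]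
      exact abs_sub_le _ _ _

lemma totalLength_succ (a : ℕ → ℝ) (n : ℕ) :
    totalLength a (n + 1) = totalLength a n + a (n + 1) := by
  simp [totalLength, Finset.sum_Icc_succ_top]

lemma treeDist_root_le (ha : ∀ n, 1 ≤ n → 0 < a n) (hg : ValidGluing a g n) (hp : p ∈ treePts a n) :
    treeDist g n p treeRoot ≤ totalLength a n := by
  induction n generalizing p with
  | zero => simp [treeDist, totalLength]
  | succ n ih =>
    rw [totalLength_succ]
    rcases mem_treePts_succ.1 hp with hp | ⟨hp, hp0, hp1⟩
    · rw [treeDist_succ_of_ne_of_ne (fst_ne_of_mem_treePts hp)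
        (treeRoot_fst_ne (one_le_of_mem_treePts hp))]
      linarith [ih hg.of_succ hp, ha (n + 1) (by omega)]
    -- At level 1 the root itself lies on the newest segment, so the distance is an absolute value
    -- and not a recursive call.
    · rcases Nat.eq_zero_or_pos n with rfl | hn
      · rw [treeDist_succ_of_eq_of_eq hp rfl]
        simpa [treeRoot, totalLength, abs_of_nonneg hp0] using hp1
      · rw [treeDist_succ_of_eq_of_ne hp (treeRoot_fst_ne hn)]
        linarith [ih hg.of_succ (hg.glue_mem hn)]

lemma gromovHeight_comm (g : ℕ → ℕ × ℝ) (n : ℕ) (p q : ℕ × ℝ) :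
    gromovHeight g n p q = gromovHeight g n q p := by
  rw [gromovHeight, gromovHeight, treeDist_comm g n p q]; ring

lemma gromovHeight_succ_of_ne_of_ne (hn : 1 ≤ n) (hp : p.1 ≠ n + 1) (hq : q.1 ≠ n + 1) :
    gromovHeight g (n + 1) p q = gromovHeight g n p q := by
  rw [gromovHeight, gromovHeight, treeDist_succ_of_ne_of_ne hp (treeRoot_fst_ne hn),
    treeDist_succ_of_ne_of_ne hq (treeRoot_fst_ne hn), treeDist_succ_of_ne_of_ne hp hq]

/-- T_n sees a point of the new segment through its gluing point: the coordinate along the segment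
cancels in the Gromov product. This is the recursion behind the branching estimate. -/
lemma gromovHeight_succ_of_eq_of_ne (hn : 1 ≤ n) (hp : p.1 = n + 1) (hq : q.1 ≠ n + 1) :
    gromovHeight g (n + 1) p q = gromovHeight g n (g (n + 1)) q := by
  rw [gromovHeight, gromovHeight, treeDist_succ_of_eq_of_ne hp (treeRoot_fst_ne hn),
    treeDist_succ_of_ne_of_ne hq (treeRoot_fst_ne hn), treeDist_succ_of_eq_of_ne hp hq]
  ring

lemma gromovHeight_succ_of_ne_of_eq (hn : 1 ≤ n) (hp : p.1 ≠ n + 1) (hq : q.1 = n + 1) :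
    gromovHeight g (n + 1) p q = gromovHeight g n p (g (n + 1)) := by
  rw [gromovHeight_comm, gromovHeight_succ_of_eq_of_ne hn hq hp, gromovHeight_comm]

/-- By the triangle inequality, the Gromov product is at most the height of `p`. -/
lemma gromovHeight_le (ha : ∀ n, 1 ≤ n → 0 < a n) (hg : ValidGluing a g n)
    (hp : p ∈ treePts a n) (hq : q ∈ treePts a n) :
    gromovHeight g n p q ≤ totalLength a n := by
  have h1 := treeDist_triangle hg hq hp (treeRoot_mem (ha 1 le_rfl) (one_le_of_mem_treePts hp))
  rw [treeDist_comm g n q p] at h1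
  have h2 := treeDist_root_le ha hg hp
  rw [gromovHeight]
  linarith

/-- The branch point realizes the Gromov product. -/
lemma exists_branchPoint (hg : ValidGluing a g n)
    (hp : p ∈ treePts a n) (hq : q ∈ treePts a n) :
    ∃ z ∈ treePts a n,
      treeDist g n treeRoot z + treeDist g n z p = treeDist g n treeRoot p ∧
      treeDist g n treeRoot z + treeDist g n z q = treeDist g n treeRoot q ∧
      treeDist g n treeRoot z = gromovHeight g n p q := by
  induction n generalizing p q with
  | zero => exact absurd (one_le_of_mem_treePts hp) (by simp)
  | succ n ih =>
    have ih := fun {p q} => @ih p q hg.of_succ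
    rcases mem_treePts_succ.1 hp with hp | ⟨hp, hp0, hp1⟩ <;>
    rcases mem_treePts_succ.1 hq with hq | ⟨hq, hq0, hq1⟩
    · have hn := one_le_of_mem_treePts hp
      obtain ⟨z, hz, h1, h2, h3⟩ := ih hp hq
      refine ⟨z, mem_treePts_succ.2 (Or.inl hz), ?_⟩
      have hz' := fst_ne_of_mem_treePts hz
      have hp' := fst_ne_of_mem_treePts hp
      have hq' := fst_ne_of_mem_treePts hq
      have hr' := treeRoot_fst_ne hn
      rw [gromovHeight_succ_of_ne_of_ne hn hp' hq', treeDist_succ_of_ne_of_ne hr' hz',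
        treeDist_succ_of_ne_of_ne hr' hp', treeDist_succ_of_ne_of_ne hr' hq',
        treeDist_succ_of_ne_of_ne hz' hp', treeDist_succ_of_ne_of_ne hz' hq']
      exact ⟨h1, h2, h3⟩
    · have hn := one_le_of_mem_treePts hp
      obtain ⟨z, hz, h1, h2, h3⟩ := ih hp (hg.glue_mem hn)
      refine ⟨z, mem_treePts_succ.2 (Or.inl hz), ?_⟩
      have hz' := fst_ne_of_mem_treePts hz
      have hp' := fst_ne_of_mem_treePts hp
      have hr' := treeRoot_fst_ne hn
      rw [gromovHeight_succ_of_ne_of_eq hn hp' hq, treeDist_succ_of_ne_of_ne hr' hz',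
        treeDist_succ_of_ne_of_ne hr' hp', treeDist_succ_of_ne_of_eq hr' hq,
        treeDist_succ_of_ne_of_ne hz' hp', treeDist_succ_of_ne_of_eq hz' hq]
      exact ⟨h1, by linarith, h3⟩
    · have hn := one_le_of_mem_treePts hq
      obtain ⟨z, hz, h1, h2, h3⟩ := ih (hg.glue_mem hn) hq
      refine ⟨z, mem_treePts_succ.2 (Or.inl hz), ?_⟩
      have hz' := fst_ne_of_mem_treePts hz
      have hq' := fst_ne_of_mem_treePts hq
      have hr' := treeRoot_fst_ne hn
      rw [gromovHeight_succ_of_eq_of_ne hn hp hq', treeDist_succ_of_ne_of_ne hr' hz',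
        treeDist_succ_of_ne_of_ne hr' hq', treeDist_succ_of_ne_of_eq hr' hp,
        treeDist_succ_of_ne_of_ne hz' hq', treeDist_succ_of_ne_of_eq hz' hp]
      exact ⟨by linarith, h2, h3⟩
    -- With both points on the newest segment, the paths separate at the one nearer to the glued
    -- end.
    · refine ⟨(n + 1, min p.2 q.2), mem_treePts_succ.2
        (Or.inr ⟨rfl, le_min hp0 hq0, (min_le_left _ _).trans hp1⟩), ?_⟩
      -- One formula covers level 1 too, since the remaining term `treeDist g 0` vanishes there.
      have hroot : ∀ z : ℕ × ℝ, z.1 = n + 1 → 0 ≤ z.2 →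
          treeDist g (n + 1) treeRoot z = z.2 + treeDist g n treeRoot (g (n + 1)) := by
        intro z hz hz0
        rcases Nat.eq_zero_or_pos n with rfl | hn
        · rw [treeDist_succ_of_eq_of_eq rfl hz]
          simp [treeRoot, treeDist, abs_of_nonneg hz0]
        · rw [treeDist_succ_of_ne_of_eq (treeRoot_fst_ne hn) hz]
      rw [gromovHeight, treeDist_comm g (n + 1) p treeRoot, treeDist_comm g (n + 1) q treeRoot,
        hroot _ rfl (le_min hp0 hq0), hroot p hp hp0, hroot q hq hq0,
        treeDist_succ_of_eq_of_eq rfl hp, treeDist_succ_of_eq_of_eq rfl hq,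
        treeDist_succ_of_eq_of_eq hp hq]
      dsimp only
      rcases le_total p.2 q.2 with h | h
      · rw [min_eq_left h, abs_of_nonpos (sub_nonpos.2 h), sub_self, abs_zero]
        exact ⟨by ring, by ring, by ring⟩
      · rw [min_eq_right h, abs_of_nonneg (sub_nonneg.2 h), sub_self, abs_zero,
          abs_of_nonpos (sub_nonpos.2 h)]
        exact ⟨by ring, by ring, by ring⟩

/-- A point common to both root paths has height at most the Gromov product, by the triangle
inequality through it; `exists_branchPoint` attains the bound. The supremum over uncountably many
points thus becomes a measurable expression. -/
lemma branchHeight_eq_gromovHeight (hg : ValidGluing a g n)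
    (hp : p ∈ treePts a n) (hq : q ∈ treePts a n) :
    branchHeight a g n p q = gromovHeight g n p q := by
  obtain ⟨z, hz, h1, h2, h3⟩ := exists_branchPoint hg hp hq
  refine IsGreatest.csSup_eq ⟨⟨z, ⟨⟨hz, h1⟩, ⟨hz, h2⟩⟩, h3⟩, ?_⟩
  rintro _ ⟨w, ⟨⟨hw, hwp⟩, ⟨-, hwq⟩⟩, rfl⟩
  have := treeDist_triangle hg hp hw hq
  rw [treeDist_comm g n p w] at this
  rw [gromovHeight, treeDist_comm g n p treeRoot, treeDist_comm g n q treeRoot]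
  linarith

lemma gromovHeight_nonneg (ha : ∀ n, 1 ≤ n → 0 < a n) (hg : ValidGluing a g n)
    (hp : p ∈ treePts a n) (hq : q ∈ treePts a n) : 0 ≤ gromovHeight g n p q := by
  have := treeDist_triangle hg hp (treeRoot_mem (ha 1 le_rfl) (one_le_of_mem_treePts hp)) hq
  rw [treeDist_comm g n treeRoot q] at this
  rw [gromovHeight]
  linarith

/-- Joint measurability in the gluing points and both marked points is what every later use of
Fubini rests on. -/
lemma measurable_treeDist (n : ℕ) :
    Measurable fun x : (ℕ → ℕ × ℝ) × (ℕ × ℝ) × (ℕ × ℝ) => treeDist x.1 n x.2.1 x.2.2 := by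
  induction n with
  | zero => exact measurable_const
  | succ n ih =>
    have m1 : MeasurableSet {x : (ℕ → ℕ × ℝ) × (ℕ × ℝ) × (ℕ × ℝ) | x.2.1.1 = n + 1} :=
      (measurableSet_singleton (n + 1)).preimage (by fun_prop : Measurable
        fun x : (ℕ → ℕ × ℝ) × (ℕ × ℝ) × (ℕ × ℝ) => x.2.1.1)
    have m2 : MeasurableSet {x : (ℕ → ℕ × ℝ) × (ℕ × ℝ) × (ℕ × ℝ) | x.2.2.1 = n + 1} :=
      (measurableSet_singleton (n + 1)).preimage (by fun_prop : Measurable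
        fun x : (ℕ → ℕ × ℝ) × (ℕ × ℝ) × (ℕ × ℝ) => x.2.2.1)
    simp only [treeDist]
    refine Measurable.ite m1 (Measurable.ite m2 ?_ ?_) (Measurable.ite m2 ?_ ?_)
    · fun_prop
    · exact Measurable.add (by fun_prop) (ih.comp
        (f := fun x : (ℕ → ℕ × ℝ) × (ℕ × ℝ) × (ℕ × ℝ) => (x.1, x.1 (n + 1), x.2.2)) (by fun_prop))
    · exact Measurable.add (by fun_prop) (ih.comp
        (f := fun x : (ℕ → ℕ × ℝ) × (ℕ × ℝ) × (ℕ × ℝ) => (x.1, x.2.1, x.1 (n + 1))) (by fun_prop))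
    · exact ih

@[fun_prop]
lemma Measurable.treeDist {β : Type*} [MeasurableSpace β] {G : β → ℕ → ℕ × ℝ} {u v : β → ℕ × ℝ}
    (hG : Measurable G) (hu : Measurable u) (hv : Measurable v) :
    Measurable fun b => treeDist (G b) n (u b) (v b) :=
  (measurable_treeDist n).comp (hG.prodMk (hu.prodMk hv))

@[fun_prop]
lemma Measurable.gromovHeight {β : Type*} [MeasurableSpace β] {G : β → ℕ → ℕ × ℝ}
    {u v : β → ℕ × ℝ} (hG : Measurable G) (hu : Measurable u) (hv : Measurable v) :
    Measurable fun b => gromovHeight (G b) n (u b) (v b) := by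
  unfold _root_.gromovHeight
  fun_prop

end Geometry

/-! ### The uniform law on the tree as a mixture -/

/-- The normalized length measure of `T_n`. -/
noncomputable def unifLaw (a : ℕ → ℝ) (n : ℕ) : Measure (ℕ × ℝ) := segLength[|treePts a n]

/-- The normalized length measure of the segment `b_n`. -/
noncomputable def segLaw (a : ℕ → ℝ) (n : ℕ) : Measure (ℕ × ℝ) :=
  (volume.restrict (Set.Icc (0 : ℝ) 1)).map fun u => (n, a n * u)

/-- The proportion of the length of `T_n` that is carried by `b_n`. -/
noncomputable def segProb (a : ℕ → ℝ) (n : ℕ) : ℝ := a n / totalLength a n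

section UniformLaw

variable {a : ℕ → ℝ} {n : ℕ}

lemma measurableSet_treePts (a : ℕ → ℝ) (n : ℕ) : MeasurableSet (treePts a n) := by
  have : treePts a n = ⋃ i ∈ Finset.Icc 1 n, {i} ×ˢ Set.Icc 0 (a i) := by
    ext ⟨i, x⟩
    simp [treePts, and_assoc, and_left_comm]
  rw [this]
  exact Finset.measurableSet_biUnion _ fun i _ =>
    (measurableSet_singleton i).prod measurableSet_Icc

/-- Points are named by pairs, so the new segment is disjoint from the old tree and lengths simply
add. -/
lemma restrict_treePts_succ (a : ℕ → ℝ) (n : ℕ) :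
    segLength.restrict (treePts a (n + 1)) = segLength.restrict (treePts a n) +
      (volume.restrict (Set.Icc 0 (a (n + 1)))).map (Prod.mk (n + 1)) := by
  have h : treePts a (n + 1) = treePts a n ∪ {n + 1} ×ˢ Set.Icc 0 (a (n + 1)) := by
    ext p
    rw [mem_treePts_succ]
    simp
  rw [h, Measure.restrict_union _ ((measurableSet_singleton _).prod measurableSet_Icc)]
  · congr 1
    rw [segLength, ← Measure.prod_restrict, Measure.restrict_singleton, Measure.count_singleton,
      one_smul, Measure.dirac_prod]
  · refine Set.disjoint_left.2 fun p hp hp' => ?_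
    exact fst_ne_of_mem_treePts hp (by simpa using hp'.1)

lemma map_restrict_Icc_eq_segLaw (hn : 0 < a n) :
    (volume.restrict (Set.Icc 0 (a n))).map (Prod.mk n) = ENNReal.ofReal (a n) • segLaw a n := by
  have h1 : volume.restrict (Set.Icc 0 (a n)) =
      ENNReal.ofReal (a n) • (volume.restrict (Set.Icc (0 : ℝ) 1)).map (a n * ·) := by
    conv_lhs => rw [← Real.smul_map_volume_mul_left hn.ne', abs_of_pos hn]
    rw [Measure.restrict_smul, Measure.restrict_map (by fun_prop) measurableSet_Icc]
    congr 4
    ext x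
    simp only [Set.mem_preimage, Set.mem_Icc]
    constructor
    · rintro ⟨h1, h2⟩
      exact ⟨by nlinarith, by nlinarith⟩
    · rintro ⟨h1, h2⟩
      exact ⟨by positivity, by nlinarith⟩
  rw [h1, Measure.map_smul, Measure.map_map (by fun_prop) (by fun_prop)]
  rfl

lemma totalLength_nonneg (ha : ∀ n, 1 ≤ n → 0 < a n) (n : ℕ) : 0 ≤ totalLength a n :=
  Finset.sum_nonneg fun i hi => (ha i (Finset.mem_Icc.1 hi).1).le

lemma totalLength_pos (ha : ∀ n, 1 ≤ n → 0 < a n) (hn : 1 ≤ n) : 0 < totalLength a n :=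
  Finset.sum_pos (fun i hi => ha i (Finset.mem_Icc.1 hi).1) ⟨1, by simp [hn]⟩

lemma le_totalLength (ha : ∀ n, 1 ≤ n → 0 < a n) (hn : 1 ≤ n) : a n ≤ totalLength a n :=
  Finset.single_le_sum (f := a) (fun i hi => (ha i (Finset.mem_Icc.1 hi).1).le) (by simp [hn])

instance (n : ℕ) : IsProbabilityMeasure (segLaw a n) := by
  have : IsProbabilityMeasure (volume.restrict (Set.Icc (0 : ℝ) 1)) := ⟨by simp⟩
  exact Measure.isProbabilityMeasure_map (by fun_prop)

lemma segLength_treePts (ha : ∀ n, 1 ≤ n → 0 < a n) (n : ℕ) :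
    segLength (treePts a n) = ENNReal.ofReal (totalLength a n) := by
  induction n with
  | zero =>
    have : treePts a 0 = ∅ := Set.eq_empty_of_forall_notMem fun p hp =>
      absurd (one_le_of_mem_treePts hp) (by simp)
    simp [this, totalLength]
  | succ n ih =>
    rw [← Measure.restrict_apply_univ, restrict_treePts_succ,
      map_restrict_Icc_eq_segLaw (ha (n + 1) (by omega)), Measure.add_apply,
      Measure.restrict_apply_univ, ih, Measure.smul_apply, measure_univ, totalLength_succ,
      ENNReal.ofReal_add (totalLength_nonneg ha n) (ha (n + 1) (by omega)).le]
    simp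

lemma unifLaw_eq_smul (ha : ∀ n, 1 ≤ n → 0 < a n) (n : ℕ) :
    unifLaw a n = (ENNReal.ofReal (totalLength a n))⁻¹ • segLength.restrict (treePts a n) := by
  rw [unifLaw, ProbabilityTheory.cond, segLength_treePts ha]

lemma isProbabilityMeasure_unifLaw (ha : ∀ n, 1 ≤ n → 0 < a n) (hn : 1 ≤ n) :
    IsProbabilityMeasure (unifLaw a n) := by
  refine ⟨?_⟩
  have h := totalLength_pos ha hn
  rw [unifLaw_eq_smul ha, Measure.smul_apply, Measure.restrict_apply_univ, segLength_treePts ha,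
    smul_eq_mul, ENNReal.inv_mul_cancel (by simpa using h) (by simp)]

lemma ae_unifLaw_mem (a : ℕ → ℝ) (n : ℕ) : ∀ᵐ x ∂unifLaw a n, x ∈ treePts a n :=
  ae_cond_mem (measurableSet_treePts a n)

lemma segProb_pos (ha : ∀ n, 1 ≤ n → 0 < a n) (hn : 1 ≤ n) : 0 < segProb a n :=
  div_pos (ha n hn) (totalLength_pos ha hn)

lemma segProb_le_one (ha : ∀ n, 1 ≤ n → 0 < a n) (hn : 1 ≤ n) : segProb a n ≤ 1 :=
  (div_le_one (totalLength_pos ha hn)).2 (le_totalLength ha hn)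

/-- A uniform point of `T_(n+1)` is uniform on `b_(n+1)` or uniform on `T_n`. -/
lemma unifLaw_succ (ha : ∀ n, 1 ≤ n → 0 < a n) (hn : 1 ≤ n) :
    unifLaw a (n + 1) = ENNReal.ofReal (1 - segProb a (n + 1)) • unifLaw a n +
      ENNReal.ofReal (segProb a (n + 1)) • segLaw a (n + 1) := by
  have h0 := totalLength_pos ha hn
  have h1 := totalLength_pos ha (show 1 ≤ n + 1 by omega)
  rw [unifLaw_eq_smul ha, unifLaw_eq_smul ha, restrict_treePts_succ,
    map_restrict_Icc_eq_segLaw (ha (n + 1) (by omega)), smul_add, smul_smul, smul_smul,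
    ← ENNReal.ofReal_inv_of_pos h0, ← ENNReal.ofReal_inv_of_pos h1,
    ← ENNReal.ofReal_mul (inv_nonneg.2 h1.le),
    ← ENNReal.ofReal_mul (sub_nonneg.2 (segProb_le_one ha (by omega)))]
  congr 3
  · rw [segProb]
    have := totalLength_succ a n
    field_simp
    linarith
  · rw [segProb, div_eq_inv_mul]

end UniformLaw

/-! ### The law of the gluing points -/

/-- The law of the gluing points up to level `n`, all other entries being set to the root. -/
noncomputable def gluingLaw (a : ℕ → ℝ) : ℕ → Measure (ℕ → ℕ × ℝ)
  | 0 => Measure.dirac fun _ => treeRoot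
  | 1 => Measure.dirac fun _ => treeRoot
  | n + 2 => ((gluingLaw a (n + 1)).prod (unifLaw a (n + 1))).map
      fun x => Function.update x.1 (n + 2) x.2

section GluingLaw

variable {a : ℕ → ℝ} {n : ℕ}

lemma gluingLaw_succ (a : ℕ → ℝ) (hn : 1 ≤ n) :
    gluingLaw a (n + 1) =
      ((gluingLaw a n).prod (unifLaw a n)).map fun x => Function.update x.1 (n + 1) x.2 := by
  obtain ⟨m, rfl⟩ := Nat.exists_eq_add_of_le' hn
  rfl

lemma measurable_update_prod (i : ℕ) : Measurable fun x : (ℕ → ℕ × ℝ) × (ℕ × ℝ) =>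
    Function.update x.1 i x.2 := by
  refine measurable_pi_iff.2 fun j => ?_
  by_cases h : j = i
  · subst h
    simpa using measurable_snd
  · simp only [Function.update_of_ne h]
    fun_prop

lemma isProbabilityMeasure_gluingLaw (ha : ∀ n, 1 ≤ n → 0 < a n) (n : ℕ) :
    IsProbabilityMeasure (gluingLaw a n) := by
  induction n with
  | zero => unfold gluingLaw; infer_instance
  | succ n ih =>
    rcases Nat.eq_zero_or_pos n with rfl | hn
    · unfold gluingLaw; infer_instance
    · have := isProbabilityMeasure_unifLaw ha hn
      rw [gluingLaw_succ a hn]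
      exact Measure.isProbabilityMeasure_map (measurable_update_prod _).aemeasurable

lemma ValidGluing.update {g : ℕ → ℕ × ℝ} {y : ℕ × ℝ} (hg : ValidGluing a g n)
    (hy : y ∈ treePts a n) : ValidGluing a (Function.update g (n + 1) y) (n + 1) := by
  intro i hi hin
  rcases eq_or_lt_of_le hin with rfl | h
  · simpa using hy
  · rw [Function.update_of_ne (by omega)]
    exact hg i hi (by omega)

lemma measurableSet_validGluing (a : ℕ → ℝ) (n : ℕ) :
    MeasurableSet {g | ValidGluing a g n} := by
  have : {g | ValidGluing a g n} = ⋂ i ∈ Finset.Icc 2 n, (fun g => g i) ⁻¹' treePts a (i - 1) := by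
    ext g
    simp [ValidGluing]
  rw [this]
  exact Finset.measurableSet_biInter _ fun i _ =>
    (measurableSet_treePts a _).preimage (measurable_pi_apply i)

lemma ae_gluingLaw_valid (ha : ∀ n, 1 ≤ n → 0 < a n) (n : ℕ) :
    ∀ᵐ g ∂gluingLaw a n, ValidGluing a g n := by
  induction n with
  | zero => exact .of_forall fun g i hi hn => by omega
  | succ n ih =>
    rcases Nat.eq_zero_or_pos n with rfl | hn
    · exact .of_forall fun g i hi hn => by omega
    · have := isProbabilityMeasure_unifLaw ha hn
      have := isProbabilityMeasure_gluingLaw ha n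
      rw [gluingLaw_succ a hn, ae_map_iff (measurable_update_prod _).aemeasurable
        (measurableSet_validGluing a _)]
      filter_upwards [Measure.quasiMeasurePreserving_fst.ae ih,
        Measure.quasiMeasurePreserving_snd.ae (ae_unifLaw_mem a n)] with x h1 h2
      exact h1.update h2

/-- The metric of T_n does not read the entry `n + 1`, so drawing the next gluing point leaves it
unchanged. -/
lemma treeDist_update (g : ℕ → ℕ × ℝ) (n : ℕ) (y p q : ℕ × ℝ) :
    treeDist (Function.update g (n + 1) y) n p q = treeDist g n p q :=
  treeDist_congr (fun i _ hi => by
    have : i ≠ n + 1 := by omega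
    rw [Function.update_of_ne this]) p q

lemma gromovHeight_update (g : ℕ → ℕ × ℝ) (n : ℕ) (y p q : ℕ × ℝ) :
    gromovHeight (Function.update g (n + 1) y) n p q = gromovHeight g n p q := by
  simp only [gromovHeight, treeDist_update]

/-- Averaging over the last gluing point first plays the role of conditioning on T_n. -/
lemma lintegral_gluingLaw_succ (ha : ∀ n, 1 ≤ n → 0 < a n) (hn : 1 ≤ n)
    {f : (ℕ → ℕ × ℝ) → ENNReal} (hf : Measurable f) :
    ∫⁻ g, f g ∂gluingLaw a (n + 1) =
      ∫⁻ g, ∫⁻ y, f (Function.update g (n + 1) y) ∂unifLaw a n ∂gluingLaw a n := by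
  have := isProbabilityMeasure_unifLaw ha hn
  rw [gluingLaw_succ a hn, lintegral_map hf (measurable_update_prod _),
    lintegral_prod _ (by exact (hf.comp (measurable_update_prod (n + 1))).aemeasurable)]

lemma integral_gluingLaw_succ {E : Type*} [NormedAddCommGroup E] [NormedSpace ℝ E]
    [MeasurableSpace E] [BorelSpace E] [SecondCountableTopology E]
    (ha : ∀ n, 1 ≤ n → 0 < a n) (hn : 1 ≤ n)
    {f : (ℕ → ℕ × ℝ) → E} (hf : Measurable f) {C : ℝ} (hC : ∀ g, ‖f g‖ ≤ C) :
    ∫ g, f g ∂gluingLaw a (n + 1) =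
      ∫ g, ∫ y, f (Function.update g (n + 1) y) ∂unifLaw a n ∂gluingLaw a n := by
  have := isProbabilityMeasure_unifLaw ha hn
  have := isProbabilityMeasure_gluingLaw ha n
  rw [gluingLaw_succ a hn, integral_map (measurable_update_prod _).aemeasurable
    hf.aestronglyMeasurable, integral_prod]
  exact .of_bound (hf.comp (measurable_update_prod _)).aestronglyMeasurable C
    (.of_forall fun x => hC _)

end GluingLaw

/-! ### From the random variables to product measures -/

/-- The gluing points up to level `n`, all other entries being set to the root. -/
noncomputable def truncGlue {Ω : Type*} (glue : ℕ → Ω → ℕ × ℝ) (n : ℕ) (ω : Ω) (i : ℕ) : ℕ × ℝ :=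
  if 2 ≤ i ∧ i ≤ n then glue i ω else treeRoot

/-- Only the entries from 2 to `n` matter at level `n`; the others, whose joint law with the marks
is unknown, may be replaced by constants. -/
lemma treeDist_truncGlue {Ω : Type*} (glue : ℕ → Ω → ℕ × ℝ) (n : ℕ) (ω : Ω) (p q : ℕ × ℝ) :
    treeDist (truncGlue glue n ω) n p q = treeDist (fun i => glue i ω) n p q :=
  treeDist_congr (fun i h1 h2 => by simp [truncGlue, h1, h2]) p q

namespace IsMarkedGluing

variable {Ω : Type*} [MeasurableSpace Ω] {P : Measure Ω} {a : ℕ → ℝ} {ℓ : ℕ}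
  {glue : ℕ → Ω → ℕ × ℝ} {X : ℕ → Fin ℓ → Ω → ℕ × ℝ} {n : ℕ}

lemma measurable_truncGlue (hX : IsMarkedGluing P a ℓ glue X) (n : ℕ) :
    Measurable (truncGlue glue n) := by
  refine measurable_pi_iff.2 fun i => ?_
  unfold truncGlue
  split_ifs
  · exact hX.measurable_glue i
  · exact measurable_const

lemma measurable_mark' (hX : IsMarkedGluing P a ℓ glue X) (n : ℕ) :
    Measurable fun ω j => X n j ω := measurable_pi_iff.2 fun j => hX.measurable_mark n j

lemma map_mark (hX : IsMarkedGluing P a ℓ glue X) (hn : 1 ≤ n) (j : Fin ℓ) :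
    P.map (X n j) = unifLaw a n := hX.mark_uniform n hn j

lemma measurable_family (hX : IsMarkedGluing P a ℓ glue X) (n : ℕ)
    (i : Finset.Icc 2 n ⊕ Fin ℓ) :
    Measurable (Sum.elim (fun i : Finset.Icc 2 n => glue i) (X n) i) := by
  rcases i with i | j
  · exact hX.measurable_glue i
  · exact hX.measurable_mark n j

lemma indepFun_truncGlue_mark (hX : IsMarkedGluing P a ℓ glue X) (hn : 1 ≤ n) :
    IndepFun (truncGlue glue n) (fun ω j => X n j ω) P := by
  classical
  let S : Finset (Finset.Icc 2 n ⊕ Fin ℓ) := Finset.univ.map Function.Embedding.inl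
  let T : Finset (Finset.Icc 2 n ⊕ Fin ℓ) := Finset.univ.map Function.Embedding.inr
  have hST : Disjoint S T := by
    rw [Finset.disjoint_left]
    simp [S, T]
  have h := (hX.indep n hn).indepFun_finset S T hST (hX.measurable_family n)
  let φ : (S → ℕ × ℝ) → ℕ → ℕ × ℝ := fun f i =>
    if hi : 2 ≤ i ∧ i ≤ n then f ⟨Sum.inl ⟨i, Finset.mem_Icc.2 hi⟩, by simp [S]⟩ else treeRoot
  let χ : (T → ℕ × ℝ) → Fin ℓ → ℕ × ℝ := fun f j => f ⟨Sum.inr j, by simp [T]⟩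
  have hφ : Measurable φ := by
    refine measurable_pi_iff.2 fun i => ?_
    by_cases hi : 2 ≤ i ∧ i ≤ n
    · simp only [φ, hi, and_self, dite_true]
      exact measurable_pi_apply _
    · simp only [φ, hi, dite_false]
      exact measurable_const
  have hχ : Measurable χ := measurable_pi_iff.2 fun j => measurable_pi_apply _
  refine (h.comp hφ hχ).congr (.of_forall fun ω => ?_) (.of_forall fun ω => ?_)
  · funext i
    simp only [φ, Function.comp, truncGlue]
    split_ifs <;> rfl
  · rfl

lemma indepFun_truncGlue_glue (hX : IsMarkedGluing P a ℓ glue X) (hn : 1 ≤ n) :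
    IndepFun (truncGlue glue n) (glue (n + 1)) P := by
  classical
  let ι := Finset.Icc 2 (n + 1) ⊕ Fin ℓ
  let last : ι := Sum.inl ⟨n + 1, by simp [hn]⟩
  -- Independence is read at level `n + 1`, where `glue (n + 1)` is in the family; the marked points
  -- of that level are ignored by `φ`.
  have h := (hX.indep (n + 1) (by omega)).indepFun_finset (Finset.univ.erase last) {last}
    (by simp) (hX.measurable_family (n + 1))
  let φ : (↥(Finset.univ.erase last) → ℕ × ℝ) → ℕ → ℕ × ℝ := fun f i =>
    if hi : 2 ≤ i ∧ i ≤ n then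
      f ⟨Sum.inl ⟨i, Finset.mem_Icc.2 ⟨hi.1, by omega⟩⟩,
        Finset.mem_erase.2 ⟨fun h => by
          have : i = n + 1 := congrArg Subtype.val (Sum.inl.inj h)
          omega, Finset.mem_univ _⟩⟩
    else treeRoot
  let χ : (↥({last} : Finset ι) → ℕ × ℝ) → ℕ × ℝ := fun f => f ⟨last, by simp⟩
  have hφ : Measurable φ := by
    refine measurable_pi_iff.2 fun i => ?_
    by_cases hi : 2 ≤ i ∧ i ≤ n
    · simp only [φ, hi, and_self, dite_true]
      exact measurable_pi_apply _
    · simp only [φ, hi, dite_false]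
      exact measurable_const
  have hχ : Measurable χ := measurable_pi_apply _
  refine (h.comp hφ hχ).congr (.of_forall fun ω => ?_) (.of_forall fun ω => ?_)
  · funext i
    simp only [φ, Function.comp, truncGlue]
    split_ifs <;> rfl
  · rfl

lemma map_truncGlue [IsProbabilityMeasure P] (hX : IsMarkedGluing P a ℓ glue X) (n : ℕ) :
    P.map (truncGlue glue n) = gluingLaw a n := by
  have h0 : ∀ m ≤ 1, P.map (truncGlue glue m) = Measure.dirac fun _ => treeRoot := by
    intro m hm
    have : truncGlue glue m = fun _ _ => treeRoot := by
      funext ω i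
      rw [truncGlue, if_neg (by omega)]
    rw [this, Measure.map_const, measure_univ, one_smul]
  induction n with
  | zero => exact h0 0 (by simp)
  | succ n ih =>
    rcases Nat.eq_zero_or_pos n with rfl | hn
    · exact h0 1 le_rfl
    · have h1 : truncGlue glue (n + 1) = (fun x : (ℕ → ℕ × ℝ) × (ℕ × ℝ) =>
          Function.update x.1 (n + 1) x.2) ∘ fun ω => (truncGlue glue n ω, glue (n + 1) ω) := by
        funext ω i
        by_cases hi : i = n + 1
        · subst hi
          have : 2 ≤ n + 1 := by omega
          simp [truncGlue, this]
        · simp only [Function.comp, Function.update_of_ne hi, truncGlue]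
          congr 1
          simp only [eq_iff_iff]
          omega
      have h2 := (indepFun_iff_map_prod_eq_prod_map_map
        (hX.measurable_truncGlue n).aemeasurable
        (hX.measurable_glue (n + 1)).aemeasurable).1 (hX.indepFun_truncGlue_glue hn)
      have h3 : P.map (glue (n + 1)) = unifLaw a n := hX.glue_uniform (n + 1) (by omega)
      rw [h1, ← Measure.map_map (measurable_update_prod _)
        ((hX.measurable_truncGlue n).prodMk (hX.measurable_glue (n + 1))), h2, ih, h3,
        gluingLaw_succ a hn]

lemma map_marks [IsProbabilityMeasure P] (hX : IsMarkedGluing P a ℓ glue X) (hn : 1 ≤ n) :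
    P.map (fun ω j => X n j ω) = Measure.pi fun _ => unifLaw a n := by
  have h : iIndepFun (X n) P := (hX.indep n hn).precomp (g := Sum.inr) Sum.inr_injective
  rw [(iIndepFun_iff_map_fun_eq_pi_map fun j => (hX.measurable_mark n j).aemeasurable).1 h]
  simp only [hX.map_mark hn]

lemma map_truncGlue_marks [IsProbabilityMeasure P] (hX : IsMarkedGluing P a ℓ glue X)
    (hn : 1 ≤ n) : P.map (fun ω => (truncGlue glue n ω, fun j => X n j ω)) =
      (gluingLaw a n).prod (Measure.pi fun _ => unifLaw a n) := by
  rw [(indepFun_iff_map_prod_eq_prod_map_map (hX.measurable_truncGlue n).aemeasurable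
    (hX.measurable_mark' n).aemeasurable).1 (hX.indepFun_truncGlue_mark hn), hX.map_truncGlue,
    hX.map_marks hn]

lemma map_truncGlue_mark [IsProbabilityMeasure P] (hX : IsMarkedGluing P a ℓ glue X)
    (hn : 1 ≤ n) (j : Fin ℓ) : P.map (fun ω => (truncGlue glue n ω, X n j ω)) =
      (gluingLaw a n).prod (unifLaw a n) := by
  have h : IndepFun (truncGlue glue n) (X n j) P :=
    (hX.indepFun_truncGlue_mark hn).comp measurable_id (measurable_pi_apply j)
  rw [(indepFun_iff_map_prod_eq_prod_map_map (hX.measurable_truncGlue n).aemeasurable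
    (hX.measurable_mark n j).aemeasurable).1 h, hX.map_truncGlue, hX.map_mark hn]

lemma map_truncGlue_mark_mark [IsProbabilityMeasure P] (hX : IsMarkedGluing P a ℓ glue X)
    (hn : 1 ≤ n) {j k : Fin ℓ} (hjk : j ≠ k) :
    P.map (fun ω => (truncGlue glue n ω, X n j ω, X n k ω)) =
      (gluingLaw a n).prod ((unifLaw a n).prod (unifLaw a n)) := by
  have h : IndepFun (truncGlue glue n) (fun ω => (X n j ω, X n k ω)) P :=
    (hX.indepFun_truncGlue_mark hn).comp measurable_id
      (ψ := fun x : Fin ℓ → ℕ × ℝ => (x j, x k)) (by fun_prop)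
  have h' : IndepFun (X n j) (X n k) P :=
    (hX.indep n hn).indepFun (i := Sum.inr j) (j := Sum.inr k) (by simpa using hjk)
  have m1 := (hX.measurable_mark n j)
  have m2 := (hX.measurable_mark n k)
  rw [(indepFun_iff_map_prod_eq_prod_map_map (hX.measurable_truncGlue n).aemeasurable
    (m1.prodMk m2).aemeasurable).1 h, (indepFun_iff_map_prod_eq_prod_map_map
    m1.aemeasurable m2.aemeasurable).1 h', hX.map_truncGlue, hX.map_mark hn, hX.map_mark hn]

lemma ae_valid (ha : ∀ n, 1 ≤ n → 0 < a n) [IsProbabilityMeasure P]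
    (hX : IsMarkedGluing P a ℓ glue X) (n : ℕ) :
    ∀ᵐ ω ∂P, ValidGluing a (fun i => glue i ω) n := by
  have h := ae_gluingLaw_valid ha n
  rw [← hX.map_truncGlue, ae_map_iff (hX.measurable_truncGlue n).aemeasurable
    (measurableSet_validGluing a n)] at h
  filter_upwards [h] with ω hω i h2 hi
  have := hω i h2 hi
  simpa [truncGlue, h2, hi] using this

lemma ae_mark_mem (hX : IsMarkedGluing P a ℓ glue X) (hn : 1 ≤ n) :
    ∀ᵐ ω ∂P, ∀ j, X n j ω ∈ treePts a n := by
  refine ae_all_iff.2 fun j => ?_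
  have h := ae_unifLaw_mem a n
  rw [← hX.map_mark hn j] at h
  exact ae_of_ae_map (hX.measurable_mark n j).aemeasurable h

end IsMarkedGluing

/-! ### The random characteristic function of the height and its variance -/

/-- The exponential moment of a uniform variable on `[0, 1]`. -/
noncomputable def unifMgf (z : ℂ) : ℂ := ∫ u in (0 : ℝ)..1, Complex.exp (z * u)

/-- The real exponential moment of a uniform variable on `[0, 1]`. -/
noncomputable def unifMgfReal (t : ℝ) : ℝ := ∫ u in (0 : ℝ)..1, Real.exp (t * u)

/-- The characteristic function of the height of a uniform point of the tree with gluing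
points `g`. -/
noncomputable def heightCharFun (a : ℕ → ℝ) (t : ℝ) (n : ℕ) (g : ℕ → ℕ × ℝ) : ℂ :=
  ∫ x, Complex.exp (t * treeDist g n x treeRoot * Complex.I) ∂unifLaw a n

/-- The product to which the exponential moment at `z` of the height of a uniform point is equal. -/
noncomputable def heightProd (a : ℕ → ℝ) (z : ℂ) (n : ℕ) : ℂ :=
  ∏ i ∈ Finset.Icc 1 n, (1 + segProb a i * (unifMgf (z * a i) - 1))

section HeightCharFun

variable {a : ℕ → ℝ} {n : ℕ} {t : ℝ}

lemma norm_exp_mul_mul_I (t d : ℝ) : ‖Complex.exp (t * d * Complex.I)‖ = 1 := by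
  rw [← Complex.ofReal_mul, Complex.norm_exp_ofReal_mul_I]

lemma treeDist_root_succ_of_ne {g : ℕ → ℕ × ℝ} {x : ℕ × ℝ} (hn : 1 ≤ n) (hx : x.1 ≠ n + 1)
    (y : ℕ × ℝ) : treeDist (Function.update g (n + 1) y) (n + 1) x treeRoot =
      treeDist g n x treeRoot := by
  rw [treeDist_succ_of_ne_of_ne hx (treeRoot_fst_ne hn), treeDist_update]

lemma treeDist_root_succ_of_eq {g : ℕ → ℕ × ℝ} (hn : 1 ≤ n) (v : ℝ)
    (y : ℕ × ℝ) : treeDist (Function.update g (n + 1) y) (n + 1) (n + 1, v) treeRoot =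
      v + treeDist g n y treeRoot := by
  rw [treeDist_succ_of_eq_of_ne rfl (treeRoot_fst_ne hn), treeDist_update,
    Function.update_self]

/-- This is the contribution of a uniform point of the segment; `w` carries the exponent already
accumulated at the gluing point. -/
lemma integral_segLaw_exp (z w : ℂ) (n : ℕ) :
    ∫ u, Complex.exp (z * (a n * u : ℝ) + w) ∂volume.restrict (Set.Icc (0 : ℝ) 1) =
      unifMgf (z * a n) * Complex.exp w := by
  rw [unifMgf, intervalIntegral.integral_of_le zero_le_one, ← integral_Icc_eq_integral_Ioc,
    ← integral_mul_const]
  refine integral_congr_ae (.of_forall fun u => ?_)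
  simp only
  rw [Complex.exp_add]
  push_cast
  ring_nf

lemma integrable_exp_mul_I {β : Type*} [MeasurableSpace β] (μ : Measure β) [IsFiniteMeasure μ]
    {f : β → ℝ} (hf : Measurable f) (t : ℝ) :
    Integrable (fun x => Complex.exp (t * f x * Complex.I)) μ :=
  .of_bound (by fun_prop) 1 (.of_forall fun x => (norm_exp_mul_mul_I t (f x)).le)

/-- One step of the construction changes the random characteristic function of the height by
mixing it with the contribution of the new segment. -/
lemma heightCharFun_succ (ha : ∀ n, 1 ≤ n → 0 < a n) (hn : 1 ≤ n) (t : ℝ) (g : ℕ → ℕ × ℝ)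
    (y : ℕ × ℝ) : heightCharFun a t (n + 1) (Function.update g (n + 1) y) =
      (1 - segProb a (n + 1)) * heightCharFun a t n g + segProb a (n + 1) *
        (unifMgf (t * Complex.I * a (n + 1)) *
          Complex.exp (t * treeDist g n y treeRoot * Complex.I)) := by
  have := isProbabilityMeasure_unifLaw ha hn
  have hp0 := (segProb_pos ha (show 1 ≤ n + 1 by omega)).le
  have hp1 := segProb_le_one ha (show 1 ≤ n + 1 by omega)
  have hm : Measurable fun x : ℕ × ℝ =>
      treeDist (Function.update g (n + 1) y) (n + 1) x treeRoot := by fun_prop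
  rw [heightCharFun, unifLaw_succ ha hn, integral_add_measure, integral_smul_measure,
    integral_smul_measure, ENNReal.toReal_ofReal (sub_nonneg.2 hp1), ENNReal.toReal_ofReal hp0]
  · congr 1
    · rw [Complex.real_smul]
      push_cast
      congr 1
      refine integral_congr_ae ?_
      filter_upwards [ae_unifLaw_mem a n] with x hx
      rw [treeDist_root_succ_of_ne hn (fst_ne_of_mem_treePts hx)]
    · rw [Complex.real_smul, segLaw, integral_map (by fun_prop) (by fun_prop),
        ← integral_segLaw_exp (t * Complex.I) _ (n + 1)]
      congr 1
      refine integral_congr_ae (.of_forall fun u => ?_)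
      simp only
      rw [treeDist_root_succ_of_eq hn]
      congr 1
      push_cast
      ring
  · exact (integrable_exp_mul_I _ hm t).smul_measure ENNReal.ofReal_ne_top
  · exact (integrable_exp_mul_I _ hm t).smul_measure ENNReal.ofReal_ne_top

lemma unifLaw_one (ha : ∀ n, 1 ≤ n → 0 < a n) : unifLaw a 1 = segLaw a 1 := by
  have h0 : treePts a 0 = ∅ := Set.eq_empty_of_forall_notMem fun p hp =>
    absurd (one_le_of_mem_treePts hp) (by simp)
  have h1 := ha 1 le_rfl
  have h2 : totalLength a 1 = a 1 := by simp [totalLength]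
  rw [unifLaw_eq_smul ha, restrict_treePts_succ a 0, h0, Measure.restrict_empty, zero_add,
    map_restrict_Icc_eq_segLaw h1, h2, smul_smul,
    ENNReal.inv_mul_cancel (by simpa using h1) (by simp), one_smul]

lemma treeDist_one_root {v : ℝ} (hv : 0 ≤ v) (g : ℕ → ℕ × ℝ) :
    treeDist g 1 (1, v) treeRoot = v := by
  rw [treeDist_succ_of_eq_of_eq rfl rfl]
  simp [treeRoot, abs_of_nonneg hv]

lemma segProb_one (ha : ∀ n, 1 ≤ n → 0 < a n) : segProb a 1 = 1 := by
  simp [segProb, totalLength, (ha 1 le_rfl).ne']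

lemma heightProd_one (ha : ∀ n, 1 ≤ n → 0 < a n) (z : ℂ) :
    heightProd a z 1 = unifMgf (z * a 1) := by
  simp [heightProd, segProb_one ha]

lemma heightProd_succ (a : ℕ → ℝ) (z : ℂ) (n : ℕ) :
    heightProd a z (n + 1) =
      heightProd a z n * (1 + segProb a (n + 1) * (unifMgf (z * a (n + 1)) - 1)) := by
  simp [heightProd, Finset.prod_Icc_succ_top]

lemma heightCharFun_one (ha : ∀ n, 1 ≤ n → 0 < a n) (t : ℝ) (g : ℕ → ℕ × ℝ) :
    heightCharFun a t 1 g = heightProd a (t * Complex.I) 1 := by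
  rw [heightProd_one ha, heightCharFun, unifLaw_one ha, segLaw,
    integral_map (by fun_prop) (by fun_prop), ← mul_one (unifMgf _), ← Complex.exp_zero,
    ← integral_segLaw_exp (t * Complex.I) _ 1]
  refine setIntegral_congr_fun measurableSet_Icc fun u hu => ?_
  rw [treeDist_one_root (mul_nonneg (ha 1 le_rfl).le hu.1)]
  congr 1
  push_cast
  ring

lemma measurable_heightCharFun (ha : ∀ n, 1 ≤ n → 0 < a n) (hn : 1 ≤ n) (t : ℝ) :
    Measurable (heightCharFun a t n) := by
  have := isProbabilityMeasure_unifLaw ha hn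
  exact (StronglyMeasurable.integral_prod_right' (f := fun x : (ℕ → ℕ × ℝ) × (ℕ × ℝ) =>
    Complex.exp (t * treeDist x.1 n x.2 treeRoot * Complex.I))
    (Measurable.stronglyMeasurable (by fun_prop))).measurable

lemma norm_heightCharFun_le (ha : ∀ n, 1 ≤ n → 0 < a n) (hn : 1 ≤ n) (t : ℝ)
    (g : ℕ → ℕ × ℝ) : ‖heightCharFun a t n g‖ ≤ 1 := by
  have := isProbabilityMeasure_unifLaw ha hn
  refine (norm_integral_le_of_norm_le_const (C := 1)
    (.of_forall fun x => (norm_exp_mul_mul_I _ _).le)).trans ?_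
  simp

lemma norm_unifMgf_mul_I_le (s : ℝ) : ‖unifMgf (s * Complex.I)‖ ≤ 1 := by
  refine (intervalIntegral.norm_integral_le_of_norm_le_const (C := 1) fun u _ => ?_).trans
    (by simp)
  rw [mul_right_comm]
  exact (norm_exp_mul_mul_I s u).le

/-- The factor is a convex combination of 1 and `w`. So the products are bounded by 1 and old
fluctuations are never amplified. -/
lemma norm_one_add_mul_sub_one_le {p : ℝ} (hp0 : 0 ≤ p) (hp1 : p ≤ 1) {w : ℂ} (hw : ‖w‖ ≤ 1) :
    ‖1 + p * (w - 1)‖ ≤ 1 := by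
  have h : 1 + p * (w - 1) = ((1 - p : ℝ) : ℂ) + (p : ℝ) * w := by push_cast; ring
  rw [h]
  refine (norm_add_le _ _).trans ?_
  rw [norm_mul, Complex.norm_real, Complex.norm_real, Real.norm_of_nonneg hp0,
    Real.norm_of_nonneg (sub_nonneg.2 hp1)]
  nlinarith

lemma norm_heightProd_mul_I_le (ha : ∀ n, 1 ≤ n → 0 < a n) (t : ℝ) (n : ℕ) :
    ‖heightProd a (t * Complex.I) n‖ ≤ 1 := by
  rw [heightProd, norm_prod]
  refine Finset.prod_le_one (fun i _ => norm_nonneg _) fun i hi => ?_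
  have hi := (Finset.mem_Icc.1 hi).1
  refine norm_one_add_mul_sub_one_le (segProb_pos ha hi).le (segProb_le_one ha hi) ?_
  rw [mul_right_comm, ← Complex.ofReal_mul]
  exact norm_unifMgf_mul_I_le _

/-- The mean square distance between the random characteristic function of the height and its
mean. -/
noncomputable def heightVar (a : ℕ → ℝ) (t : ℝ) (n : ℕ) : ℝ :=
  ∫ g, ‖heightCharFun a t n g - heightProd a (t * Complex.I) n‖ ^ 2 ∂gluingLaw a n

/-- Two bounds are kept together. The constant one will dominate the series of variances; the one in
`|t| * totalLength a n` makes each fixed level vanish when `t` is rescaled. -/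
lemma norm_exp_sub_heightCharFun_le (ha : ∀ n, 1 ≤ n → 0 < a n) (hn : 1 ≤ n) {g : ℕ → ℕ × ℝ}
    (hg : ValidGluing a g n) {y : ℕ × ℝ} (hy : y ∈ treePts a n) :
    ‖Complex.exp (t * treeDist g n y treeRoot * Complex.I) - heightCharFun a t n g‖ ≤
      2 * min 1 (|t| * totalLength a n) := by
  have := isProbabilityMeasure_unifLaw ha hn
  have key : ∀ x ∈ treePts a n,
      ‖Complex.exp (t * treeDist g n x treeRoot * Complex.I) - 1‖ ≤ |t| * totalLength a n := by
    intro x hx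
    have h := Real.norm_exp_I_mul_ofReal_sub_one_le (x := t * treeDist g n x treeRoot)
    rw [mul_comm Complex.I, Complex.ofReal_mul] at h
    refine h.trans ?_
    rw [norm_mul, Real.norm_eq_abs, Real.norm_of_nonneg
      (treeDist_nonneg hg hx (treeRoot_mem (ha 1 le_rfl) hn))]
    exact mul_le_mul_of_nonneg_left (treeDist_root_le ha hg hx) (abs_nonneg t)
  have hK : ‖heightCharFun a t n g - 1‖ ≤ |t| * totalLength a n := by
    have h1 : heightCharFun a t n g - 1 =
        ∫ x, (Complex.exp (t * treeDist g n x treeRoot * Complex.I) - 1) ∂unifLaw a n := by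
      rw [integral_sub (integrable_exp_mul_I _ (by fun_prop) t) (integrable_const _)]
      simp [heightCharFun]
    rw [h1]
    refine (norm_integral_le_of_norm_le_const (C := |t| * totalLength a n) ?_).trans (by simp)
    filter_upwards [ae_unifLaw_mem a n] with x hx using key x hx
  rw [mul_min_of_nonneg _ _ zero_le_two]
  refine le_min ?_ ?_
  · refine (norm_sub_le _ _).trans ?_
    rw [norm_exp_mul_mul_I]
    linarith [norm_heightCharFun_le ha hn t g]
  · have := norm_sub_le (Complex.exp (t * treeDist g n y treeRoot * Complex.I) - 1)
      (heightCharFun a t n g - 1)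
    rw [sub_sub_sub_cancel_right] at this
    linarith [key y hy]

/-- The deviation at level `n + 1` is a contraction of the previous deviation plus an increment that
is centred given T_n. The two are orthogonal, so their mean squares add. -/
lemma heightVar_succ_le (ha : ∀ n, 1 ≤ n → 0 < a n) (hn : 1 ≤ n) (t : ℝ) :
    heightVar a t (n + 1) ≤ heightVar a t n +
      segProb a (n + 1) ^ 2 * (2 * min 1 (|t| * totalLength a n)) ^ 2 := by
  have := isProbabilityMeasure_unifLaw ha hn
  have := isProbabilityMeasure_gluingLaw ha n
  have hp0 := (segProb_pos ha (show 1 ≤ n + 1 by omega)).le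
  have hp1 := segProb_le_one ha (show 1 ≤ n + 1 by omega)
  set p := segProb a (n + 1) with hp
  set w := unifMgf (t * Complex.I * a (n + 1)) with hw
  have hw1 : ‖w‖ ≤ 1 := by
    rw [hw, mul_right_comm, ← Complex.ofReal_mul]
    exact norm_unifMgf_mul_I_le _
  set B := 2 * min 1 (|t| * totalLength a n) with hB
  have hbound : ∀ m, 1 ≤ m → ∀ g,
      ‖heightCharFun a t m g - heightProd a (t * Complex.I) m‖ ^ 2 ≤ 4 := by
    intro m hm g
    have := norm_sub_le (heightCharFun a t m g) (heightProd a (t * Complex.I) m)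
    nlinarith [norm_heightCharFun_le ha hm t g, norm_heightProd_mul_I_le ha t m,
      norm_nonneg (heightCharFun a t m g - heightProd a (t * Complex.I) m)]
  have hmeas : ∀ m, 1 ≤ m → Measurable fun g =>
      ‖heightCharFun a t m g - heightProd a (t * Complex.I) m‖ ^ 2 := fun m hm =>
    ((measurable_heightCharFun ha hm t).sub_const _).norm.pow_const 2
  rw [heightVar, integral_gluingLaw_succ ha hn (hmeas _ (by omega)) (C := 4) (fun g => by
    rw [Real.norm_of_nonneg (by positivity)]; exact hbound _ (by omega) g)]
  have hstep : ∀ᵐ g ∂gluingLaw a n,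
      ∫ y, ‖heightCharFun a t (n + 1) (Function.update g (n + 1) y) -
        heightProd a (t * Complex.I) (n + 1)‖ ^ 2 ∂unifLaw a n ≤
      ‖heightCharFun a t n g - heightProd a (t * Complex.I) n‖ ^ 2 + p ^ 2 * B ^ 2 := by
    filter_upwards [ae_gluingLaw_valid ha n] with g hg
    set K := heightCharFun a t n g with hK
    set φ := heightProd a (t * Complex.I) n with hφ
    set e : ℕ × ℝ → ℂ := fun y => Complex.exp (t * treeDist g n y treeRoot * Complex.I) with he
    have hei : Integrable e (unifLaw a n) := integrable_exp_mul_I _ (by fun_prop) t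
    have hdecomp : ∀ y, heightCharFun a t (n + 1) (Function.update g (n + 1) y) -
        heightProd a (t * Complex.I) (n + 1) =
        (1 + p * (w - 1)) * (K - φ) + p * w * (e y - K) := by
      intro y
      rw [heightCharFun_succ ha hn, heightProd_succ]
      simp only [he]
      ring
    set u := (1 + p * (w - 1)) * (K - φ) with hu
    have hsq : ∀ y, ‖u + p * w * (e y - K)‖ ^ 2 =
        ‖u‖ ^ 2 + 2 * inner ℝ u (p * w * (e y - K)) + ‖p * w * (e y - K)‖ ^ 2 :=
      fun y => norm_add_sq_real _ _
    simp only [hdecomp, hsq]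
    have hI : Integrable (fun y => (p : ℂ) * w * (e y - K)) (unifLaw a n) :=
      (hei.sub (integrable_const _)).const_mul _
    have hI2 : Integrable (fun y => inner ℝ u (p * w * (e y - K))) (unifLaw a n) :=
      hI.const_inner u
    -- The cross term disappears because `K` is exactly the mean of `e` over the uniform gluing
    -- point.
    have hzero : ∫ y, inner ℝ u (p * w * (e y - K)) ∂unifLaw a n = 0 := by
      rw [integral_inner hI, integral_const_mul, integral_sub hei (integrable_const _)]
      have : ∫ y, e y ∂unifLaw a n = K := rfl
      simp [this]
    have hle : ∀ᵐ y ∂unifLaw a n, ‖p * w * (e y - K)‖ ^ 2 ≤ p ^ 2 * B ^ 2 := by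
      filter_upwards [ae_unifLaw_mem a n] with y hy
      rw [← mul_pow]
      refine pow_le_pow_left₀ (norm_nonneg _) ?_ 2
      rw [norm_mul, norm_mul, Complex.norm_real, Real.norm_of_nonneg hp0]
      have h1 := norm_exp_sub_heightCharFun_le (t := t) ha hn hg hy
      refine mul_le_mul ?_ h1 (norm_nonneg _) hp0
      exact mul_le_of_le_one_right hp0 hw1
    have hm3 : Measurable fun y => ‖(p : ℂ) * w * (e y - K)‖ ^ 2 := by
      simp only [he]
      fun_prop
    have hI3 : Integrable (fun y => ‖(p : ℂ) * w * (e y - K)‖ ^ 2) (unifLaw a n) := by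
      refine .of_bound hm3.aestronglyMeasurable (p ^ 2 * B ^ 2) ?_
      filter_upwards [hle] with y hy
      rwa [Real.norm_of_nonneg (by positivity)]
    have hI1 : Integrable (fun y => ‖u‖ ^ 2 + 2 * inner ℝ u (p * w * (e y - K)))
        (unifLaw a n) := (integrable_const _).add (hI2.const_mul 2)
    rw [integral_add hI1 hI3, integral_add (integrable_const _) (hI2.const_mul 2),
      integral_const_mul, hzero]
    have h1 : ∫ y, ‖p * w * (e y - K)‖ ^ 2 ∂unifLaw a n ≤ p ^ 2 * B ^ 2 := by
      have := integral_mono_ae hI3 (integrable_const _) hle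
      simpa using this
    have h2 : ‖u‖ ^ 2 ≤ ‖K - φ‖ ^ 2 := by
      refine pow_le_pow_left₀ (norm_nonneg _) ?_ 2
      rw [hu, norm_mul]
      exact mul_le_of_le_one_left (norm_nonneg _) (norm_one_add_mul_sub_one_le hp0 hp1 hw1)
    simp only [integral_const, probReal_univ, smul_eq_mul, one_mul, mul_zero, add_zero]
    linarith
  have hIv : Integrable (fun g => ‖heightCharFun a t n g - heightProd a (t * Complex.I) n‖ ^ 2)
      (gluingLaw a n) := by
    refine .of_bound (hmeas n hn).aestronglyMeasurable 4 (.of_forall fun g => ?_)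
    rw [Real.norm_of_nonneg (by positivity)]
    exact hbound n hn g
  have hfin := integral_mono_of_nonneg (.of_forall fun g => integral_nonneg fun y => by positivity)
    (hIv.add (integrable_const (p ^ 2 * B ^ 2))) hstep
  refine hfin.trans (le_of_eq ?_)
  simp only [Pi.add_apply]
  rw [integral_add hIv (integrable_const _), heightVar]
  simp

lemma heightVar_le_sum (ha : ∀ n, 1 ≤ n → 0 < a n) (hn : 1 ≤ n) (t : ℝ) :
    heightVar a t n ≤ ∑ i ∈ Finset.Ico 1 n,
      segProb a (i + 1) ^ 2 * (2 * min 1 (|t| * totalLength a i)) ^ 2 := by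
  induction n, hn using Nat.le_induction with
  | base => simp [heightVar, heightCharFun_one ha]
  | succ n hn ih =>
    rw [Finset.sum_Ico_succ_top hn]
    exact (heightVar_succ_le ha hn t).trans (by gcongr)

end HeightCharFun

/-! ### Asymptotic independence of the heights -/

section Decorrelation

variable {a : ℕ → ℝ}

/-- Replace the factors one at a time; all the others have norm at most 1. -/
lemma norm_prod_sub_prod_le_sum {ι : Type*} (s : Finset ι) {u v : ι → ℂ}
    (hu : ∀ i ∈ s, ‖u i‖ ≤ 1) (hv : ∀ i ∈ s, ‖v i‖ ≤ 1) :
    ‖∏ i ∈ s, u i - ∏ i ∈ s, v i‖ ≤ ∑ i ∈ s, ‖u i - v i‖ := by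
  classical
  induction s using Finset.induction_on with
  | empty => simp
  | insert i s hi ih =>
    have ih := ih (fun j hj => hu j (Finset.mem_insert_of_mem hj))
      fun j hj => hv j (Finset.mem_insert_of_mem hj)
    rw [Finset.prod_insert hi, Finset.prod_insert hi, Finset.sum_insert hi]
    have h : u i * ∏ j ∈ s, u j - v i * ∏ j ∈ s, v j =
        (u i - v i) * ∏ j ∈ s, u j + v i * (∏ j ∈ s, u j - ∏ j ∈ s, v j) := by ring
    rw [h]
    refine (norm_add_le _ _).trans ?_
    rw [norm_mul, norm_mul]
    have h1 : ‖∏ j ∈ s, u j‖ ≤ 1 := by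
      rw [norm_prod]
      exact Finset.prod_le_one (fun _ _ => norm_nonneg _)
        fun j hj => hu j (Finset.mem_insert_of_mem hj)
    have h2 := hv i (Finset.mem_insert_self i s)
    refine add_le_add (mul_le_of_le_one_right (norm_nonneg _) h1) ?_
    exact (mul_le_of_le_one_left (norm_nonneg _) h2).trans ih

/-- Dominated convergence for the series of variance increments: each level tends to 0 as its total
length is fixed while `N n` grows, and the squares of `segProb`, times 4, dominate. -/
lemma tendsto_heightVar (ha : ∀ n, 1 ≤ n → 0 < a n)
    (hs : Summable fun i => segProb a (i + 1) ^ 2) {N : ℕ → ℝ} (hN : Tendsto N atTop atTop)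
    (t : ℝ) : Tendsto (fun n => heightVar a (t / N n) n) atTop (𝓝 0) := by
  let F : ℕ → ℕ → ℝ := fun n i => if i ∈ Finset.Ico 1 n then
    segProb a (i + 1) ^ 2 * (2 * min 1 (|t / N n| * totalLength a i)) ^ 2 else 0
  have hle : ∀ᶠ n in atTop, heightVar a (t / N n) n ≤ ∑' i, F n i := by
    filter_upwards [eventually_ge_atTop 1] with n hn
    refine (heightVar_le_sum ha hn _).trans (le_of_eq ?_)
    rw [tsum_eq_sum (s := Finset.Ico 1 n) fun i hi => if_neg hi]
    exact Finset.sum_congr rfl fun i hi => (if_pos hi).symm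
  have hlim : Tendsto (fun n => ∑' i, F n i) atTop (𝓝 (∑' i : ℕ, (0 : ℝ))) := by
    refine tendsto_tsum_of_dominated_convergence (bound := fun i => segProb a (i + 1) ^ 2 * 4)
      (hs.mul_right 4) (fun i => ?_) (.of_forall fun n i => ?_)
    · have h0 : Tendsto (fun n => segProb a (i + 1) ^ 2 *
          (2 * min 1 (|t / N n| * totalLength a i)) ^ 2) atTop (𝓝 0) := by
        have h1 : Tendsto (fun n => |t / N n| * totalLength a i) atTop (𝓝 0) := by
          simpa using ((hN.const_div_atTop t).abs).mul_const (totalLength a i)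
        have h2 := (((tendsto_const_nhds (x := (1 : ℝ))).min h1).const_mul 2).pow 2
        simpa using h2.const_mul (segProb a (i + 1) ^ 2)
      refine squeeze_zero (fun n => ?_) (fun n => ?_) h0
      · simp only [F]; split_ifs <;> positivity
      · simp only [F]; split_ifs
        · exact le_rfl
        · positivity
    · have h0 : 0 ≤ min 1 (|t / N n| * totalLength a i) :=
        le_min zero_le_one (mul_nonneg (abs_nonneg _) (totalLength_nonneg ha i))
      have h1 : min 1 (|t / N n| * totalLength a i) ≤ 1 := min_le_left _ _
      simp only [F]
      split_ifs
      · rw [Real.norm_of_nonneg (by positivity)]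
        exact mul_le_mul_of_nonneg_left (by nlinarith) (by positivity)
      · simp only [norm_zero]; positivity
  rw [tsum_zero] at hlim
  exact tendsto_of_tendsto_of_tendsto_of_le_of_le' tendsto_const_nhds hlim
    (.of_forall fun n => integral_nonneg fun g => by positivity) hle

/-- The heights of several uniform points are asymptotically independent. -/
lemma tendsto_integral_prod_heightCharFun_sub (ha : ∀ n, 1 ≤ n → 0 < a n)
    (hs : Summable fun i => segProb a (i + 1) ^ 2) {N : ℕ → ℝ} (hN : Tendsto N atTop atTop)
    {ℓ : ℕ} (t : Fin ℓ → ℝ) :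
    Tendsto (fun n => ∫ g, ∏ j, heightCharFun a (t j / N n) n g ∂gluingLaw a n -
      ∏ j, heightProd a ((t j / N n : ℝ) * Complex.I) n) atTop (𝓝 0) := by
  rw [Metric.tendsto_atTop']
  intro ε hε
  have hδ : 0 < ε / (2 * (ℓ + 1)) := by positivity
  set δ := ε / (2 * (ℓ + 1)) with hδ_def
  have hev : ∀ᶠ n in atTop, ∀ j : Fin ℓ, heightVar a (t j / N n) n < δ ^ 2 :=
    eventually_all.2 fun j => (tendsto_heightVar ha hs hN (t j)).eventually
      (gt_mem_nhds (by positivity))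
  obtain ⟨n₀, h₀⟩ := eventually_atTop.1 hev
  refine ⟨max n₀ 1, fun n hn => ?_⟩
  have hn1 : 1 ≤ n := (le_max_right _ _).trans hn.le
  have := isProbabilityMeasure_gluingLaw ha n
  have hv := h₀ n ((le_max_left _ _).trans hn.le)
  rw [dist_zero_right]
  have hmK := fun j => measurable_heightCharFun ha hn1 (t j / N n)
  have hKi : Integrable (fun g => ∏ j, heightCharFun a (t j / N n) n g) (gluingLaw a n) := by
    refine .of_bound (Finset.measurable_prod _ fun j _ => hmK j).aestronglyMeasurable 1
      (.of_forall fun g => ?_)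
    rw [norm_prod]
    exact Finset.prod_le_one (fun _ _ => norm_nonneg _)
      fun j _ => norm_heightCharFun_le ha hn1 _ g
  have hdiff : ∀ j, Integrable (fun g => ‖heightCharFun a (t j / N n) n g -
      heightProd a ((t j / N n : ℝ) * Complex.I) n‖ ^ 2) (gluingLaw a n) := fun j => by
    refine .of_bound (((hmK j).sub_const _).norm.pow_const 2).aestronglyMeasurable 4
      (.of_forall fun g => ?_)
    rw [Real.norm_of_nonneg (by positivity)]
    have := norm_sub_le (heightCharFun a (t j / N n) n g)
      (heightProd a ((t j / N n : ℝ) * Complex.I) n)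
    nlinarith [norm_heightCharFun_le ha hn1 (t j / N n) g,
      norm_heightProd_mul_I_le ha (t j / N n) n, norm_nonneg (heightCharFun a (t j / N n) n g -
      heightProd a ((t j / N n : ℝ) * Complex.I) n)]
  have h1 : ∫ g, ∏ j, heightCharFun a (t j / N n) n g ∂gluingLaw a n -
      ∏ j, heightProd a ((t j / N n : ℝ) * Complex.I) n =
      ∫ g, (∏ j, heightCharFun a (t j / N n) n g -
        ∏ j, heightProd a ((t j / N n : ℝ) * Complex.I) n) ∂gluingLaw a n := by
    rw [integral_sub hKi (integrable_const _)]
    simp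
  -- The inequality x ≤ δ/2 + x²/(2δ) converts the mean-square estimate into a first-moment one.
  -- Each mark then costs at most δ, and ℓ δ < ε by the choice of δ.
  have hpt : ∀ g, ‖∏ j, heightCharFun a (t j / N n) n g -
      ∏ j, heightProd a ((t j / N n : ℝ) * Complex.I) n‖ ≤
      ∑ j, (δ / 2 + ‖heightCharFun a (t j / N n) n g -
      heightProd a ((t j / N n : ℝ) * Complex.I) n‖ ^ 2 / (2 * δ)) := by
    intro g
    refine (norm_prod_sub_prod_le_sum _ (fun j _ => norm_heightCharFun_le ha hn1 _ g)
      fun j _ => norm_heightProd_mul_I_le ha _ n).trans (Finset.sum_le_sum fun j _ => ?_)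
    set x := ‖heightCharFun a (t j / N n) n g - heightProd a ((t j / N n : ℝ) * Complex.I) n‖
    have : δ / 2 + x ^ 2 / (2 * δ) - x = (δ - x) ^ 2 / (2 * δ) := by field_simp; ring
    have h3 : 0 ≤ (δ - x) ^ 2 / (2 * δ) := by positivity
    linarith
  rw [h1]
  refine (norm_integral_le_of_norm_le (integrable_finsetSum _ fun j _ =>
    (integrable_const (δ / 2)).add ((hdiff j).div_const (2 * δ))) (.of_forall hpt)).trans_lt ?_
  rw [integral_finsetSum _ fun j _ =>
    (integrable_const (δ / 2)).add ((hdiff j).div_const (2 * δ))]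
  have h2 : ∀ j, ∫ g, (δ / 2 + ‖heightCharFun a (t j / N n) n g -
      heightProd a ((t j / N n : ℝ) * Complex.I) n‖ ^ 2 / (2 * δ)) ∂gluingLaw a n ≤ δ := by
    intro j
    rw [integral_add (integrable_const _) ((hdiff j).div_const _), integral_div (2 * δ)]
    have := (hv j).le
    rw [heightVar] at this
    have h4 : (∫ g, ‖heightCharFun a (t j / N n) n g -
      heightProd a ((t j / N n : ℝ) * Complex.I) n‖ ^ 2 ∂gluingLaw a n) / (2 * δ) ≤ δ / 2 := by
      rw [div_le_iff₀ (by positivity)]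
      nlinarith
    simp only [integral_const, probReal_univ, smul_eq_mul, one_mul]
    linarith
  refine (Finset.sum_le_sum fun j _ => h2 j).trans_lt ?_
  simp only [Finset.sum_const, Finset.card_univ, Fintype.card_fin, nsmul_eq_mul]
  rw [hδ_def, mul_div_assoc', div_lt_iff₀ (by positivity)]
  nlinarith [(Nat.cast_nonneg ℓ : (0 : ℝ) ≤ ℓ)]

end Decorrelation

/-! ### Real exponential moments of the height -/

section Mgf

variable {a : ℕ → ℝ} {n : ℕ}

/-- The exponential moment of the height of a uniform point of the random tree. -/
noncomputable def heightMgf (a : ℕ → ℝ) (t : ℝ) (n : ℕ) : ENNReal :=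
  ∫⁻ g, ∫⁻ x, ENNReal.ofReal (Real.exp (t * treeDist g n x treeRoot)) ∂unifLaw a n ∂gluingLaw a n

lemma unifMgfReal_nonneg (t : ℝ) : 0 ≤ unifMgfReal t :=
  intervalIntegral.integral_nonneg zero_le_one fun _ _ => (Real.exp_pos _).le

lemma lintegral_exp_mul_Icc (t c : ℝ) :
    ∫⁻ u in Set.Icc (0 : ℝ) 1, ENNReal.ofReal (Real.exp (t * (c * u))) =
      ENNReal.ofReal (unifMgfReal (t * c)) := by
  rw [unifMgfReal, intervalIntegral.integral_of_le zero_le_one, ← integral_Icc_eq_integral_Ioc,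
    ofReal_integral_eq_lintegral_ofReal]
  · simp only [mul_assoc]
  · exact Continuous.integrableOn_Icc (by fun_prop)
  · exact .of_forall fun u => (Real.exp_pos _).le

lemma lintegral_unifLaw_succ (ha : ∀ n, 1 ≤ n → 0 < a n) (hn : 1 ≤ n) (f : ℕ × ℝ → ENNReal) :
    ∫⁻ x, f x ∂unifLaw a (n + 1) =
      ENNReal.ofReal (1 - segProb a (n + 1)) * ∫⁻ x, f x ∂unifLaw a n +
      ENNReal.ofReal (segProb a (n + 1)) * ∫⁻ x, f x ∂segLaw a (n + 1) := by
  rw [unifLaw_succ ha hn, lintegral_add_measure, lintegral_smul_measure, lintegral_smul_measure,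
    smul_eq_mul, smul_eq_mul]

lemma lintegral_segLaw {f : ℕ × ℝ → ENNReal} (hf : Measurable f) :
    ∫⁻ x, f x ∂segLaw a n = ∫⁻ u in Set.Icc (0 : ℝ) 1, f (n, a n * u) := by
  rw [segLaw, lintegral_map hf (by fun_prop)]

/-- Only the mean is needed here, so averaging over the gluing point closes the recursion exactly.
Working in `ENNReal` avoids any integrability question. -/
lemma heightMgf_succ (ha : ∀ n, 1 ≤ n → 0 < a n) (hn : 1 ≤ n) (t : ℝ) :
    heightMgf a t (n + 1) = heightMgf a t n *
      ENNReal.ofReal (1 + segProb a (n + 1) * (unifMgfReal (t * a (n + 1)) - 1)) := by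
  have := isProbabilityMeasure_unifLaw ha hn
  have := isProbabilityMeasure_unifLaw ha (show 1 ≤ n + 1 by omega)
  have := isProbabilityMeasure_gluingLaw ha n
  have hp0 := (segProb_pos ha (show 1 ≤ n + 1 by omega)).le
  have hp1 := segProb_le_one ha (show 1 ≤ n + 1 by omega)
  set p := segProb a (n + 1)
  set w := unifMgfReal (t * a (n + 1)) with hw
  have hw0 : 0 ≤ w := unifMgfReal_nonneg _
  have hm : ∀ m, Measurable fun x : (ℕ → ℕ × ℝ) × (ℕ × ℝ) =>
      ENNReal.ofReal (Real.exp (t * treeDist x.1 m x.2 treeRoot)) := fun m => by fun_prop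
  have hinner : ∀ g y, ∫⁻ x, ENNReal.ofReal (Real.exp (t *
      treeDist (Function.update g (n + 1) y) (n + 1) x treeRoot)) ∂unifLaw a (n + 1) =
      ENNReal.ofReal (1 - p) * ∫⁻ x, ENNReal.ofReal (Real.exp (t * treeDist g n x treeRoot))
        ∂unifLaw a n + ENNReal.ofReal p * (ENNReal.ofReal w *
          ENNReal.ofReal (Real.exp (t * treeDist g n y treeRoot))) := by
    intro g y
    rw [lintegral_unifLaw_succ ha hn]
    congr 2
    · refine lintegral_congr_ae ?_
      filter_upwards [ae_unifLaw_mem a n] with x hx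
      rw [treeDist_root_succ_of_ne hn (fst_ne_of_mem_treePts hx)]
    · rw [lintegral_segLaw (by fun_prop), hw, ← lintegral_exp_mul_Icc,
        ← lintegral_mul_const _ (by fun_prop)]
      refine lintegral_congr fun u => ?_
      rw [treeDist_root_succ_of_eq hn, mul_add, Real.exp_add, ENNReal.ofReal_mul (by positivity)]
  have hy : ∀ g, Measurable fun y => ENNReal.ofReal (Real.exp (t * treeDist g n y treeRoot)) :=
    fun g => by fun_prop
  rw [heightMgf, lintegral_gluingLaw_succ ha hn (hm (n + 1)).lintegral_prod_right]
  have hstep : ∀ g, ∫⁻ y, ∫⁻ x, ENNReal.ofReal (Real.exp (t *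
      treeDist (Function.update g (n + 1) y) (n + 1) x treeRoot)) ∂unifLaw a (n + 1)
        ∂unifLaw a n = (∫⁻ x, ENNReal.ofReal (Real.exp (t * treeDist g n x treeRoot))
        ∂unifLaw a n) * ENNReal.ofReal (1 + p * (w - 1)) := by
    intro g
    simp only [hinner]
    rw [lintegral_add_left measurable_const, lintegral_const, measure_univ, mul_one,
      lintegral_const_mul _ ((hy g).const_mul _), lintegral_const_mul _ (hy g), ← mul_assoc,
      ← add_mul, ← ENNReal.ofReal_mul hp0, ← ENNReal.ofReal_add (sub_nonneg.2 hp1)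
      (mul_nonneg hp0 hw0), mul_comm]
    congr 2
    ring
  simp only [hstep]
  rw [lintegral_mul_const _ (hm n).lintegral_prod_right, heightMgf]

lemma heightMgf_eq (ha : ∀ n, 1 ≤ n → 0 < a n) (hn : 1 ≤ n) (t : ℝ) :
    heightMgf a t n = ENNReal.ofReal
      (∏ i ∈ Finset.Icc 1 n, (1 + segProb a i * (unifMgfReal (t * a i) - 1))) := by
  induction n, hn using Nat.le_induction with
  | base =>
    have h : ∀ g, ∫⁻ x, ENNReal.ofReal (Real.exp (t * treeDist g 1 x treeRoot)) ∂unifLaw a 1 =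
        ENNReal.ofReal (unifMgfReal (t * a 1)) := by
      intro g
      rw [unifLaw_one ha, lintegral_segLaw (by fun_prop), ← lintegral_exp_mul_Icc]
      refine setLIntegral_congr_fun measurableSet_Icc fun u hu => ?_
      rw [treeDist_one_root (mul_nonneg (ha 1 le_rfl).le hu.1)]
    have := isProbabilityMeasure_gluingLaw ha 1
    simp [heightMgf, h, segProb_one ha]
  | succ n hn ih =>
    rw [heightMgf_succ ha hn, ih, Finset.prod_Icc_succ_top (by omega), ENNReal.ofReal_mul]
    refine Finset.prod_nonneg fun i hi => ?_
    have hi := (Finset.mem_Icc.1 hi).1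
    nlinarith [segProb_pos ha hi, segProb_le_one ha hi, unifMgfReal_nonneg (t * a i)]

end Mgf

/-! ### Tightness of the branch heights -/

section Branching

variable {a : ℕ → ℝ} {n : ℕ}

/-- The probability that the branch point of two uniform points is higher than `h`. -/
noncomputable def branchProb (a : ℕ → ℝ) (h : ℝ) (n : ℕ) : ENNReal :=
  ∫⁻ g, ∫⁻ x, ∫⁻ y, (Set.Ioi h).indicator 1 (gromovHeight g n x y)
    ∂unifLaw a n ∂unifLaw a n ∂gluingLaw a n

/-- If one point falls on the new segment, it may be replaced by the gluing point, which is uniform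
in T_n; if none does, nothing changes. Only the event that both fall on the new segment can add
probability. -/
lemma branchProb_succ_le (ha : ∀ n, 1 ≤ n → 0 < a n) (hn : 1 ≤ n) (h : ℝ) :
    branchProb a h (n + 1) ≤ branchProb a h n + ENNReal.ofReal (segProb a (n + 1) ^ 2) := by
  have := isProbabilityMeasure_unifLaw ha hn
  have := isProbabilityMeasure_unifLaw ha (show 1 ≤ n + 1 by omega)
  have := isProbabilityMeasure_gluingLaw ha n
  have hp0 := (segProb_pos ha (show 1 ≤ n + 1 by omega)).le
  have hp1 := segProb_le_one ha (show 1 ≤ n + 1 by omega)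
  have hp : ENNReal.ofReal (1 - segProb a (n + 1)) + ENNReal.ofReal (segProb a (n + 1)) = 1 := by
    rw [← ENNReal.ofReal_add (sub_nonneg.2 hp1) hp0]
    simp
  have hsq : ENNReal.ofReal (segProb a (n + 1) ^ 2) =
      ENNReal.ofReal (segProb a (n + 1)) * ENNReal.ofReal (segProb a (n + 1)) := by
    rw [sq, ENNReal.ofReal_mul hp0]
  rw [hsq]
  set p := ENNReal.ofReal (segProb a (n + 1))
  set q := ENNReal.ofReal (1 - segProb a (n + 1))
  have hind : Measurable ((Set.Ioi h).indicator (1 : ℝ → ENNReal)) :=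
    measurable_one.indicator measurableSet_Ioi
  have hF : ∀ m, Measurable fun x : (ℕ → ℕ × ℝ) × (ℕ × ℝ) × (ℕ × ℝ) =>
      (Set.Ioi h).indicator (1 : ℝ → ENNReal) (gromovHeight x.1 m x.2.1 x.2.2) := fun m =>
    hind.comp (by fun_prop)
  set F : ℕ → (ℕ → ℕ × ℝ) → ℕ × ℝ → ℕ × ℝ → ENNReal := fun m g x y =>
    (Set.Ioi h).indicator 1 (gromovHeight g m x y) with hFdef
  have hF' : ∀ m {β : Type} [MeasurableSpace β] {G : β → ℕ → ℕ × ℝ} {u v : β → ℕ × ℝ},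
      Measurable G → Measurable u → Measurable v → Measurable fun b => F m (G b) (u b) (v b) :=
    fun m _ _ _ _ _ hG hu hv => (hF m).comp (hG.prodMk (hu.prodMk hv))
  have hF1 : ∀ m g x y, F m g x y ≤ 1 := fun m g x y => Set.indicator_le_self' (by simp) _
  -- The four products of `q` and `p` record which of the two points lie on the new segment; when
  -- both do, the indicator is bounded by 1.
  have hint : ∀ g z, ∫⁻ x, ∫⁻ y, F (n + 1) (Function.update g (n + 1) z) x y
      ∂unifLaw a (n + 1) ∂unifLaw a (n + 1) ≤
      q * (q * ∫⁻ x, ∫⁻ y, F n g x y ∂unifLaw a n ∂unifLaw a n +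
        p * ∫⁻ x, F n g x z ∂unifLaw a n) +
      p * (q * ∫⁻ y, F n g z y ∂unifLaw a n + p) := by
    intro g z
    rw [lintegral_unifLaw_succ ha hn]
    gcongr
    · have e : ∀ᵐ x ∂unifLaw a n, ∫⁻ y, F (n + 1) (Function.update g (n + 1) z) x y
          ∂unifLaw a (n + 1) = q * ∫⁻ y, F n g x y ∂unifLaw a n + p * F n g x z := by
        filter_upwards [ae_unifLaw_mem a n] with x hx
        have hx := fst_ne_of_mem_treePts hx
        rw [lintegral_unifLaw_succ ha hn]
        congr 2
        · refine lintegral_congr_ae ?_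
          filter_upwards [ae_unifLaw_mem a n] with y hy
          simp only [F]
          rw [gromovHeight_succ_of_ne_of_ne hn hx (fst_ne_of_mem_treePts hy),
            gromovHeight_update]
        · rw [lintegral_segLaw (by exact hF' _ measurable_const measurable_const measurable_id)]
          have : ∀ u : ℝ, F (n + 1) (Function.update g (n + 1) z) x
              (n + 1, a (n + 1) * u) = F n g x z := by
            intro u
            simp only [F]
            rw [gromovHeight_succ_of_ne_of_eq hn hx rfl, gromovHeight_update,
              Function.update_self]
          simp [this]
      rw [lintegral_congr_ae e, lintegral_add_left, lintegral_const_mul, lintegral_const_mul]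
      · exact hF' n measurable_const measurable_id measurable_const
      · exact Measurable.lintegral_prod_right' (f := fun x : (ℕ × ℝ) × (ℕ × ℝ) => F n g x.1 x.2)
          (hF' n measurable_const measurable_fst measurable_snd)
      · exact (Measurable.lintegral_prod_right' (f := fun x : (ℕ × ℝ) × (ℕ × ℝ) => F n g x.1 x.2)
          (hF' n measurable_const measurable_fst measurable_snd)).const_mul _
    · rw [lintegral_segLaw (Measurable.lintegral_prod_right'
        (f := fun x : (ℕ × ℝ) × (ℕ × ℝ) => F (n + 1) (Function.update g (n + 1) z) x.1 x.2)
          (hF' (n + 1) measurable_const measurable_fst measurable_snd))]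
      have e : ∀ u : ℝ, ∫⁻ y, F (n + 1) (Function.update g (n + 1) z) (n + 1, a (n + 1) * u) y
          ∂unifLaw a (n + 1) ≤ q * ∫⁻ y, F n g z y ∂unifLaw a n + p := by
        intro u
        rw [lintegral_unifLaw_succ ha hn]
        refine add_le_add (le_of_eq ?_) ?_
        · congr 1
          refine lintegral_congr_ae ?_
          filter_upwards [ae_unifLaw_mem a n] with y hy
          simp only [F]
          rw [gromovHeight_succ_of_eq_of_ne hn rfl (fst_ne_of_mem_treePts hy),
            gromovHeight_update, Function.update_self]
        · refine mul_le_of_le_one_right' ?_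
          refine (lintegral_mono fun y => hF1 _ _ _ y).trans (by simp)
      refine (lintegral_mono e).trans (by simp)
  have hsym : ∀ g, ∫⁻ z, ∫⁻ x, F n g x z ∂unifLaw a n ∂unifLaw a n =
      ∫⁻ x, ∫⁻ y, F n g x y ∂unifLaw a n ∂unifLaw a n := fun g =>
    lintegral_lintegral_swap
      (hF' n measurable_const measurable_snd measurable_fst).aemeasurable
  have hJ : Measurable fun g => ∫⁻ x, ∫⁻ y, F n g x y ∂unifLaw a n ∂unifLaw a n := by
    refine Measurable.lintegral_prod_right'
      (f := fun x : (ℕ → ℕ × ℝ) × (ℕ × ℝ) => ∫⁻ y, F n x.1 x.2 y ∂unifLaw a n) ?_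
    exact Measurable.lintegral_prod_right'
      (f := fun x : ((ℕ → ℕ × ℝ) × (ℕ × ℝ)) × (ℕ × ℝ) => F n x.1.1 x.1.2 x.2)
      (hF' n (by fun_prop) (by fun_prop) (by fun_prop))
  have hJ1 : Measurable fun g => ∫⁻ x, ∫⁻ y, F (n + 1) g x y
      ∂unifLaw a (n + 1) ∂unifLaw a (n + 1) := by
    refine Measurable.lintegral_prod_right'
      (f := fun x : (ℕ → ℕ × ℝ) × (ℕ × ℝ) => ∫⁻ y, F (n + 1) x.1 x.2 y ∂unifLaw a (n + 1)) ?_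
    exact Measurable.lintegral_prod_right'
      (f := fun x : ((ℕ → ℕ × ℝ) × (ℕ × ℝ)) × (ℕ × ℝ) => F (n + 1) x.1.1 x.1.2 x.2)
      (hF' (n + 1) (by fun_prop) (by fun_prop) (by fun_prop))
  have hm1 : ∀ g, Measurable fun z => ∫⁻ x, F n g x z ∂unifLaw a n := fun g =>
    Measurable.lintegral_prod_left' (f := fun x : (ℕ × ℝ) × (ℕ × ℝ) => F n g x.1 x.2)
      (hF' n measurable_const measurable_fst measurable_snd)
  have hm2 : ∀ g, Measurable fun z => ∫⁻ y, F n g z y ∂unifLaw a n := fun g =>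
    Measurable.lintegral_prod_right' (f := fun x : (ℕ × ℝ) × (ℕ × ℝ) => F n g x.1 x.2)
      (hF' n measurable_const measurable_fst measurable_snd)
  change ∫⁻ g, ∫⁻ x, ∫⁻ y, F (n + 1) g x y ∂unifLaw a (n + 1) ∂unifLaw a (n + 1)
    ∂gluingLaw a (n + 1) ≤ ∫⁻ g, ∫⁻ x, ∫⁻ y, F n g x y ∂unifLaw a n ∂unifLaw a n
    ∂gluingLaw a n + p * p
  rw [lintegral_gluingLaw_succ ha hn hJ1]
  have hstep : ∀ g, ∫⁻ z, ∫⁻ x, ∫⁻ y, F (n + 1) (Function.update g (n + 1) z) x y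
      ∂unifLaw a (n + 1) ∂unifLaw a (n + 1) ∂unifLaw a n ≤
      ∫⁻ x, ∫⁻ y, F n g x y ∂unifLaw a n ∂unifLaw a n + p * p := by
    intro g
    refine (lintegral_mono (hint g)).trans ?_
    set J := ∫⁻ x, ∫⁻ y, F n g x y ∂unifLaw a n ∂unifLaw a n with hJdef
    have hU := hm1 g
    have hV := hm2 g
    have hUJ := hsym g
    rw [← hJdef] at hUJ
    set U := fun z => ∫⁻ x, F n g x z ∂unifLaw a n
    set V := fun z => ∫⁻ y, F n g z y ∂unifLaw a n
    have hVJ : ∫⁻ z, V z ∂unifLaw a n = J := rfl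
    change ∫⁻ z, (q * (q * J + p * U z) + p * (q * V z + p)) ∂unifLaw a n ≤ _
    rw [lintegral_add_left (by fun_prop), lintegral_const_mul _ (by fun_prop),
      lintegral_add_left measurable_const, lintegral_const_mul _ hU, hUJ,
      lintegral_const, measure_univ, mul_one, lintegral_const_mul _ (by fun_prop),
      lintegral_add_right _ measurable_const, lintegral_const_mul _ hV, hVJ]
    simp only [lintegral_const, measure_univ, mul_one]
    -- The coefficient of `J` is q² + 2pq, at most (q + p)² = 1.
    calc q * (q * J + p * J) + p * (q * J + p) = ((q + p) * q + p * q) * J + p * p := by ring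
      _ ≤ ((q + p) * q + p * (q + p)) * J + p * p := by
        gcongr
        exact le_self_add
      _ = J + p * p := by
        rw [hp, one_mul, mul_one, hp, one_mul]
  refine (lintegral_mono hstep).trans ?_
  rw [lintegral_add_right _ measurable_const]
  simp

/-- At level `m` no branch point can be higher than the total length; afterwards the one-step
increments are summed. -/
lemma branchProb_totalLength_le (ha : ∀ n, 1 ≤ n → 0 < a n) {m : ℕ} (hm : 1 ≤ m) (hn : m ≤ n) :
    branchProb a (totalLength a m) n ≤
      ENNReal.ofReal (∑ i ∈ Finset.Ico m n, segProb a (i + 1) ^ 2) := by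
  induction n, hn using Nat.le_induction with
  | base =>
    have h0 : branchProb a (totalLength a m) m = 0 := by
      rw [branchProb, ← lintegral_zero (μ := gluingLaw a m)]
      refine lintegral_congr_ae ?_
      filter_upwards [ae_gluingLaw_valid ha m] with g hg
      rw [← lintegral_zero (μ := unifLaw a m)]
      refine lintegral_congr_ae ?_
      filter_upwards [ae_unifLaw_mem a m] with x hx
      rw [← lintegral_zero (μ := unifLaw a m)]
      refine lintegral_congr_ae ?_
      filter_upwards [ae_unifLaw_mem a m] with y hy
      exact Set.indicator_of_notMem (by simpa using gromovHeight_le ha hg hx hy) _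
    simp [h0]
  | succ n hn ih =>
    refine (branchProb_succ_le ha (hm.trans hn) _).trans ?_
    rw [Finset.sum_Ico_succ_top hn, ENNReal.ofReal_add (Finset.sum_nonneg fun i _ => by positivity)
      (by positivity)]
    gcongr

end Branching

/-! ### Regularly varying sequences: comparability and Potter's bound -/

namespace RegularlyVarying

variable {a : ℕ → ℝ} {α : ℝ}

/-- A regularly varying sequence is comparable to `a n` on `[n / 2, n]`, uniformly in `n`. -/
lemma exists_comparable (ha : ∀ n, 1 ≤ n → 0 < a n) (h : RegularlyVarying a α) :
    ∃ C : ℝ, ∃ N : ℕ, 1 ≤ N ∧ ∀ n, N ≤ n → ∀ i, n ≤ 2 * i → i ≤ n → a i ≤ C * a n := by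
  -- A Steinhaus-type argument: `E M` collects the ratios for which comparison holds with constant
  -- and threshold both `M + 1`. These sets increase to [1, 4], so one of them misses a set of
  -- measure less than 1/2.
  let E : ℕ → Set ℝ := fun M => {c | c ∈ Set.Icc (1 : ℝ) 4 ∧ ∀ n : ℕ, M + 1 ≤ n →
    a ⌊c * n⌋₊ ≤ (M + 1) * a n ∧ a n ≤ (M + 1) * a ⌊c * n⌋₊}
  have hfl : ∀ c : ℝ, 1 ≤ c → ∀ n : ℕ, 1 ≤ n → 1 ≤ ⌊c * n⌋₊ := by
    intro c hc n hn
    refine Nat.le_floor ?_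
    have : (1 : ℝ) ≤ n := by exact_mod_cast hn
    push_cast
    nlinarith
  have hmono : Monotone E := by
    intro M M' hM c hc
    have hM' : (M : ℝ) ≤ M' := by exact_mod_cast hM
    refine ⟨hc.1, fun n hn => ?_⟩
    obtain ⟨h1, h2⟩ := hc.2 n (by omega)
    have h3 := ha n (by omega)
    have h4 := ha _ (hfl c hc.1.1 n (by omega))
    exact ⟨h1.trans (by nlinarith), h2.trans (by nlinarith)⟩
  have hunion : ⋃ M, E M = Set.Icc 1 4 := by
    refine Set.Subset.antisymm (Set.iUnion_subset fun M c hc => hc.1) fun c hc => ?_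
    have hc0 : 0 < c := by linarith [hc.1]
    have hpos : 0 < c ^ α := Real.rpow_pos_of_pos hc0 α
    have hlim := h c hc0
    obtain ⟨N, hN⟩ := eventually_atTop.1 ((hlim.eventually (gt_mem_nhds (show c ^ α < 2 * c ^ α by
      linarith))).and (hlim.eventually (lt_mem_nhds (show c ^ α / 2 < c ^ α by linarith))))
    obtain ⟨M, hM⟩ := exists_nat_ge (max (2 * c ^ α) (2 / c ^ α))
    refine Set.mem_iUnion.2 ⟨max N M, hc, fun n hn => ?_⟩
    have hM1 : 2 * c ^ α ≤ (max N M : ℕ) := (le_max_left _ _).trans (hM.trans (by simp))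
    have hM2 : 2 / c ^ α ≤ (max N M : ℕ) := (le_max_right _ _).trans (hM.trans (by simp))
    have hn0 := ha n (by omega)
    have hf0 := ha _ (hfl c hc.1 n (by omega))
    obtain ⟨h1, h2⟩ := hN n (by omega)
    rw [div_lt_iff₀ hn0] at h1
    rw [lt_div_iff₀ hn0] at h2
    rw [div_le_iff₀ hpos] at hM2
    constructor
    · nlinarith
    · have : a n ≤ 2 / c ^ α * a ⌊c * n⌋₊ := by
        rw [div_mul_eq_mul_div, le_div_iff₀ hpos]
        linarith
      refine this.trans ?_
      have h3 : 2 / c ^ α ≤ (max N M : ℕ) := by rwa [div_le_iff₀ hpos]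
      nlinarith
  have hmeas : ∀ M, MeasurableSet (E M) := by
    intro M
    have hf : ∀ n : ℕ, Measurable fun c : ℝ => a ⌊c * n⌋₊ := fun n =>
      (measurable_from_nat (f := a)).comp (Nat.measurable_floor.comp (measurable_id.mul_const _))
    have : E M = Set.Icc (1 : ℝ) 4 ∩ ⋂ n : ℕ, ⋂ _ : M + 1 ≤ n,
        ({c : ℝ | a ⌊c * n⌋₊ ≤ (M + 1) * a n} ∩ {c : ℝ | a n ≤ (M + 1) * a ⌊c * n⌋₊}) := by
      ext c
      simp [E]
    rw [this]
    refine measurableSet_Icc.inter (MeasurableSet.iInter fun n => MeasurableSet.iInter fun _ => ?_)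
    exact (measurableSet_le (hf n) measurable_const).inter
      (measurableSet_le measurable_const ((hf n).const_mul _))
  obtain ⟨M, hM⟩ : ∃ M, volume (Set.Icc (1 : ℝ) 4 \ E M) < ENNReal.ofReal (1 / 2) := by
    have hlim := tendsto_measure_iUnion_atTop (μ := (volume : Measure ℝ)) hmono
    rw [hunion, Real.volume_Icc] at hlim
    obtain ⟨M, hM⟩ := (hlim.eventually (lt_mem_nhds (show ENNReal.ofReal (5 / 2) <
      ENNReal.ofReal (4 - 1) from (ENNReal.ofReal_lt_ofReal_iff (by norm_num)).2
        (by norm_num)))).exists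
    refine ⟨M, ?_⟩
    have hsub : E M ⊆ Set.Icc 1 4 := fun c hc => hc.1
    have hfin : volume (E M) ≠ ⊤ := measure_ne_top_of_subset hsub (by simp)
    rw [measure_sdiff hsub (hmeas M).nullMeasurableSet hfin, Real.volume_Icc]
    refine ENNReal.sub_lt_of_lt_add ?_ ?_
    · have := measure_mono (μ := volume) hsub
      rwa [Real.volume_Icc] at this
    · simp only [Function.comp] at hM
      calc ENNReal.ofReal (4 - 1) = ENNReal.ofReal (1 / 2) + ENNReal.ofReal (5 / 2) := by
            rw [← ENNReal.ofReal_add (by norm_num) (by norm_num)]; norm_num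
        _ < ENNReal.ofReal (1 / 2) + volume (E M) :=
            ENNReal.add_lt_add_left ENNReal.ofReal_ne_top hM
  -- The threshold is doubled so that `i ≥ n / 2` still exceeds `M`. The constant is squared because
  -- the comparison goes through the intermediate index ⌊x⌋.
  refine ⟨(M + 1) * (M + 1), 2 * (M + 1), by omega, fun n hn i hni hin => ?_⟩
  have hi0 : (0 : ℝ) < i := by exact_mod_cast (show 0 < i by omega)
  have hn0 : (0 : ℝ) < n := by exact_mod_cast (show 0 < n by omega)
  have hin' : (i : ℝ) ≤ n := by exact_mod_cast hin
  have hni' : (n : ℝ) ≤ 2 * i := by exact_mod_cast hni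
  set D := Set.Icc (1 : ℝ) 4 \ E M with hD
  -- For x in [n, 2n) both x/n and x/i lie in [1, 4]. The x with a bad ratio have measure less than
  -- n/2 + n/2, so some x has both ratios in `E M`.
  obtain ⟨x, hx, hxD⟩ : ∃ x ∈ Set.Ico (n : ℝ) (2 * n),
      x ∉ ((fun y => (n : ℝ)⁻¹ * y) ⁻¹' D ∪ (fun y => (i : ℝ)⁻¹ * y) ⁻¹' D) := by
    by_contra! hcon
    have h1 : volume (Set.Ico (n : ℝ) (2 * n)) ≤ _ := (measure_mono hcon).trans
      (measure_union_le _ _)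
    rw [Real.volume_Ico, Real.volume_preimage_mul_left (inv_ne_zero hn0.ne'),
      Real.volume_preimage_mul_left (inv_ne_zero hi0.ne'), inv_inv, inv_inv, abs_of_pos hn0,
      abs_of_pos hi0] at h1
    have h2 : ENNReal.ofReal n * volume D + ENNReal.ofReal i * volume D <
        ENNReal.ofReal (2 * n - n) := by
      calc ENNReal.ofReal n * volume D + ENNReal.ofReal i * volume D
          ≤ ENNReal.ofReal n * volume D + ENNReal.ofReal n * volume D := by gcongr
        _ < ENNReal.ofReal n * ENNReal.ofReal (1 / 2) +
            ENNReal.ofReal n * ENNReal.ofReal (1 / 2) := by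
            have := ENNReal.mul_lt_mul_right (a := ENNReal.ofReal n) (by simpa using hn0.ne')
              ENNReal.ofReal_ne_top hM
            exact ENNReal.add_lt_add this this
        _ = ENNReal.ofReal (2 * n - n) := by
            rw [← ENNReal.ofReal_mul hn0.le, ← ENNReal.ofReal_add (by positivity) (by positivity)]
            congr 1
            ring
    exact absurd h1 (not_le.2 h2)
  have hE : ∀ m : ℝ, 0 < m → m ≤ n → (n : ℝ) ≤ 2 * m → m⁻¹ * x ∉ D → m⁻¹ * x ∈ E M := by
    intro m hm hmn hnm hmD
    by_contra hcon
    refine hmD ⟨⟨?_, ?_⟩, hcon⟩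
    · rw [inv_mul_eq_div, le_div_iff₀ hm]; linarith [hx.1]
    · rw [inv_mul_eq_div, div_le_iff₀ hm]; linarith [hx.2]
  have hxn := (hE n hn0 le_rfl (by linarith) fun h => hxD (Or.inl h)).2 n (by omega)
  have hxi := (hE i hi0 hin' hni' fun h => hxD (Or.inr h)).2 i (by omega)
  rw [inv_mul_eq_div, div_mul_cancel₀ _ hn0.ne'] at hxn
  rw [inv_mul_eq_div, div_mul_cancel₀ _ hi0.ne'] at hxi
  calc a i ≤ (M + 1) * a ⌊x⌋₊ := hxi.2
    _ ≤ (M + 1) * ((M + 1) * a n) := by gcongr; exact hxn.1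
    _ = _ := by ring

/-- A sequence of positive index is almost increasing. -/
lemma exists_le_mul (ha : ∀ n, 1 ≤ n → 0 < a n) (h : RegularlyVarying a α) (hα : 0 < α) :
    ∃ C : ℝ, 0 < C ∧ ∀ i n, 1 ≤ i → i ≤ n → a i ≤ C * a n := by
  obtain ⟨C, N, hN1, hN⟩ := h.exists_comparable ha
  have hlim := h (1 / 2) (by norm_num)
  have hlt : ((1 : ℝ) / 2) ^ α < 1 := Real.rpow_lt_one (by norm_num) (by norm_num) hα
  obtain ⟨N', hN'⟩ := eventually_atTop.1 (hlim.eventually (gt_mem_nhds hlt))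
  have hhalf : ∀ n : ℕ, ⌊(1 / 2 : ℝ) * n⌋₊ = n / 2 := by
    intro n
    rw [one_div, inv_mul_eq_div]
    exact_mod_cast Nat.floor_div_eq_div (K := ℝ) n 2
  let N₀ := max (max N N') 1
  -- A crude bound for all the ratios below the asymptotic range.
  let S : ℝ := ∑ n ∈ Finset.Icc 1 N₀, ∑ i ∈ Finset.Icc 1 N₀, a i / a n
  have hpos : ∀ n ∈ Finset.Icc 1 N₀, ∀ i ∈ Finset.Icc 1 N₀, 0 ≤ a i / a n := fun n hn i hi =>
    (div_pos (ha i (Finset.mem_Icc.1 hi).1) (ha n (Finset.mem_Icc.1 hn).1)).le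
  have hS0 : 0 ≤ S := Finset.sum_nonneg fun n hn => Finset.sum_nonneg (hpos n hn)
  refine ⟨|C| + S + 1, by positivity, fun i n hi => ?_⟩
  induction n using Nat.strong_induction_on with
  | _ n ih =>
    intro hin
    have hn0 := ha n (hi.trans hin)
    rcases le_or_gt n N₀ with hn | hn
    · have hnm : n ∈ Finset.Icc 1 N₀ := Finset.mem_Icc.2 ⟨hi.trans hin, hn⟩
      have him : i ∈ Finset.Icc 1 N₀ := Finset.mem_Icc.2 ⟨hi, hin.trans hn⟩
      have h1 : a i / a n ≤ S := (Finset.single_le_sum (f := fun i => a i / a n)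
        (hpos n hnm) him).trans (Finset.single_le_sum
          (f := fun n => ∑ i ∈ Finset.Icc 1 N₀, a i / a n)
          (fun n hn => Finset.sum_nonneg (hpos n hn)) hnm)
      rw [div_le_iff₀ hn0] at h1
      nlinarith [abs_nonneg C]
    · have hnN : N ≤ n := ((le_max_left _ _).trans (le_max_left _ _)).trans hn.le
      have hnN' : N' ≤ n := ((le_max_right _ _).trans (le_max_left _ _)).trans hn.le
      rcases le_or_gt n (2 * i) with h2 | h2
      · have := hN n hnN i h2 hin
        nlinarith [le_abs_self C]
      -- Halving does not degrade the constant: for large `n`, `a (n / 2) ≤ a n`, since the ratio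
      -- tends to 2^(-α) < 1.
      · have h3 := ih (n / 2) (by omega) (by omega)
        have h4 := hN' n hnN'
        rw [hhalf, div_lt_one hn0] at h4
        exact h3.trans (by gcongr)

lemma tendsto_floor_mul_atTop {c : ℝ} (hc : 0 < c) :
    Tendsto (fun n : ℕ => ⌊c * n⌋₊) atTop atTop :=
  tendsto_nat_floor_atTop.comp (tendsto_natCast_atTop_atTop.const_mul_atTop hc)

lemma tendsto_floor_mul_div {c : ℝ} (hc : 0 < c) :
    Tendsto (fun n : ℕ => (⌊c * n⌋₊ : ℝ) / n) atTop (𝓝 c) :=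
  (tendsto_nat_floor_mul_div_atTop hc.le).comp tendsto_natCast_atTop_atTop

lemma mul_rpow (h : RegularlyVarying a α) (γ : ℝ) :
    RegularlyVarying (fun n => a n * (n : ℝ) ^ γ) (α + γ) := by
  intro c hc
  have h1 := (h c hc).mul ((tendsto_floor_mul_div hc).rpow_const (p := γ) (Or.inl hc.ne'))
  rw [Real.rpow_add hc]
  refine h1.congr fun n => ?_
  rw [Real.div_rpow (by positivity) (by positivity), mul_div_mul_comm]

/-- Potter's bound. -/
lemma exists_potter (ha : ∀ n, 1 ≤ n → 0 < a n) (h : RegularlyVarying a α) {δ : ℝ} (hδ : δ < α) :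
    ∃ C : ℝ, 0 < C ∧ ∀ i n, 1 ≤ i → i ≤ n → a i / a n ≤ C * ((i : ℝ) / n) ^ δ := by
  -- The sequence a_n n^(-δ) has positive index α - δ, hence is almost increasing.
  obtain ⟨C, hC, hle⟩ := (h.mul_rpow (-δ)).exists_le_mul
    (fun n hn => mul_pos (ha n hn) (Real.rpow_pos_of_pos (by exact_mod_cast hn) _))
    (by linarith)
  refine ⟨C, hC, fun i n hi hin => ?_⟩
  have hn := hi.trans hin
  have hi0 : (0 : ℝ) < i := by exact_mod_cast hi
  have hn0 : (0 : ℝ) < n := by exact_mod_cast hn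
  have h1 := hle i n hi hin
  rw [Real.rpow_neg hi0.le, Real.rpow_neg hn0.le, ← div_eq_mul_inv, ← div_eq_mul_inv,
    div_le_iff₀ (Real.rpow_pos_of_pos hi0 δ)] at h1
  rw [div_le_iff₀ (ha n hn), Real.div_rpow hi0.le hn0.le]
  refine h1.trans (le_of_eq ?_)
  ring

/-- Potter's bound with `i = 1` and exponent α/2 bounds a_n below by a multiple of n^(α/2). -/
lemma tendsto_atTop_of_pos (ha : ∀ n, 1 ≤ n → 0 < a n) (h : RegularlyVarying a α) (hα : 0 < α) :
    Tendsto a atTop atTop := by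
  obtain ⟨C, hC, hle⟩ := h.exists_potter ha (half_lt_self hα)
  have h1 : Tendsto (fun n : ℕ => a 1 / C * (n : ℝ) ^ (α / 2)) atTop atTop :=
    ((tendsto_rpow_atTop (half_pos hα)).comp tendsto_natCast_atTop_atTop).const_mul_atTop
      (div_pos (ha 1 le_rfl) hC)
  refine tendsto_atTop_mono' _ ?_ h1
  filter_upwards [eventually_ge_atTop 1] with n hn
  have hn0 : (0 : ℝ) < n := by exact_mod_cast hn
  have h2 := hle 1 n le_rfl hn
  rw [Nat.cast_one, Real.div_rpow zero_le_one hn0.le, Real.one_rpow, div_le_iff₀ (ha n hn),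
    mul_one_div, div_mul_eq_mul_div, le_div_iff₀ (Real.rpow_pos_of_pos hn0 _)] at h2
  rw [div_mul_eq_mul_div, div_le_iff₀ hC]
  linarith

end RegularlyVarying

/-! ### Sums over levels as integrals of step functions -/

section RiemannSum

variable {E : Type*} [NormedAddCommGroup E] [NormedSpace ℝ E]

lemma sum_Icc_one_eq_sum_range {M : Type*} [AddCommMonoid M] (f : ℕ → M) (n : ℕ) :
    ∑ i ∈ Finset.Icc 1 n, f i = ∑ i ∈ Finset.range n, f (i + 1) := by
  induction n with
  | zero => simp
  | succ n ih => rw [Finset.sum_Icc_succ_top (by omega), ih, Finset.sum_range_succ]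

lemma sum_range_eq_integral_floor [CompleteSpace E] {n : ℕ} (hn : 1 ≤ n) (f : ℕ → E) :
    ∑ i ∈ Finset.range n, f i = ∫ x in (0 : ℝ)..1, (n : ℝ) • f ⌊x * n⌋₊ := by
  have hn0 : (0 : ℝ) < n := by exact_mod_cast hn
  have hle : ∀ k : ℕ, (k : ℝ) / n ≤ ((k + 1 : ℕ) : ℝ) / n := fun k => by
    gcongr
    omega
  have hfl : ∀ k : ℕ, Set.EqOn (fun x : ℝ => (n : ℝ) • f ⌊x * n⌋₊) (fun _ => (n : ℝ) • f k)
      (Set.Ioo ((k : ℝ) / n) (((k + 1 : ℕ) : ℝ) / n)) := by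
    intro k x hx
    have h1 : ⌊x * n⌋₊ = k := by
      have h2 := (div_lt_iff₀ hn0).1 hx.1
      have h3 := (lt_div_iff₀ hn0).1 hx.2
      push_cast at h3
      exact (Nat.floor_eq_iff ((Nat.cast_nonneg k).trans h2.le)).2 ⟨h2.le, h3⟩
    simp only [h1]
  have hint : ∀ k < n, IntervalIntegrable (fun x : ℝ => (n : ℝ) • f ⌊x * n⌋₊) volume
      ((k : ℝ) / n) (((k + 1 : ℕ) : ℝ) / n) := fun k _ => by
    rw [intervalIntegrable_iff_integrableOn_Ioo_of_le (hle k)]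
    exact (integrableOn_congr_fun (hfl k) measurableSet_Ioo).2 (by simp)
  have h := intervalIntegral.sum_integral_adjacent_intervals hint
  rw [Nat.cast_zero, zero_div, div_self hn0.ne'] at h
  rw [← h]
  refine Finset.sum_congr rfl fun k _ => ?_
  rw [intervalIntegral.integral_congr_Ioo_of_le (hle k) (hfl k), intervalIntegral.integral_const,
    smul_smul, ← sub_div]
  push_cast
  rw [add_sub_cancel_left, one_div, inv_mul_cancel₀ hn0.ne', one_smul]

/-- If k = ⌊xn⌋ ≥ 1 then xn < k + 1 ≤ 2k. Negative powers of ⌊xn⌋/n can thus be dominated by powers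
of x. -/
lemma half_le_floor_div {x : ℝ} {n : ℕ} (h : 1 ≤ ⌊x * n⌋₊) : x / 2 ≤ (⌊x * n⌋₊ : ℝ) / n := by
  have hn0 : (0 : ℝ) < n := by
    rcases Nat.eq_zero_or_pos n with rfl | h0
    · simp at h
    · exact_mod_cast h0
  have h1 : (1 : ℝ) ≤ ⌊x * n⌋₊ := by exact_mod_cast h
  rw [le_div_iff₀ hn0]
  linarith [Nat.lt_floor_add_one (x * n)]

lemma floor_div_le {x : ℝ} (hx : 0 ≤ x) (n : ℕ) : (⌊x * n⌋₊ : ℝ) / n ≤ x := by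
  rcases Nat.eq_zero_or_pos n with rfl | h0
  · simpa using hx
  · rw [div_le_iff₀ (by exact_mod_cast h0)]
    exact Nat.floor_le (by positivity)

/-- Convergence of Riemann-type sums by domination. -/
lemma tendsto_sum_of_floor_dominated [CompleteSpace E] [MeasurableSpace E] [BorelSpace E]
    [SecondCountableTopology E] {H : ℕ → ℕ → E} {g : ℝ → E} {bound : ℝ → ℝ}
    (hbound : ∀ n : ℕ, ∀ x ∈ Set.Ioo (0 : ℝ) 1, 1 ≤ ⌊x * n⌋₊ → ⌊x * n⌋₊ ≤ n →
      ‖(n : ℝ) • H n ⌊x * n⌋₊‖ ≤ bound x)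
    (hb0 : ∀ x ∈ Set.Ioo (0 : ℝ) 1, 0 ≤ bound x)
    (hbi : IntervalIntegrable bound volume 0 1)
    (hlim : ∀ x ∈ Set.Ioo (0 : ℝ) 1,
      Tendsto (fun n : ℕ => (n : ℝ) • H n ⌊x * n⌋₊) atTop (𝓝 (g x)))
    (hend : Tendsto (fun n => H n n) atTop (𝓝 0)) :
    Tendsto (fun n => ∑ i ∈ Finset.Icc 1 n, H n i) atTop (𝓝 (∫ x in (0 : ℝ)..1, g x)) := by
  -- The step function over [0, 1) sees the indices 0, …, n - 1: index 0 is erased by hand, and the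
  -- last term `H n n` is added separately, which is why `hend` is assumed.
  let H' : ℕ → ℕ → E := fun n i => if i = 0 then 0 else H n i
  have hsum : ∀ᶠ n : ℕ in atTop, (∫ x in (0 : ℝ)..1, (n : ℝ) • H' n ⌊x * n⌋₊) + H n n =
      ∑ i ∈ Finset.Icc 1 n, H n i := by
    filter_upwards [eventually_ge_atTop 1] with n hn
    have h1 : ∑ i ∈ Finset.Icc 1 n, H n i = ∑ i ∈ Finset.range (n + 1), H' n i := by
      rw [Finset.sum_range_succ', sum_Icc_one_eq_sum_range]
      simp [H']
    rw [← sum_range_eq_integral_floor hn, h1, Finset.sum_range_succ]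
    simp [H', show n ≠ 0 by omega]
  have hae : ∀ᵐ x : ℝ ∂volume, x ≠ 1 := by
    simp [ae_iff]
  have hint : Tendsto (fun n : ℕ => ∫ x in (0 : ℝ)..1, (n : ℝ) • H' n ⌊x * n⌋₊) atTop
      (𝓝 (∫ x in (0 : ℝ)..1, g x)) := by
    refine intervalIntegral.tendsto_integral_filter_of_dominated_convergence bound
      (.of_forall fun n => ?_) (.of_forall fun n => ?_) hbi ?_
    · have : Measurable fun x : ℝ => H' n ⌊x * n⌋₊ :=
        (measurable_from_nat (f := H' n)).comp
          (Nat.measurable_floor.comp (measurable_id.mul_const _))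
      exact (this.const_smul (n : ℝ)).aestronglyMeasurable
    · filter_upwards [hae] with x hx1 hx
      rw [Set.uIoc_of_le zero_le_one] at hx
      have hx' : x ∈ Set.Ioo (0 : ℝ) 1 := ⟨hx.1, lt_of_le_of_ne hx.2 hx1⟩
      by_cases h0 : ⌊x * n⌋₊ = 0
      · simp only [H', h0, if_true, smul_zero, norm_zero]
        exact hb0 x hx'
      · simp only [H', h0, if_false]
        refine hbound n x hx' (by omega) (Nat.floor_le_of_le ?_)
        have : (0 : ℝ) ≤ n := Nat.cast_nonneg n
        nlinarith [hx.2]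
    · filter_upwards [hae] with x hx1 hx
      rw [Set.uIoc_of_le zero_le_one] at hx
      have hx' : x ∈ Set.Ioo (0 : ℝ) 1 := ⟨hx.1, lt_of_le_of_ne hx.2 hx1⟩
      refine (hlim x hx').congr' ?_
      filter_upwards [(RegularlyVarying.tendsto_floor_mul_atTop hx.1).eventually_ge_atTop 1]
        with n hn
      simp [H', show ⌊x * n⌋₊ ≠ 0 by omega]
  have := hint.add hend
  rw [add_zero] at this
  exact this.congr' hsum

end RiemannSum

/-! ### Expansion of the uniform exponential moment at 0 -/

section UnifMgf

lemma continuous_unifMgf : Continuous unifMgf :=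
  intervalIntegral.continuous_parametric_intervalIntegral_of_continuous'
    (f := fun (z : ℂ) (u : ℝ) => Complex.exp (z * u)) (by fun_prop) 0 1

lemma norm_unifMgf_sub_one_le (z : ℂ) : ‖unifMgf z - 1‖ ≤ ‖z‖ * Real.exp ‖z‖ := by
  have h : unifMgf z - 1 = ∫ u in (0 : ℝ)..1, (Complex.exp (z * u) - 1) := by
    rw [intervalIntegral.integral_sub (Continuous.intervalIntegrable (by fun_prop) _ _)
      (by simp)]
    simp [unifMgf]
  rw [h]
  refine (intervalIntegral.norm_integral_le_of_norm_le_const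
    (C := ‖z‖ * Real.exp ‖z‖) fun u hu => ?_).trans (by simp)
  rw [Set.uIoc_of_le zero_le_one] at hu
  have h1 := Complex.norm_exp_sub_sum_le_norm_mul_exp (z * u) 1
  have h2 : ‖z * u‖ ≤ ‖z‖ := by
    rw [norm_mul, Complex.norm_real, Real.norm_of_nonneg hu.1.le]
    exact mul_le_of_le_one_right (norm_nonneg _) hu.2
  simp only [Finset.sum_range_one, pow_zero, Nat.factorial_zero, Nat.cast_one, div_one,
    pow_one] at h1
  exact h1.trans (by gcongr)

lemma norm_unifMgf_sub_one_sub_half_le (z : ℂ) :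
    ‖unifMgf z - 1 - z / 2‖ ≤ ‖z‖ ^ 2 * Real.exp ‖z‖ := by
  have h : unifMgf z - 1 - z / 2 = ∫ u in (0 : ℝ)..1, (Complex.exp (z * u) - (1 + z * u)) := by
    rw [intervalIntegral.integral_sub (Continuous.intervalIntegrable (by fun_prop) _ _)
      (Continuous.intervalIntegrable (by fun_prop) _ _),
      intervalIntegral.integral_add (by simp) (Continuous.intervalIntegrable (by fun_prop) _ _),
      intervalIntegral.integral_const_mul, intervalIntegral.integral_ofReal, integral_id]
    simp [unifMgf]
    ring
  rw [h]
  refine (intervalIntegral.norm_integral_le_of_norm_le_const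
    (C := ‖z‖ ^ 2 * Real.exp ‖z‖) fun u hu => ?_).trans (by simp)
  rw [Set.uIoc_of_le zero_le_one] at hu
  have h1 := Complex.norm_exp_sub_sum_le_norm_mul_exp (z * u) 2
  have h2 : ‖z * u‖ ≤ ‖z‖ := by
    rw [norm_mul, Complex.norm_real, Real.norm_of_nonneg hu.1.le]
    exact mul_le_of_le_one_right (norm_nonneg _) hu.2
  simp only [Finset.sum_range_succ, Finset.sum_range_zero, zero_add, pow_zero,
    Nat.factorial_zero, Nat.factorial_one, Nat.cast_one, div_one, pow_one] at h1
  exact h1.trans (by gcongr)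

end UnifMgf

/-! ### From products to exponentials of sums -/

section ProductLimit

/-- Factor by factor, the error is |e^w - 1 - w| ≤ |w|² e^|w|, and the remaining factors are bounded
by exponentials of the norms. -/
lemma norm_prod_one_add_sub_exp_sum_le {ι : Type*} (s : Finset ι) (w : ι → ℂ) :
    ‖∏ i ∈ s, (1 + w i) - Complex.exp (∑ i ∈ s, w i)‖ ≤
      (∑ i ∈ s, ‖w i‖ ^ 2) * Real.exp (∑ i ∈ s, ‖w i‖) := by
  classical
  induction s using Finset.induction_on with
  | empty => simp
  | insert i s hi ih =>
    rw [Finset.prod_insert hi, Finset.sum_insert hi, Finset.sum_insert hi, Finset.sum_insert hi,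
      Complex.exp_add, Real.exp_add]
    set Q := ∏ j ∈ s, (1 + w j)
    set S := ∑ j ∈ s, w j
    set R := ∑ j ∈ s, ‖w j‖
    have h1 : ‖1 + w i‖ ≤ Real.exp ‖w i‖ := by
      refine (norm_add_le _ _).trans ?_
      rw [norm_one]
      linarith [Real.add_one_le_exp ‖w i‖]
    have h2 : ‖1 + w i - Complex.exp (w i)‖ ≤ ‖w i‖ ^ 2 * Real.exp ‖w i‖ := by
      have := Complex.norm_exp_sub_sum_le_norm_mul_exp (w i) 2
      simp only [Finset.sum_range_succ, Finset.sum_range_zero, zero_add, pow_zero,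
        Nat.factorial_zero, Nat.factorial_one, Nat.cast_one, div_one, pow_one] at this
      rwa [norm_sub_rev]
    have h3 : ‖Complex.exp S‖ ≤ Real.exp R :=
      (Complex.norm_exp_le_exp_norm _).trans (Real.exp_le_exp.2 (norm_sum_le _ _))
    have h4 : (1 + w i) * Q - Complex.exp (w i) * Complex.exp S =
        (1 + w i) * (Q - Complex.exp S) + (1 + w i - Complex.exp (w i)) * Complex.exp S := by ring
    rw [h4]
    calc _ ≤ ‖1 + w i‖ * ‖Q - Complex.exp S‖ +
          ‖1 + w i - Complex.exp (w i)‖ * ‖Complex.exp S‖ := by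
          rw [← norm_mul, ← norm_mul]; exact norm_add_le _ _
      _ ≤ Real.exp ‖w i‖ * ((∑ j ∈ s, ‖w j‖ ^ 2) * Real.exp R) +
          ‖w i‖ ^ 2 * Real.exp ‖w i‖ * Real.exp R := by gcongr
      _ = _ := by ring

/-- The exponential moments of the rescaled heights converge as soon as the sums of the exponents
do. -/
lemma tendsto_heightProd {a : ℕ → ℝ} (ha : ∀ n, 1 ≤ n → 0 < a n)
    (hs : Summable fun i => segProb a (i + 1) ^ 2) {N : ℕ → ℝ} (hN : Tendsto N atTop atTop)
    (hN0 : ∀ n, 1 ≤ n → 0 < N n) {C B : ℝ}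
    (hC : ∀ i n, 1 ≤ i → i ≤ n → a i / N n ≤ C)
    (hB : ∀ᶠ n in atTop, ∑ i ∈ Finset.Icc 1 n, segProb a i * (a i / N n) ≤ B) {z L : ℂ}
    (hL : Tendsto (fun n => ∑ i ∈ Finset.Icc 1 n,
      (segProb a i : ℂ) * (unifMgf (z * (a i / N n : ℝ)) - 1)) atTop (𝓝 L)) :
    Tendsto (fun n => heightProd a (z / N n) n) atTop (𝓝 (Complex.exp L)) := by
  set w : ℕ → ℕ → ℂ := fun n i => (segProb a i : ℂ) * (unifMgf (z * (a i / N n : ℝ)) - 1) with hw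
  have hprod : ∀ n, heightProd a (z / N n) n = ∏ i ∈ Finset.Icc 1 n, (1 + w n i) := by
    intro n
    refine Finset.prod_congr rfl fun i _ => ?_
    simp only [hw]
    rw [Complex.ofReal_div, show z / (N n : ℂ) * a i = z * (a i / N n) by ring]
  set K := ‖z‖ * Real.exp (‖z‖ * C) with hK
  have hK0 : 0 ≤ K := by positivity
  have hwle : ∀ n i, 1 ≤ i → i ≤ n → ‖w n i‖ ≤ K * (segProb a i * (a i / N n)) := by
    intro n i hi hin
    have h0 : 0 ≤ a i / N n := (div_pos (ha i hi) (hN0 n (hi.trans hin))).le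
    have h1 := norm_unifMgf_sub_one_le (z * (a i / N n : ℝ))
    rw [norm_mul, Complex.norm_real, Real.norm_of_nonneg h0] at h1
    simp only [hw]
    rw [norm_mul, Complex.norm_real, Real.norm_of_nonneg (segProb_pos ha hi).le]
    have h2 : Real.exp (‖z‖ * (a i / N n)) ≤ Real.exp (‖z‖ * C) := by
      gcongr
      exact hC i n hi hin
    calc _ ≤ segProb a i * (‖z‖ * (a i / N n) * Real.exp (‖z‖ * C)) :=
          mul_le_mul_of_nonneg_left (h1.trans (by gcongr)) (segProb_pos ha hi).le
      _ = _ := by rw [hK]; ring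
  -- Dominated convergence again: each `w n i` vanishes as `N n → ∞`, and its square is at most (K
  -- C)² times that of `segProb a i`.
  have hsq : Tendsto (fun n => ∑ i ∈ Finset.Icc 1 n, ‖w n i‖ ^ 2) atTop (𝓝 0) := by
    let F : ℕ → ℕ → ℝ := fun n i => if i ∈ Finset.range n then ‖w n (i + 1)‖ ^ 2 else 0
    have hF : ∀ n, ∑ i ∈ Finset.Icc 1 n, ‖w n i‖ ^ 2 = ∑' i, F n i := by
      intro n
      rw [tsum_eq_sum (s := Finset.range n) fun i hi => if_neg hi, sum_Icc_one_eq_sum_range]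
      exact Finset.sum_congr rfl fun i hi => (if_pos hi).symm
    have hlim : Tendsto (fun n => ∑' i, F n i) atTop (𝓝 (∑' i : ℕ, (0 : ℝ))) := by
      refine tendsto_tsum_of_dominated_convergence
        (bound := fun i => (K * C) ^ 2 * segProb a (i + 1) ^ 2)
        (hs.mul_left _) (fun i => ?_) (.of_forall fun n i => ?_)
      · have h0 : Tendsto (fun n => (K * (segProb a (i + 1) * (a (i + 1) / N n))) ^ 2) atTop
            (𝓝 0) := by
          have := (((hN.const_div_atTop (a (i + 1))).const_mul
            (segProb a (i + 1))).const_mul K).pow 2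
          simpa using this
        refine squeeze_zero' (.of_forall fun n => ?_) (.of_forall fun n => ?_) h0
        · simp only [F]; split_ifs <;> positivity
        · simp only [F]; split_ifs with hin
          · exact pow_le_pow_left₀ (norm_nonneg _)
              (hwle n (i + 1) (by omega) (by simpa using hin)) 2
          · positivity
      · simp only [F]
        split_ifs with hin
        · have hin' : i + 1 ≤ n := by simpa using hin
          rw [Real.norm_of_nonneg (by positivity), ← mul_pow]
          refine pow_le_pow_left₀ (norm_nonneg _) ((hwle n (i + 1) (by omega) hin').trans ?_) 2
          have h1 := hC (i + 1) n (by omega) hin'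
          have h2 := (segProb_pos ha (show 1 ≤ i + 1 by omega)).le
          calc _ ≤ K * (segProb a (i + 1) * C) := by gcongr
            _ = _ := by ring
        · simp only [norm_zero]; positivity
    rw [tsum_zero] at hlim
    exact hlim.congr fun n => (hF n).symm
  have hbd : ∀ᶠ n in atTop, Real.exp (∑ i ∈ Finset.Icc 1 n, ‖w n i‖) ≤ Real.exp (K * B) := by
    filter_upwards [hB] with n hn
    refine Real.exp_le_exp.2 ((Finset.sum_le_sum fun i hi => hwle n i (Finset.mem_Icc.1 hi).1
      (Finset.mem_Icc.1 hi).2).trans ?_)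
    rw [← Finset.mul_sum]
    gcongr
  have hdiff : Tendsto (fun n => ∏ i ∈ Finset.Icc 1 n, (1 + w n i) -
      Complex.exp (∑ i ∈ Finset.Icc 1 n, w n i)) atTop (𝓝 0) := by
    refine squeeze_zero_norm' ?_ (show Tendsto (fun n => (∑ i ∈ Finset.Icc 1 n, ‖w n i‖ ^ 2) *
      Real.exp (K * B)) atTop (𝓝 0) by simpa using hsq.mul_const (Real.exp (K * B)))
    filter_upwards [hbd] with n hn
    refine (norm_prod_one_add_sub_exp_sum_le _ _).trans ?_
    exact mul_le_mul_of_nonneg_left hn (Finset.sum_nonneg fun i _ => by positivity)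
  have := hdiff.add ((Complex.continuous_exp.tendsto L).comp hL)
  rw [zero_add] at this
  refine this.congr fun n => ?_
  rw [hprod]
  simp [w]

end ProductLimit

/-! ### Limits for positive index -/

namespace RegularlyVarying

variable {a : ℕ → ℝ} {α : ℝ}

lemma tendsto_totalLength_div (ha : ∀ n, 1 ≤ n → 0 < a n) (h : RegularlyVarying a α)
    (hα : 0 ≤ α) : Tendsto (fun n : ℕ => totalLength a n / (n * a n)) atTop (𝓝 (1 / (α + 1))) := by
  -- Exponent -1/2 is below every α ≥ 0 and still integrable at 0, so index 0 is included.
  obtain ⟨C, hC, hpot⟩ := h.exists_potter ha (show -(1 / 2 : ℝ) < α by linarith)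
  have key := tendsto_sum_of_floor_dominated (H := fun n i => a i / (n * a n))
    (g := fun x : ℝ => x ^ α) (bound := fun x => C * ((2⁻¹ : ℝ) ^ (-(1 / 2 : ℝ)) *
      x ^ (-(1 / 2 : ℝ)))) ?_ ?_ ?_ ?_ ?_
  · have hI : ∫ x in (0 : ℝ)..1, x ^ α = 1 / (α + 1) := by
      rw [integral_rpow (Or.inl (by linarith)), Real.one_rpow, Real.zero_rpow (by linarith),
        sub_zero]
    rw [hI] at key
    refine key.congr fun n => ?_
    rw [← Finset.sum_div, totalLength]
  · intro n x hx h1 h2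
    have hn : 1 ≤ n := h1.trans h2
    have hn0 : (0 : ℝ) < n := by exact_mod_cast hn
    have e : (n : ℝ) • (a ⌊x * n⌋₊ / (n * a n)) = a ⌊x * n⌋₊ / a n := by
      have := (ha n hn).ne'
      rw [smul_eq_mul]
      field_simp
    rw [e, Real.norm_of_nonneg (div_pos (ha _ h1) (ha n hn)).le]
    refine (hpot _ n h1 h2).trans ?_
    rw [← Real.mul_rpow (by norm_num) hx.1.le]
    refine mul_le_mul_of_nonneg_left ?_ hC.le
    refine Real.rpow_le_rpow_of_nonpos (by linarith [hx.1]) ?_ (by norm_num)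
    have := half_le_floor_div h1
    rwa [inv_mul_eq_div]
  · intro x hx
    have := hx.1
    positivity
  · exact ((intervalIntegral.intervalIntegrable_rpow' (by norm_num)).const_mul _).const_mul _
  · intro x hx
    refine (h x hx.1).congr' ?_
    filter_upwards [eventually_ge_atTop 1] with n hn
    have hn0 : (0 : ℝ) < n := by exact_mod_cast hn
    have := (ha n hn).ne'
    rw [smul_eq_mul]
    field_simp
  · refine tendsto_one_div_atTop_nhds_zero_nat.congr' ?_
    filter_upwards [eventually_ge_atTop 1] with n hn
    have := (ha n hn).ne'
    field_simp

lemma tendsto_mul_segProb (ha : ∀ n, 1 ≤ n → 0 < a n) (h : RegularlyVarying a α)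
    (hα : 0 ≤ α) : Tendsto (fun n : ℕ => n * segProb a n) atTop (𝓝 (α + 1)) := by
  have := (h.tendsto_totalLength_div ha hα).inv₀ (by positivity)
  rw [one_div, inv_inv] at this
  refine this.congr fun n => ?_
  rw [inv_div, segProb, mul_div_assoc]

lemma exists_segProb_le (ha : ∀ n, 1 ≤ n → 0 < a n) (h : RegularlyVarying a α) (hα : 0 ≤ α) :
    ∃ C : ℝ, 0 ≤ C ∧ ∀ n : ℕ, 1 ≤ n → segProb a n ≤ C / n := by
  obtain ⟨C, hC⟩ := (h.tendsto_mul_segProb ha hα).bddAbove_range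
  refine ⟨max C 0, le_max_right _ _, fun n hn => ?_⟩
  have hn0 : (0 : ℝ) < n := by exact_mod_cast hn
  rw [le_div_iff₀ hn0, mul_comm]
  exact (hC ⟨n, rfl⟩).trans (le_max_left _ _)

/-- Since `segProb a n` is O(1/n). Both the decorrelation and the branching estimates use regular
variation only through this summability and the divergence of the scale. -/
lemma summable_segProb_sq (ha : ∀ n, 1 ≤ n → 0 < a n) (h : RegularlyVarying a α) (hα : 0 ≤ α) :
    Summable fun i => segProb a (i + 1) ^ 2 := by
  obtain ⟨C, hC0, hC⟩ := h.exists_segProb_le ha hα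
  have h1 : Summable fun n : ℕ => C ^ 2 * (1 / (n : ℝ) ^ 2) :=
    (Real.summable_one_div_nat_pow.2 one_lt_two).mul_left _
  refine Summable.of_nonneg_of_le (fun i => by positivity) (fun i => ?_)
    ((summable_nat_add_iff 1).2 h1)
  have := hC (i + 1) (by omega)
  calc segProb a (i + 1) ^ 2 ≤ (C / ((i + 1 : ℕ) : ℝ)) ^ 2 :=
        pow_le_pow_left₀ (segProb_pos ha (by omega)).le this 2
    _ = _ := by rw [div_pow, mul_one_div]

/-- The limit of the sums over the levels of a function of the rescaled segment length. -/
lemma tendsto_sum_segProb_smul {E : Type*} [NormedAddCommGroup E] [NormedSpace ℝ E]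
    [CompleteSpace E] [MeasurableSpace E] [BorelSpace E] [SecondCountableTopology E]
    (ha : ∀ n, 1 ≤ n → 0 < a n) (h : RegularlyVarying a α) (hα : 0 < α) {G : ℝ → E}
    (hG : Continuous G) (hG' : ∀ C : ℝ, ∃ K : ℝ, ∀ s, 0 ≤ s → s ≤ C → ‖G s‖ ≤ K * s) :
    Tendsto (fun n => ∑ i ∈ Finset.Icc 1 n, segProb a i • G (a i / a n)) atTop
      (𝓝 (∫ x in (0 : ℝ)..1, ((α + 1) / x) • G (x ^ α))) := by
  obtain ⟨C, hC, hpot⟩ := h.exists_potter ha (half_lt_self hα)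
  obtain ⟨D, hD0, hD⟩ := h.exists_segProb_le ha hα.le
  obtain ⟨K', hK'⟩ := hG' C
  set K := max K' 0
  have hK0 : 0 ≤ K := le_max_right _ _
  have hK : ∀ s, 0 ≤ s → s ≤ C → ‖G s‖ ≤ K * s := fun s h0 h1 =>
    (hK' s h0 h1).trans (mul_le_mul_of_nonneg_right (le_max_left _ _) h0)
  refine tendsto_sum_of_floor_dominated (H := fun n i => segProb a i • G (a i / a n))
    -- The factor 2D/x bounds `n * segProb`, and K C x^(α/2) bounds `G` by Potter. Linear decay of
    -- `G` at 0 is what compensates the 1/x.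
    (bound := fun x => 2 * D * K * C * x ^ (α / 2 - 1)) ?_ ?_ ?_ ?_ ?_
  · intro n x hx h1 h2
    have hn : 1 ≤ n := h1.trans h2
    have hn0 : (0 : ℝ) < n := by exact_mod_cast hn
    set i := ⌊x * n⌋₊ with hi
    have hi0 : (0 : ℝ) < i := by exact_mod_cast h1
    have hp := hpot i n h1 h2
    have hr0 : 0 ≤ a i / a n := (div_pos (ha i h1) (ha n hn)).le
    have hix : (i : ℝ) / n ≤ x := floor_div_le hx.1.le n
    have hix2 : x / 2 ≤ (i : ℝ) / n := half_le_floor_div h1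
    have hpow : ((i : ℝ) / n) ^ (α / 2) ≤ x ^ (α / 2) :=
      Real.rpow_le_rpow (by positivity) hix (by linarith)
    have hpow1 : x ^ (α / 2) ≤ 1 := Real.rpow_le_one hx.1.le hx.2.le (by linarith)
    have hr1 : a i / a n ≤ C * x ^ (α / 2) := hp.trans (by gcongr)
    have hGle := hK _ hr0 (hr1.trans (mul_le_of_le_one_right hC.le hpow1))
    have hnp : n * segProb a i ≤ 2 * D / x := by
      have h3 := hD i h1
      rw [le_div_iff₀ hi0] at h3
      rw [le_div_iff₀ hx.1]
      rw [div_le_div_iff₀ two_pos hn0] at hix2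
      have h4 := (segProb_pos ha h1).le
      nlinarith
    rw [norm_smul, norm_smul, Real.norm_of_nonneg hn0.le,
      Real.norm_of_nonneg (segProb_pos ha h1).le, ← mul_assoc]
    have hx0 := hx.1
    calc _ ≤ (2 * D / x) * (K * (C * x ^ (α / 2))) := by
          refine mul_le_mul hnp (hGle.trans (by gcongr)) (norm_nonneg _) (by positivity)
      _ = _ := by
          rw [Real.rpow_sub_one hx.1.ne']
          ring
  · intro x hx
    have := hx.1
    positivity
  · exact (intervalIntegral.intervalIntegrable_rpow' (by linarith)).const_mul _
  · intro x hx
    have h1 := (hG.tendsto (x ^ α)).comp (h x hx.1)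
    have h2 : Tendsto (fun n : ℕ => (n : ℝ) * segProb a ⌊x * n⌋₊) atTop (𝓝 ((α + 1) / x)) := by
      have := ((h.tendsto_mul_segProb ha hα.le).comp (tendsto_floor_mul_atTop hx.1)).div
        (tendsto_floor_mul_div hx.1) hx.1.ne'
      refine this.congr' ?_
      filter_upwards [(tendsto_floor_mul_atTop hx.1).eventually_ge_atTop 1,
        eventually_ge_atTop 1] with n hn hn1
      have hi0 : (0 : ℝ) < ⌊x * n⌋₊ := by exact_mod_cast hn
      have hn0 : (0 : ℝ) < n := by exact_mod_cast hn1
      simp only [Pi.div_apply, Function.comp_apply]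
      field_simp
    refine (h2.smul h1).congr fun n => ?_
    rw [mul_smul]
    rfl
  · have h1 : Tendsto (fun n : ℕ => D / (n : ℝ) * ‖G 1‖) atTop (𝓝 0) := by
      simpa using (tendsto_const_div_atTop_nhds_zero_nat D).mul_const ‖G 1‖
    refine squeeze_zero_norm' ?_ h1
    filter_upwards [eventually_ge_atTop 1] with n hn
    rw [div_self (ha n hn).ne', norm_smul, Real.norm_of_nonneg (segProb_pos ha hn).le]
    exact mul_le_mul_of_nonneg_right (hD n hn) (norm_nonneg _)

lemma tendsto_heightProd_of_pos (ha : ∀ n, 1 ≤ n → 0 < a n) (h : RegularlyVarying a α)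
    (hα : 0 < α) (z : ℂ) : Tendsto (fun n => heightProd a (z / a n) n) atTop
      (𝓝 (Complex.exp (∫ x in (0 : ℝ)..1,
        ((α + 1) / x) • (unifMgf (z * (x ^ α : ℝ)) - 1)))) := by
  obtain ⟨C, hC, hle⟩ := h.exists_le_mul ha hα
  -- The identity function gives the bound `B` on the sums of norms; `key` below gives the limit of
  -- the exponents.
  have hsum := h.tendsto_sum_segProb_smul ha hα (G := fun s : ℝ => s) continuous_id
    fun C => ⟨1, fun s hs _ => by rw [Real.norm_of_nonneg hs, one_mul]⟩
  obtain ⟨B, hB⟩ := hsum.bddAbove_range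
  refine tendsto_heightProd ha (h.summable_segProb_sq ha hα.le) (h.tendsto_atTop_of_pos ha hα) ha
    (C := C) (B := B) (fun i n hi hin => (div_le_iff₀ (ha n (hi.trans hin))).2 (hle i n hi hin))
    (.of_forall fun n => hB ⟨n, rfl⟩) ?_
  have key := h.tendsto_sum_segProb_smul ha hα
    (G := fun s : ℝ => unifMgf (z * (s : ℝ)) - 1)
    ((continuous_unifMgf.comp (by fun_prop)).sub continuous_const)
    fun C => ⟨‖z‖ * Real.exp (‖z‖ * C), fun s hs hsC => ?_⟩
  · simpa only [Complex.real_smul] using key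
  · refine (norm_unifMgf_sub_one_le _).trans ?_
    rw [norm_mul, Complex.norm_real, Real.norm_of_nonneg hs]
    have : Real.exp (‖z‖ * s) ≤ Real.exp (‖z‖ * C) := by gcongr
    calc _ ≤ ‖z‖ * s * Real.exp (‖z‖ * C) := by gcongr
      _ = _ := by ring

end RegularlyVarying

/-! ### Limits for index 0 -/

section SlowVariation

variable {a : ℕ → ℝ}

lemma harmonicSum_pos (ha : ∀ n, 1 ≤ n → 0 < a n) {n : ℕ} (hn : 1 ≤ n) : 0 < harmonicSum a n := by
  refine Finset.sum_pos (fun i hi => ?_) ⟨1, by simp [hn]⟩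
  have hi := (Finset.mem_Icc.1 hi).1
  have : (0 : ℝ) < i := by exact_mod_cast hi
  exact mul_pos (inv_pos.2 this) (ha i hi)

lemma harmonicSum_mono (ha : ∀ n, 1 ≤ n → 0 < a n) : Monotone (harmonicSum a) := by
  intro m n hmn
  refine Finset.sum_le_sum_of_subset_of_nonneg (Finset.Icc_subset_Icc_right hmn)
    fun i hi _ => mul_nonneg (by positivity) (ha i (Finset.mem_Icc.1 hi).1).le

lemma RegularlyVarying.tendsto_div_harmonicSum (ha : ∀ n, 1 ≤ n → 0 < a n)
    (h : RegularlyVarying a 0) : Tendsto (fun n => a n / harmonicSum a n) atTop (𝓝 0) := by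
  -- Without the weight (i/n)^η, the Riemann sum for S_n / a_n would approach the divergent integral
  -- of 1/x. With it, the sum is a lower bound for S_n / a_n and tends to 1/η; since 1/η > 1/(2η),
  -- eventually a_n / S_n ≤ 2η.
  have key : ∀ η : ℝ, 0 < η → η < 1 →
      ∀ᶠ n in atTop, a n / harmonicSum a n ≤ 2 * η := by
    intro η hη hη1
    obtain ⟨C, hC, hpot⟩ := h.exists_potter ha (show -(η / 2) < 0 by linarith)
    have hlim := tendsto_sum_of_floor_dominated
      (H := fun n i => (i : ℝ)⁻¹ * (a i / a n) * ((i : ℝ) / n) ^ η)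
      (g := fun x : ℝ => x ^ (η - 1))
      (bound := fun x => C * ((2⁻¹ : ℝ) ^ (η / 2 - 1) * x ^ (η / 2 - 1))) ?_ ?_ ?_ ?_ ?_
    · have hI : ∫ x in (0 : ℝ)..1, x ^ (η - 1) = 1 / η := by
        rw [integral_rpow (Or.inl (by linarith)), Real.one_rpow, sub_add_cancel,
          Real.zero_rpow hη.ne', sub_zero]
      rw [hI] at hlim
      have hlt : 1 / (2 * η) < 1 / η := by
        rw [div_lt_div_iff₀ (by positivity) hη]
        linarith
      filter_upwards [hlim.eventually (lt_mem_nhds hlt), eventually_ge_atTop 1] with n hn hn1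
      have hn0 : (0 : ℝ) < n := by exact_mod_cast hn1
      have hle : ∑ i ∈ Finset.Icc 1 n, (i : ℝ)⁻¹ * (a i / a n) * ((i : ℝ) / n) ^ η ≤
          harmonicSum a n / a n := by
        rw [harmonicSum, Finset.sum_div]
        refine Finset.sum_le_sum fun i hi => ?_
        obtain ⟨hi1, hin⟩ := Finset.mem_Icc.1 hi
        have hi0 : (0 : ℝ) < i := by exact_mod_cast hi1
        rw [← mul_div_assoc]
        refine mul_le_of_le_one_right
          (div_nonneg (mul_nonneg (by positivity) (ha i hi1).le) (ha n hn1).le) ?_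
        refine Real.rpow_le_one (by positivity) ?_ hη.le
        rw [div_le_one hn0]
        exact_mod_cast hin
      have h2 := hn.le.trans hle
      rw [div_le_div_iff₀ (by positivity) (ha n hn1), one_mul] at h2
      rw [div_le_iff₀ (harmonicSum_pos ha hn1)]
      linarith
    · intro n x hx h1 h2
      have hn : 1 ≤ n := h1.trans h2
      have hn0 : (0 : ℝ) < n := by exact_mod_cast hn
      set i := ⌊x * n⌋₊ with hi
      have hi0 : (0 : ℝ) < i := by exact_mod_cast h1
      have hp := hpot i n h1 h2
      have hr0 : 0 ≤ a i / a n := (div_pos (ha i h1) (ha n hn)).le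
      have hix2 : x / 2 ≤ (i : ℝ) / n := half_le_floor_div h1
      have hin0 : 0 < (i : ℝ) / n := by positivity
      rw [smul_eq_mul, Real.norm_of_nonneg (by positivity)]
      calc (n : ℝ) * ((i : ℝ)⁻¹ * (a i / a n) * ((i : ℝ) / n) ^ η)
          = ((i : ℝ) / n)⁻¹ * ((i : ℝ) / n) ^ η * (a i / a n) := by
            rw [inv_div]; ring
        _ ≤ ((i : ℝ) / n)⁻¹ * ((i : ℝ) / n) ^ η * (C * ((i : ℝ) / n) ^ (-(η / 2))) := by gcongr
        _ = C * ((i : ℝ) / n) ^ (η / 2 - 1) := by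
            rw [show η / 2 - 1 = η + -(η / 2) - 1 by ring, Real.rpow_sub_one hin0.ne',
              Real.rpow_add hin0]
            ring
        _ ≤ _ := by
            rw [← Real.mul_rpow (by norm_num) hx.1.le]
            refine mul_le_mul_of_nonneg_left ?_ hC.le
            refine Real.rpow_le_rpow_of_nonpos (by linarith [hx.1]) ?_ (by linarith)
            rwa [inv_mul_eq_div]
    · intro x hx
      have := hx.1
      positivity
    · exact ((intervalIntegral.intervalIntegrable_rpow' (by linarith)).const_mul _).const_mul _
    · intro x hx
      have h1 := tendsto_floor_mul_div hx.1
      have h2 := ((h1.inv₀ hx.1.ne').mul (h x hx.1)).mul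
        (h1.rpow_const (p := η) (Or.inl hx.1.ne'))
      rw [Real.rpow_zero, mul_one] at h2
      rw [Real.rpow_sub_one hx.1.ne', div_eq_inv_mul]
      refine h2.congr fun n => ?_
      rw [inv_div, smul_eq_mul]
      ring
    · refine tendsto_one_div_atTop_nhds_zero_nat.congr' ?_
      filter_upwards [eventually_ge_atTop 1] with n hn
      have hn0 : (0 : ℝ) < n := by exact_mod_cast hn
      rw [div_self (ha n hn).ne', div_self hn0.ne', Real.one_rpow]
      simp
  rw [Metric.tendsto_nhds]
  intro ε hε
  have hη : 0 < min (ε / 4) (1 / 2) := by positivity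
  filter_upwards [key _ hη ((min_le_right _ _).trans_lt (by norm_num)), eventually_ge_atTop 1]
    with n hn hn1
  rw [dist_zero_right, Real.norm_of_nonneg (div_pos (ha n hn1) (harmonicSum_pos ha hn1)).le]
  linarith [min_le_left (ε / 4) (1 / 2)]

/-- Weighted Cesàro means. -/
lemma tendsto_sum_mul_div_harmonicSum (ha : ∀ n, 1 ≤ n → 0 < a n)
    (hS : Tendsto (harmonicSum a) atTop atTop) {c : ℕ → ℝ} {L : ℝ} (hc : Tendsto c atTop (𝓝 L)) :
    Tendsto (fun n => (∑ i ∈ Finset.Icc 1 n, c i * ((i : ℝ)⁻¹ * a i)) / harmonicSum a n) atTop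
      (𝓝 L) := by
  set b : ℕ → ℝ := fun i => ((i + 1 : ℕ) : ℝ)⁻¹ * a (i + 1) with hb
  have hSb : harmonicSum a = fun n => ∑ i ∈ Finset.range n, b i := by
    funext n
    rw [harmonicSum, sum_Icc_one_eq_sum_range]
  have hc' : Tendsto (fun i => c (i + 1) - L) atTop (𝓝 0) := by
    simpa using ((tendsto_add_atTop_iff_nat 1).2 hc).sub_const L
  have h1 : (fun i => (c (i + 1) - L) * b i) =o[atTop] b := by
    have := ((Asymptotics.isLittleO_one_iff ℝ).2 hc').mul_isBigO (Asymptotics.isBigO_refl b atTop)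
    simpa using this
  have h2 := h1.sum_range (fun i => mul_nonneg (by positivity) (ha (i + 1) (by omega)).le)
    (hSb ▸ hS)
  have h3 := h2.tendsto_div_nhds_zero.add_const L
  rw [zero_add] at h3
  refine h3.congr' ?_
  filter_upwards [eventually_ge_atTop 1] with n hn
  have hpos := (harmonicSum_pos ha hn).ne'
  have hSn : ∑ i ∈ Finset.range n, b i = harmonicSum a n := by rw [hSb]
  simp only [sub_mul, Finset.sum_sub_distrib, ← Finset.mul_sum]
  rw [hSn, sub_div, mul_div_cancel_right₀ _ hpos, sub_add_cancel, sum_Icc_one_eq_sum_range]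

lemma RegularlyVarying.tendsto_heightProd_of_zero (ha : ∀ n, 1 ≤ n → 0 < a n)
    (h : RegularlyVarying a 0) (hS : Tendsto (harmonicSum a) atTop atTop) (z : ℂ) :
    Tendsto (fun n => heightProd a (z / harmonicSum a n) n) atTop (𝓝 (Complex.exp (z / 2))) := by
  have hr := h.tendsto_div_harmonicSum ha
  obtain ⟨C, hC⟩ := hr.bddAbove_range
  have hCle : ∀ i n, 1 ≤ i → i ≤ n → a i / harmonicSum a n ≤ a i / harmonicSum a i :=
    fun i n hi hin => div_le_div_of_nonneg_left (ha i hi).le (harmonicSum_pos ha hi)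
      (harmonicSum_mono ha hin)
  have hC' : ∀ i n, 1 ≤ i → i ≤ n → a i / harmonicSum a n ≤ C := fun i n hi hin =>
    (hCle i n hi hin).trans (hC ⟨i, rfl⟩)
  have hp := h.tendsto_mul_segProb ha le_rfl
  rw [zero_add] at hp
  have hsum1 : Tendsto (fun n => ∑ i ∈ Finset.Icc 1 n, segProb a i * (a i / harmonicSum a n))
      atTop (𝓝 1) := by
    refine (tendsto_sum_mul_div_harmonicSum ha hS hp).congr fun n => ?_
    rw [Finset.sum_div]
    refine Finset.sum_congr rfl fun i hi => ?_
    have : (0 : ℝ) < i := by exact_mod_cast (Finset.mem_Icc.1 hi).1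
    field_simp
  -- Since S increases, one factor a_i / S_n is at most a_i / S_i, which tends to 0; weighted Cesàro
  -- then applies.
  have hsum2 : Tendsto (fun n => ∑ i ∈ Finset.Icc 1 n,
      segProb a i * (a i / harmonicSum a n) ^ 2) atTop (𝓝 0) := by
    have h1 := tendsto_sum_mul_div_harmonicSum ha hS (hp.mul hr)
    rw [mul_zero] at h1
    refine squeeze_zero (fun n => Finset.sum_nonneg fun i hi => mul_nonneg
      (segProb_pos ha (Finset.mem_Icc.1 hi).1).le (by positivity)) (fun n => ?_) h1
    rw [Finset.sum_div]
    refine Finset.sum_le_sum fun i hi => ?_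
    obtain ⟨hi1, hin⟩ := Finset.mem_Icc.1 hi
    have hi0 : (0 : ℝ) < i := by exact_mod_cast hi1
    have h2 := hCle i n hi1 hin
    have h3 := segProb_pos ha hi1
    have h4 : 0 ≤ a i / harmonicSum a n :=
      (div_pos (ha i hi1) (harmonicSum_pos ha (hi1.trans hin))).le
    calc segProb a i * (a i / harmonicSum a n) ^ 2
        ≤ segProb a i * (a i / harmonicSum a i * (a i / harmonicSum a n)) := by
          rw [sq]; gcongr
      _ = _ := by field_simp
  obtain ⟨B, hB⟩ := hsum1.bddAbove_range
  refine tendsto_heightProd ha (h.summable_segProb_sq ha le_rfl) hS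
    (fun n hn => harmonicSum_pos ha hn) hC' (.of_forall fun n => hB ⟨n, rfl⟩) ?_
  set K := ‖z‖ ^ 2 * Real.exp (‖z‖ * C)
  have hdiff : Tendsto (fun n => ∑ i ∈ Finset.Icc 1 n,
      (segProb a i : ℂ) * (unifMgf (z * (a i / harmonicSum a n : ℝ)) - 1) -
      z / 2 * ((∑ i ∈ Finset.Icc 1 n, segProb a i * (a i / harmonicSum a n) : ℝ) : ℂ)) atTop
      (𝓝 0) := by
    refine squeeze_zero_norm (a := fun n => K * ∑ i ∈ Finset.Icc 1 n,
      segProb a i * (a i / harmonicSum a n) ^ 2) (fun n => ?_) (by simpa using hsum2.const_mul K)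
    rw [Complex.ofReal_sum, Finset.mul_sum, ← Finset.sum_sub_distrib, Finset.mul_sum]
    refine (norm_sum_le _ _).trans (Finset.sum_le_sum fun i hi => ?_)
    obtain ⟨hi1, hin⟩ := Finset.mem_Icc.1 hi
    have h3 := (segProb_pos ha hi1).le
    have h4 : 0 ≤ a i / harmonicSum a n :=
      (div_pos (ha i hi1) (harmonicSum_pos ha (hi1.trans hin))).le
    set s := a i / harmonicSum a n with hs
    have h5 : (segProb a i : ℂ) * (unifMgf (z * (s : ℝ)) - 1) -
        z / 2 * ((segProb a i * s : ℝ) : ℂ) =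
        segProb a i * (unifMgf (z * (s : ℝ)) - 1 - z * s / 2) := by push_cast; ring
    rw [h5, norm_mul, Complex.norm_real, Real.norm_of_nonneg h3]
    have h6 := norm_unifMgf_sub_one_sub_half_le (z * (s : ℝ))
    rw [norm_mul, Complex.norm_real, Real.norm_of_nonneg h4] at h6
    have h7 : Real.exp (‖z‖ * s) ≤ Real.exp (‖z‖ * C) := by
      gcongr
      exact hC' i n hi1 hin
    calc _ ≤ segProb a i * ((‖z‖ * s) ^ 2 * Real.exp (‖z‖ * C)) :=
          mul_le_mul_of_nonneg_left (h6.trans (by gcongr)) h3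
      _ = _ := by simp only [K]; ring
  have h2 := hdiff.add (((Complex.continuous_ofReal.tendsto 1).comp hsum1).const_mul (z / 2))
  simp only [Function.comp, sub_add_cancel, zero_add, Complex.ofReal_one, mul_one] at h2
  exact h2

end SlowVariation

/-! ### Identification of the limit exponent -/

section XiExponent

lemma unifMgf_ofReal (t : ℝ) : unifMgf t = (unifMgfReal t : ℂ) := by
  rw [unifMgf, unifMgfReal, ← intervalIntegral.integral_ofReal]
  push_cast
  rfl

lemma unifMgfReal_eq {s : ℝ} (hs : s ≠ 0) : unifMgfReal s = (Real.exp s - 1) / s := by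
  rw [unifMgfReal, intervalIntegral.integral_comp_mul_left (fun x => Real.exp x) hs]
  simp [integral_exp, div_eq_inv_mul]

lemma continuous_unifMgfReal : Continuous unifMgfReal :=
  intervalIntegral.continuous_parametric_intervalIntegral_of_continuous'
    (f := fun (t : ℝ) (u : ℝ) => Real.exp (t * u)) (by fun_prop) 0 1

lemma abs_unifMgfReal_sub_one_le (t : ℝ) : |unifMgfReal t - 1| ≤ |t| * Real.exp |t| := by
  have h := norm_unifMgf_sub_one_le t
  rw [unifMgf_ofReal, ← Complex.ofReal_one, ← Complex.ofReal_sub, Complex.norm_real,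
    Complex.norm_real] at h
  exact h

lemma abs_exp_sub_one_le_mul_exp (t : ℝ) : |Real.exp t - 1| ≤ |t| * Real.exp |t| := by
  have h1 := Complex.norm_exp_sub_sum_le_norm_mul_exp t 1
  simp only [Finset.sum_range_one, pow_zero, Nat.factorial_zero, Nat.cast_one, div_one,
    pow_one] at h1
  rw [← Complex.ofReal_exp, ← Complex.ofReal_one, ← Complex.ofReal_sub, Complex.norm_real,
    Complex.norm_real] at h1
  exact h1

lemma intervalIntegrable_of_bounded {f : ℝ → ℝ} (hf : Measurable f) {C : ℝ}
    (hC : ∀ x ∈ Set.Ioc (0 : ℝ) 1, |f x| ≤ C) : IntervalIntegrable f volume 0 1 := by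
  rw [intervalIntegrable_iff_integrableOn_Ioc_of_le zero_le_one]
  refine Measure.integrableOn_of_bounded (M := C) (by simp) hf.aestronglyMeasurable ?_
  filter_upwards [ae_restrict_mem measurableSet_Ioc] with x hx using hC x hx

/-- A quantity of first order in `t * y` stays bounded after division by `y`; this gives
integrability at 0. -/
lemma div_abs_le_of_abs_le {t y w : ℝ} (hy : y ∈ Set.Ioc (0 : ℝ) 1)
    (hw : |w| ≤ |t * y| * Real.exp |t * y|) : |w / y| ≤ |t| * Real.exp |t| := by
  have h1 : |t * y| = |t| * y := by rw [abs_mul, abs_of_pos hy.1]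
  have h2 : |t| * y ≤ |t| := mul_le_of_le_one_right (abs_nonneg t) hy.2
  rw [h1] at hw
  rw [abs_div, abs_of_pos hy.1, div_le_iff₀ hy.1]
  calc |w| ≤ |t| * y * Real.exp (|t| * y) := hw
    _ ≤ |t| * y * Real.exp |t| := mul_le_mul_of_nonneg_left (Real.exp_le_exp.2 h2)
        (mul_nonneg (abs_nonneg t) hy.1.le)
    _ = _ := by ring

/-- Integration by parts for the exponent. -/
lemma integral_unifMgfReal_sub_one_div (t : ℝ) :
    ∫ y in (0 : ℝ)..1, (unifMgfReal (t * y) - 1) / y =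
      ∫ u in (0 : ℝ)..1, (Real.exp (t * u) - 1) * ((1 - u) / u) := by
  rcases eq_or_ne t 0 with rfl | ht
  · simp [unifMgfReal]
  have hm : Measurable fun y : ℝ => unifMgfReal (t * y) :=
    (continuous_unifMgfReal.comp (by fun_prop)).measurable
  have i1 : IntervalIntegrable (fun y => (unifMgfReal (t * y) - 1) / y) volume 0 1 :=
    intervalIntegrable_of_bounded (by fun_prop) fun y hy =>
      div_abs_le_of_abs_le hy (abs_unifMgfReal_sub_one_le _)
  have i2 : IntervalIntegrable (fun y => (Real.exp (t * y) - 1) / y) volume 0 1 :=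
    intervalIntegrable_of_bounded (by fun_prop) fun y hy =>
      div_abs_le_of_abs_le hy (abs_exp_sub_one_le_mul_exp _)
  have i3 : IntervalIntegrable (fun y => Real.exp (t * y) - 1) volume 0 1 :=
    Continuous.intervalIntegrable (by fun_prop) _ _
  -- With F(y) = (e^(ty) - 1)/(ty), one has F'(y) = (e^(ty) - 1)/y - (F(y) - 1)/y. The boundary term
  -- F(1) - F(0) is the integral of e^(tu) - 1, which turns 1/u into (1 - u)/u.
  have hftc : ∫ y in (0 : ℝ)..1, ((Real.exp (t * y) - 1) / y - (unifMgfReal (t * y) - 1) / y) =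
      unifMgfReal (t * 1) - unifMgfReal (t * 0) := by
    refine intervalIntegral.integral_eq_sub_of_hasDerivAt_of_le
      (f := fun y => unifMgfReal (t * y)) zero_le_one
      (continuous_unifMgfReal.comp (by fun_prop)).continuousOn (fun y hy => ?_) (i2.sub i1)
    have hy0 : y ≠ 0 := hy.1.ne'
    have hd : HasDerivAt (fun y => (Real.exp (t * y) - 1) / (t * y))
        ((Real.exp (t * y) * (t * 1) * (t * y) - (Real.exp (t * y) - 1) * (t * 1)) / (t * y) ^ 2)
        y := by
      have h1 := (hasDerivAt_id y).const_mul t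
      exact (h1.exp.sub_const 1).div h1 (mul_ne_zero ht hy0)
    have heq : (fun y => unifMgfReal (t * y)) =ᶠ[𝓝 y]
        fun y => (Real.exp (t * y) - 1) / (t * y) := by
      filter_upwards [isOpen_ne.mem_nhds hy0] with x hx
      exact unifMgfReal_eq (mul_ne_zero ht hx)
    refine (hd.congr_of_eventuallyEq heq).congr_deriv ?_
    rw [unifMgfReal_eq (mul_ne_zero ht hy0)]
    field_simp
    ring
  rw [intervalIntegral.integral_sub i2 i1] at hftc
  have hu : ∫ u in (0 : ℝ)..1, (Real.exp (t * u) - 1) = unifMgfReal t - 1 := by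
    rw [intervalIntegral.integral_sub (Continuous.intervalIntegrable (by fun_prop) _ _) (by simp)]
    simp [unifMgfReal]
  have h0 : unifMgfReal 0 = 1 := by simp [unifMgfReal]
  have hR : ∫ u in (0 : ℝ)..1, (Real.exp (t * u) - 1) * ((1 - u) / u) =
      ∫ u in (0 : ℝ)..1, ((Real.exp (t * u) - 1) / u - (Real.exp (t * u) - 1)) := by
    refine intervalIntegral.integral_congr_Ioo_of_le zero_le_one fun u hu => ?_
    have := hu.1.ne'
    field_simp
  rw [hR, intervalIntegral.integral_sub i2 i3, hu]
  rw [mul_one, mul_zero, h0] at hftc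
  linarith

/-- A power change of variables on the unit interval. -/
lemma integral_rpow_div {α : ℝ} (hα : 0 < α) (f : ℝ → ℝ) :
    ∫ x in (0 : ℝ)..1, f (x ^ α) / x = α⁻¹ * ∫ y in (0 : ℝ)..1, f y / y := by
  have h := integral_comp_rpow_Ioi (fun y => (Set.Ioc (0 : ℝ) 1).indicator (fun y => f y / y) y)
    hα.ne'
  rw [setIntegral_indicator measurableSet_Ioc, Set.inter_eq_right.2 Set.Ioc_subset_Ioi_self,
    ← intervalIntegral.integral_of_le zero_le_one] at h
  rw [← h, intervalIntegral.integral_of_le zero_le_one, ← integral_const_mul]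
  have h2 : ∫ x in Set.Ioc (0 : ℝ) 1, f (x ^ α) / x =
      ∫ x in Set.Ioi (0 : ℝ), (Set.Ioc (0 : ℝ) 1).indicator (fun x => f (x ^ α) / x) x := by
    rw [setIntegral_indicator measurableSet_Ioc, Set.inter_eq_right.2 Set.Ioc_subset_Ioi_self]
  rw [h2]
  refine setIntegral_congr_fun measurableSet_Ioi fun x hx => ?_
  have hx : 0 < x := hx
  have hiff : x ^ α ∈ Set.Ioc (0 : ℝ) 1 ↔ x ∈ Set.Ioc (0 : ℝ) 1 := by
    simp only [Set.mem_Ioc, hx, Real.rpow_pos_of_pos hx, true_and]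
    rw [Real.rpow_le_one_iff_of_pos hx]
    refine ⟨?_, fun h => Or.inr ⟨h, hα.le⟩⟩
    rintro (⟨-, h⟩ | ⟨h, -⟩)
    · linarith
    · exact h
  by_cases hx1 : x ∈ Set.Ioc (0 : ℝ) 1
  · rw [Set.indicator_of_mem hx1, Set.indicator_of_mem (hiff.2 hx1), abs_of_pos hα,
      smul_eq_mul, Real.rpow_sub_one hx.ne']
    have := (Real.rpow_pos_of_pos hx α).ne'
    field_simp
  · rw [Set.indicator_of_notMem hx1, Set.indicator_of_notMem (mt hiff.1 hx1)]
    simp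

lemma integral_exponent_eq_xiExponent {α : ℝ} (hα : 0 < α) (t : ℝ) :
    ∫ x in (0 : ℝ)..1, ((α + 1) / x) • (unifMgf ((t : ℂ) * (x ^ α : ℝ)) - 1) =
      (xiExponent α t : ℂ) := by
  have h1 : ∀ x : ℝ, ((α + 1) / x) • (unifMgf ((t : ℂ) * (x ^ α : ℝ)) - 1) =
      (((α + 1) * ((unifMgfReal (t * x ^ α) - 1) / x) : ℝ) : ℂ) := by
    intro x
    rw [← Complex.ofReal_mul, unifMgf_ofReal, Complex.real_smul]
    push_cast
    ring
  simp only [h1]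
  rw [intervalIntegral.integral_ofReal, intervalIntegral.integral_const_mul,
    integral_rpow_div hα fun y => unifMgfReal (t * y) - 1, integral_unifMgfReal_sub_one_div,
    xiExponent]
  congr 1
  ring

/-- The exponent is at most (α + 1)|t|e^|t| times the integral of x^(α-1). Continuity at 0 is what
tightness requires. -/
lemma continuousAt_exponent {α : ℝ} (hα : 0 < α) :
    ContinuousAt (fun t : ℝ => Complex.exp (∫ x in (0 : ℝ)..1,
      ((α + 1) / x) • (unifMgf ((t : ℂ) * Complex.I * (x ^ α : ℝ)) - 1))) 0 := by
  refine Complex.continuous_exp.continuousAt.comp ?_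
  have h0 : ∫ x in (0 : ℝ)..1,
      ((α + 1) / x) • (unifMgf (((0 : ℝ) : ℂ) * Complex.I * (x ^ α : ℝ)) - 1) = 0 := by
    simp [unifMgf]
  rw [ContinuousAt, h0]
  set J := ∫ x in (0 : ℝ)..1, x ^ (α - 1) with hJ
  refine squeeze_zero_norm (a := fun t : ℝ => (α + 1) * |t| * Real.exp |t| * J) (fun t => ?_) ?_
  · rw [hJ, ← intervalIntegral.integral_const_mul]
    refine intervalIntegral.norm_integral_le_of_norm_le zero_le_one (.of_forall fun x hx => ?_)
      ((intervalIntegral.intervalIntegrable_rpow' (by linarith)).const_mul _)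
    have hx0 := hx.1
    have hp1 : x ^ α ≤ 1 := Real.rpow_le_one hx.1.le hx.2 hα.le
    have hn : ‖(t : ℂ) * Complex.I * (x ^ α : ℝ)‖ = |t| * x ^ α := by
      rw [norm_mul, norm_mul, Complex.norm_I, mul_one, Complex.norm_real, Complex.norm_real,
        Real.norm_eq_abs, Real.norm_of_nonneg (by positivity)]
    have h1 := norm_unifMgf_sub_one_le ((t : ℂ) * Complex.I * (x ^ α : ℝ))
    rw [hn] at h1
    have h2 : Real.exp (|t| * x ^ α) ≤ Real.exp |t| :=
      Real.exp_le_exp.2 (mul_le_of_le_one_right (abs_nonneg t) hp1)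
    rw [norm_smul, Real.norm_of_nonneg (by positivity)]
    calc _ ≤ (α + 1) / x * (|t| * x ^ α * Real.exp |t|) := by
          refine mul_le_mul_of_nonneg_left (h1.trans ?_) (by positivity)
          gcongr
      _ = _ := by
          rw [Real.rpow_sub_one hx0.ne']
          ring
  · have : Continuous fun t : ℝ => (α + 1) * |t| * Real.exp |t| * J := by fun_prop
    simpa using this.tendsto 0

end XiExponent

/-! ### Weak limits and exponential moments -/

section MgfLimit

lemma mgf_eq_of_lintegral {ν : Measure ℝ} {t M : ℝ} (hM : 0 ≤ M)
    (h : ∫⁻ x, ENNReal.ofReal (Real.exp (t * x)) ∂ν = ENNReal.ofReal M) : mgf id ν t = M := by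
  rw [mgf, integral_eq_lintegral_of_nonneg_ae (.of_forall fun x => (Real.exp_pos _).le)
    (by fun_prop)]
  simp only [id]
  rw [h, ENNReal.toReal_ofReal hM]

/-- Exponential moments pass to weak limits when they converge everywhere. -/
lemma lintegral_exp_eq_of_tendsto {μ : ℕ → ProbabilityMeasure ℝ} {ν : ProbabilityMeasure ℝ}
    (hμ : Tendsto μ atTop (𝓝 ν)) {M : ℝ → ℝ} (hmgf : ∀ t, Tendsto
      (fun n => ∫⁻ x, ENNReal.ofReal (Real.exp (t * x)) ∂(μ n : Measure ℝ)) atTop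
      (𝓝 (ENNReal.ofReal (M t)))) (t : ℝ) :
    ∫⁻ x, ENNReal.ofReal (Real.exp (t * x)) ∂(ν : Measure ℝ) = ENNReal.ofReal (M t) := by
  -- Truncation makes the exponential bounded and continuous, hence a test function for weak
  -- convergence.
  let g : ℕ → ℝ → NNReal := fun k x => min (Real.toNNReal (Real.exp (t * x))) k
  have hg : ∀ k, Continuous (g k) := fun k => by fun_prop
  have hconv : ∀ k, Tendsto (fun n => ∫⁻ x, (g k x : ENNReal) ∂(μ n : Measure ℝ)) atTop
      (𝓝 (∫⁻ x, (g k x : ENNReal) ∂(ν : Measure ℝ))) := by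
    intro k
    have := ProbabilityMeasure.tendsto_iff_forall_lintegral_tendsto.1 hμ
      (BoundedContinuousFunction.mkOfBound ⟨g k, hg k⟩ k fun x y => by
        rw [NNReal.dist_eq, abs_sub_le_iff]
        have h1 : (g k x : ℝ) ≤ k := by exact_mod_cast min_le_right _ _
        have h2 : (g k y : ℝ) ≤ k := by exact_mod_cast min_le_right _ _
        have h3 := (g k x).coe_nonneg
        have h4 := (g k y).coe_nonneg
        constructor <;> simp only [ContinuousMap.coe_mk] <;> linarith)
    exact this
  have hmono : ∀ᵐ x ∂(ν : Measure ℝ), Monotone fun k => (g k x : ENNReal) :=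
    .of_forall fun x k l hkl => by
      simp only [g]
      gcongr
  have hsup : Tendsto (fun k => ∫⁻ x, (g k x : ENNReal) ∂(ν : Measure ℝ)) atTop
      (𝓝 (∫⁻ x, ENNReal.ofReal (Real.exp (t * x)) ∂(ν : Measure ℝ))) := by
    refine lintegral_tendsto_of_tendsto_of_monotone
      (fun k => ((hg k).measurable.coe_nnreal_ennreal).aemeasurable) hmono (.of_forall fun x => ?_)
    refine tendsto_const_nhds.congr' ?_
    obtain ⟨k₀, hk₀⟩ := exists_nat_ge (Real.toNNReal (Real.exp (t * x)))
    filter_upwards [eventually_ge_atTop k₀] with k hk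
    have : g k x = Real.toNNReal (Real.exp (t * x)) :=
      min_eq_left (hk₀.trans (by exact_mod_cast hk))
    rw [this]
    rfl
  refine le_antisymm (le_of_tendsto hsup (.of_forall fun k => ?_)) ?_
  · refine le_of_tendsto_of_tendsto' (hconv k) (hmgf t) fun n => lintegral_mono fun x => ?_
    exact ENNReal.coe_le_coe.2 (min_le_left _ _)
  -- No mass escapes: where e^(tx) ≥ k, it is at most e^(2tx)/k, so the truncation loses at most
  -- M(2t)/k uniformly in the sequence.
  · have hlow : ∀ k : ℕ, 1 ≤ k → ENNReal.ofReal (M t) ≤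
        ∫⁻ x, (g k x : ENNReal) ∂(ν : Measure ℝ) +
          (k : ENNReal)⁻¹ * ENNReal.ofReal (M (2 * t)) := by
      intro k hk
      have hk0 : (k : ENNReal) ≠ 0 := by exact_mod_cast (by omega : k ≠ 0)
      have hkt : (k : ENNReal) ≠ ⊤ := ENNReal.natCast_ne_top k
      have h1 : Tendsto (fun n => ∫⁻ x, (g k x : ENNReal) ∂(μ n : Measure ℝ) + (k : ENNReal)⁻¹ *
          ∫⁻ x, ENNReal.ofReal (Real.exp (2 * t * x)) ∂(μ n : Measure ℝ)) atTop
          (𝓝 (∫⁻ x, (g k x : ENNReal) ∂(ν : Measure ℝ) +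
            (k : ENNReal)⁻¹ * ENNReal.ofReal (M (2 * t)))) :=
        (hconv k).add (ENNReal.Tendsto.const_mul (hmgf (2 * t))
          (Or.inr (ENNReal.inv_ne_top.2 hk0)))
      refine le_of_tendsto_of_tendsto' (hmgf t) h1 fun n => ?_
      rw [← lintegral_const_mul _ (by fun_prop),
        ← lintegral_add_left (hg k).measurable.coe_nnreal_ennreal]
      refine lintegral_mono fun x => ?_
      have hk0' : (0 : ℝ) < k := by exact_mod_cast hk
      rcases le_total (Real.toNNReal (Real.exp (t * x))) (k : NNReal) with hle | hle
      · have : g k x = Real.toNNReal (Real.exp (t * x)) := min_eq_left hle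
        simp only [this]
        exact le_self_add
      · refine le_add_left ?_
        have hle' : (k : ℝ) ≤ Real.exp (t * x) := by
          have := NNReal.coe_le_coe.2 hle
          rwa [Real.coe_toNNReal _ (Real.exp_pos _).le] at this
        have e : Real.exp (2 * t * x) = Real.exp (t * x) * Real.exp (t * x) := by
          rw [← Real.exp_add]; ring_nf
        rw [e, ENNReal.ofReal_mul (Real.exp_pos _).le, ← mul_assoc]
        refine le_mul_of_one_le_left' ?_
        rw [← ENNReal.inv_mul_cancel hk0 hkt]
        gcongr
        rw [← ENNReal.ofReal_natCast]
        exact ENNReal.ofReal_le_ofReal hle'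
    have hlim : Tendsto (fun k : ℕ => ∫⁻ x, (g k x : ENNReal) ∂(ν : Measure ℝ) +
          (k : ENNReal)⁻¹ * ENNReal.ofReal (M (2 * t))) atTop
        (𝓝 (∫⁻ x, ENNReal.ofReal (Real.exp (t * x)) ∂(ν : Measure ℝ) + 0)) := by
      refine hsup.add ?_
      have := ENNReal.Tendsto.mul_const (b := ENNReal.ofReal (M (2 * t)))
        ENNReal.tendsto_inv_nat_nhds_zero (Or.inr ENNReal.ofReal_ne_top)
      rwa [zero_mul] at this
    rw [add_zero] at hlim
    refine ge_of_tendsto hlim ?_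
    filter_upwards [eventually_ge_atTop 1] with k hk using hlow k hk

/-- If the characteristic functions converge to a function continuous at `0` and the exponential
moments converge, then the limits come from a probability measure. -/
lemma exists_charFun_mgf_limit {μ : ℕ → ProbabilityMeasure ℝ} {f : ℝ → ℂ} {M : ℝ → ℝ}
    (hf : ContinuousAt f 0)
    (hchar : ∀ t, Tendsto (fun n => charFun (μ n : Measure ℝ) t) atTop (𝓝 (f t)))
    (hM : ∀ t, 0 ≤ M t) (hmgf : ∀ t, Tendsto
      (fun n => ∫⁻ x, ENNReal.ofReal (Real.exp (t * x)) ∂(μ n : Measure ℝ)) atTop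
      (𝓝 (ENNReal.ofReal (M t)))) :
    ∃ ν : ProbabilityMeasure ℝ, (∀ t, charFun (ν : Measure ℝ) t = f t) ∧
      ∀ t, mgf id (ν : Measure ℝ) t = M t := by
  have htight : IsTightMeasureSet (Set.range fun n => (μ n : Measure ℝ)) :=
    isTightMeasureSet_of_tendsto_charFun hf hchar
  have hcomp : IsCompact (closure (Set.range μ)) := by
    refine isCompact_closure_of_isTightMeasureSet ?_
    convert htight using 1
    ext m
    simp
  obtain ⟨ν, -, φ, hφ, hν⟩ := hcomp.tendsto_subseq fun n => subset_closure (Set.mem_range_self n)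
  refine ⟨ν, fun t => ?_, fun t => mgf_eq_of_lintegral (hM t) ?_⟩
  · exact tendsto_nhds_unique (ProbabilityMeasure.tendsto_iff_tendsto_charFun.1 hν t)
      ((hchar t).comp hφ.tendsto_atTop)
  · exact lintegral_exp_eq_of_tendsto hν (fun t => (hmgf t).comp hφ.tendsto_atTop) t

/-- The moment generating functions are finite and equal on the whole line, so their complex
extensions agree on the imaginary axis too, where they are the characteristic functions. -/
lemma IsXiLaw.unique {α : ℝ} {ν ν' : ProbabilityMeasure ℝ} (h : IsXiLaw α ν)
    (h' : IsXiLaw α ν') : ν = ν' := by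
  have hmgf : mgf id (ν : Measure ℝ) = mgf id (ν' : Measure ℝ) :=
    funext fun t => (h t).trans (h' t).symm
  have huniv : integrableExpSet id (ν : Measure ℝ) = Set.univ := by
    refine Set.eq_univ_of_forall fun t => ?_
    by_contra hcon
    -- An infinite exponential moment would give `mgf` its default value 0, which is not an
    -- exponential.
    have := mgf_undef hcon
    rw [h t] at this
    exact (Real.exp_pos _).ne' this
  have heq := eqOn_complexMGF_of_mgf hmgf
  have hν : (ν : Measure ℝ) = ν' := Measure.ext_of_charFun <| funext fun t => by
    rw [← complexMGF_id_mul_I, ← complexMGF_id_mul_I]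
    exact heq (by simp [huniv])
  exact Subtype.ext hν

end MgfLimit

/-! ### Convergence of heights and branch points -/

namespace IsMarkedGluing

variable {Ω : Type*} [MeasurableSpace Ω] {P : Measure Ω} {a : ℕ → ℝ} {ℓ : ℕ}
  {glue : ℕ → Ω → ℕ × ℝ} {X : ℕ → Fin ℓ → Ω → ℕ × ℝ} {n : ℕ}

lemma measurable_glue' (hX : IsMarkedGluing P a ℓ glue X) :
    Measurable fun ω i => glue i ω := measurable_pi_iff.2 fun i => hX.measurable_glue i

lemma measurable_height (hX : IsMarkedGluing P a ℓ glue X) (n : ℕ) (j : Fin ℓ) :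
    Measurable fun ω => treeDist (fun i => glue i ω) n (X n j ω) treeRoot :=
  Measurable.treeDist hX.measurable_glue' (hX.measurable_mark n j) measurable_const

/-- Given the tree, the marked points are i.i.d., so the inner integral factorizes into the random
characteristic functions. -/
lemma integral_prod_exp_height [IsProbabilityMeasure P] (ha : ∀ n, 1 ≤ n → 0 < a n)
    (hX : IsMarkedGluing P a ℓ glue X) (hn : 1 ≤ n) (t : Fin ℓ → ℝ) :
    ∫ ω, ∏ j, Complex.exp (t j * treeDist (fun i => glue i ω) n (X n j ω) treeRoot * Complex.I)
      ∂P = ∫ g, ∏ j, heightCharFun a (t j) n g ∂gluingLaw a n := by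
  have := isProbabilityMeasure_unifLaw ha hn
  have := isProbabilityMeasure_gluingLaw ha n
  have hm : Measurable fun x : (ℕ → ℕ × ℝ) × (Fin ℓ → ℕ × ℝ) =>
      ∏ j, Complex.exp (t j * treeDist x.1 n (x.2 j) treeRoot * Complex.I) := by fun_prop
  have h1 := integral_map
    ((hX.measurable_truncGlue n).prodMk (hX.measurable_mark' n)).aemeasurable
    (f := fun x : (ℕ → ℕ × ℝ) × (Fin ℓ → ℕ × ℝ) =>
      ∏ j, Complex.exp (t j * treeDist x.1 n (x.2 j) treeRoot * Complex.I))
    hm.aestronglyMeasurable (μ := P)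
  simp only [treeDist_truncGlue] at h1
  rw [← h1, hX.map_truncGlue_marks hn, integral_prod]
  · refine integral_congr_ae (.of_forall fun g => ?_)
    exact integral_fintype_prod_eq_prod (μ := fun _ => unifLaw a n)
      (f := fun (j : Fin ℓ) (x : ℕ × ℝ) =>
        Complex.exp (t j * treeDist g n x treeRoot * Complex.I))
  · refine .of_bound hm.aestronglyMeasurable 1 (.of_forall fun x => ?_)
    rw [norm_prod]
    exact Finset.prod_le_one (fun _ _ => norm_nonneg _) fun j _ => (norm_exp_mul_mul_I _ _).le

lemma tendsto_integral_prod_exp_height [IsProbabilityMeasure P] (ha : ∀ n, 1 ≤ n → 0 < a n)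
    (hX : IsMarkedGluing P a ℓ glue X) (hs : Summable fun i => segProb a (i + 1) ^ 2)
    {N : ℕ → ℝ} (hN : Tendsto N atTop atTop) {f : ℝ → ℂ}
    (hlim : ∀ t : ℝ, Tendsto (fun n => heightProd a (t * Complex.I / N n) n) atTop (𝓝 (f t)))
    (t : Fin ℓ → ℝ) : Tendsto (fun n => ∫ ω, ∏ j, Complex.exp (t j *
        (treeDist (fun i => glue i ω) n (X n j ω) treeRoot / N n : ℝ) * Complex.I) ∂P) atTop
      (𝓝 (∏ j, f (t j))) := by
  have h1 := (tendsto_integral_prod_heightCharFun_sub ha hs hN t).add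
    (tendsto_finsetProd Finset.univ fun j _ => hlim (t j))
  rw [zero_add] at h1
  refine h1.congr' ?_
  filter_upwards [eventually_ge_atTop 1] with n hn
  have h2 : ∀ j, ((t j / N n : ℝ) : ℂ) * Complex.I = t j * Complex.I / N n := fun j => by
    push_cast; ring
  simp only [h2, sub_add_cancel]
  rw [← hX.integral_prod_exp_height ha hn]
  refine integral_congr_ae (.of_forall fun ω => Finset.prod_congr rfl fun j _ => ?_)
  congr 1
  push_cast
  ring

/-- The joint convergence of the rescaled heights follows from that of their one-point exponential
moments. -/
lemma tendstoInDistribution_heights [IsProbabilityMeasure P] (ha : ∀ n, 1 ≤ n → 0 < a n)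
    (hX : IsMarkedGluing P a ℓ glue X) (hs : Summable fun i => segProb a (i + 1) ^ 2)
    {N : ℕ → ℝ} (hN : Tendsto N atTop atTop) (ν : ProbabilityMeasure ℝ)
    (hlim : ∀ t : ℝ, Tendsto (fun n => heightProd a (t * Complex.I / N n) n) atTop
      (𝓝 (charFun (ν : Measure ℝ) t))) :
    TendstoInDistribution (fun (n : ℕ) (ω : Ω) (j : Fin ℓ) =>
      treeDist (fun i => glue i ω) n (X n j ω) treeRoot / N n) atTop id (fun _ => P)
      (Measure.pi fun _ : Fin ℓ => (ν : Measure ℝ)) := by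
  have hm : ∀ n, Measurable fun (ω : Ω) (j : Fin ℓ) =>
      treeDist (fun i => glue i ω) n (X n j ω) treeRoot / N n := fun n =>
    measurable_pi_iff.2 fun j => (hX.measurable_height n j).div_const _
  -- Characteristic functions need an inner product, so convergence is proved in Euclidean space and
  -- carried back by a continuous map.
  have hE : TendstoInDistribution (fun (n : ℕ) (ω : Ω) => WithLp.toLp 2 fun j : Fin ℓ =>
      treeDist (fun i => glue i ω) n (X n j ω) treeRoot / N n) atTop
      (WithLp.toLp 2 : (Fin ℓ → ℝ) → EuclideanSpace ℝ (Fin ℓ)) (fun _ => P)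
      (Measure.pi fun _ : Fin ℓ => (ν : Measure ℝ)) := by
    have hm' : ∀ n, Measurable fun (ω : Ω) => WithLp.toLp 2 fun j : Fin ℓ =>
        treeDist (fun i => glue i ω) n (X n j ω) treeRoot / N n := fun n =>
      (WithLp.measurable_toLp 2 _).comp (hm n)
    refine ⟨fun n => (hm' n).aemeasurable, (WithLp.measurable_toLp 2 _).aemeasurable, ?_⟩
    refine ProbabilityMeasure.tendsto_of_tendsto_charFun fun t => ?_
    simp only [ProbabilityMeasure.coe_mk]
    rw [charFun_pi (E := fun _ : Fin ℓ => ℝ) (μ := fun _ => (ν : Measure ℝ)) t]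
    refine (hX.tendsto_integral_prod_exp_height ha hs hN hlim t).congr fun n => ?_
    rw [charFun_apply, integral_map (hm' n).aemeasurable (by fun_prop)]
    refine integral_congr_ae (.of_forall fun ω => ?_)
    simp only [PiLp.inner_apply]
    rw [← Complex.exp_sum, Complex.ofReal_sum, Finset.sum_mul]
    congr 1
    refine Finset.sum_congr rfl fun j _ => ?_
    simp
  exact hE.continuous_comp (g := WithLp.ofLp) (PiLp.continuous_ofLp 2 _)

/-- A measurable version of the largest height of a branch point. -/
noncomputable def maxGromov (glue : ℕ → Ω → ℕ × ℝ) (X : ℕ → Fin ℓ → Ω → ℕ × ℝ) (n : ℕ) (ω : Ω) :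
    ℝ :=
  ⨆ e : {e : Fin ℓ × Fin ℓ // e.1 ≠ e.2},
    gromovHeight (fun i => glue i ω) n (X n e.1.1 ω) (X n e.1.2 ω)

/-- Gluing and marked points almost surely lie in their trees, where branch heights are Gromov
products. This supplies measurability of the branch heights. -/
lemma maxBranchHeight_ae_eq [IsProbabilityMeasure P] (ha : ∀ n, 1 ≤ n → 0 < a n)
    (hX : IsMarkedGluing P a ℓ glue X) (n : ℕ) :
    (fun ω => maxBranchHeight a (fun i => glue i ω) n fun j => X n j ω) =ᵐ[P]
      maxGromov glue X n := by
  rcases Nat.eq_zero_or_pos n with rfl | hn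
  -- Level 0 is not a tree, but convergence in distribution asks for measurability at every index;
  -- there both sides are 0.
  · refine .of_forall fun ω => ?_
    have h0 : ∀ p q, branchHeight a (fun i => glue i ω) 0 p q = 0 := fun p q => by
      have : rootPath a (fun i => glue i ω) 0 p = ∅ :=
        Set.eq_empty_of_forall_notMem fun z hz => absurd (one_le_of_mem_treePts hz.1) (by simp)
      simp [branchHeight, this]
    simp [maxBranchHeight, maxGromov, h0, gromovHeight, treeDist]
  · filter_upwards [hX.ae_valid ha n, hX.ae_mark_mem hn] with ω h1 h2
    simp only [maxBranchHeight, maxGromov]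
    refine iSup_congr fun e => branchHeight_eq_gromovHeight h1 (h2 _) (h2 _)

lemma measurable_maxGromov (hX : IsMarkedGluing P a ℓ glue X) (n : ℕ) :
    Measurable (maxGromov glue X n) :=
  Measurable.iSup fun _ => Measurable.gromovHeight hX.measurable_glue'
    (hX.measurable_mark n _) (hX.measurable_mark n _)

lemma measure_gromov_gt_le [IsProbabilityMeasure P] (ha : ∀ n, 1 ≤ n → 0 < a n)
    (hX : IsMarkedGluing P a ℓ glue X) {m : ℕ} (hm : 1 ≤ m) (hmn : m ≤ n) {j k : Fin ℓ}
    (hjk : j ≠ k) :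
    P {ω | totalLength a m < gromovHeight (fun i => glue i ω) n (X n j ω) (X n k ω)} ≤
      ENNReal.ofReal (∑ i ∈ Finset.Ico m n, segProb a (i + 1) ^ 2) := by
  have hn := hm.trans hmn
  have := isProbabilityMeasure_unifLaw ha hn
  have := isProbabilityMeasure_gluingLaw ha n
  refine le_trans (le_of_eq ?_) (branchProb_totalLength_le ha hm hmn)
  let S : Set ((ℕ → ℕ × ℝ) × (ℕ × ℝ) × (ℕ × ℝ)) :=
    {x | totalLength a m < gromovHeight x.1 n x.2.1 x.2.2}
  have hS : MeasurableSet S := measurableSet_lt measurable_const (by fun_prop)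
  have hmeas : Measurable fun ω => (truncGlue glue n ω, X n j ω, X n k ω) :=
    (hX.measurable_truncGlue n).prodMk ((hX.measurable_mark n j).prodMk (hX.measurable_mark n k))
  have hset : {ω | totalLength a m < gromovHeight (fun i => glue i ω) n (X n j ω) (X n k ω)} =
      (fun ω => (truncGlue glue n ω, X n j ω, X n k ω)) ⁻¹' S := by
    ext ω
    simp [S, gromovHeight, treeDist_truncGlue]
  have hind : Measurable fun x : (ℕ → ℕ × ℝ) × (ℕ × ℝ) × (ℕ × ℝ) =>
      (Set.Ioi (totalLength a m)).indicator (1 : ℝ → ENNReal) (gromovHeight x.1 n x.2.1 x.2.2) :=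
    (measurable_one.indicator measurableSet_Ioi).comp (by fun_prop)
  rw [hset, ← Measure.map_apply hmeas hS, hX.map_truncGlue_mark_mark hn hjk, branchProb,
    ← lintegral_indicator_one hS]
  have h1 := lintegral_prod _ hind.aemeasurable (μ := gluingLaw a n)
    (ν := (unifLaw a n).prod (unifLaw a n))
  have h2 : ∀ x, S.indicator (1 : (ℕ → ℕ × ℝ) × (ℕ × ℝ) × (ℕ × ℝ) → ENNReal) x =
      (Set.Ioi (totalLength a m)).indicator 1 (gromovHeight x.1 n x.2.1 x.2.2) := fun x => rfl
  simp only [h2]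
  rw [h1]
  refine lintegral_congr fun g => ?_
  exact lintegral_prod _ (hind.comp measurable_prodMk_left).aemeasurable

/-- The branch points stay at a bounded height. -/
lemma tendstoInMeasure_maxBranchHeight [IsProbabilityMeasure P] (ha : ∀ n, 1 ≤ n → 0 < a n)
    (hX : IsMarkedGluing P a ℓ glue X) (hs : Summable fun i => segProb a (i + 1) ^ 2)
    {N : ℕ → ℝ} (hN : Tendsto N atTop atTop) :
    TendstoInMeasure P (fun (n : ℕ) (ω : Ω) =>
      maxBranchHeight a (fun i => glue i ω) n (fun j => X n j ω) / N n) atTop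
      (fun _ => (0 : ℝ)) := by
  rw [tendstoInMeasure_iff_norm]
  intro ε hε
  rw [ENNReal.tendsto_nhds_zero]
  intro δ hδ
  -- A union bound over at most ℓ² pairs: `m` is fixed first to make the tail small, and only then
  -- `n` is taken large enough that ε `N n` exceeds the length of T_m.
  have htail : Tendsto (fun m => ENNReal.ofReal
      ((ℓ * ℓ : ℕ) * ∑' k, segProb a (k + m + 1) ^ 2)) atTop (𝓝 0) := by
    have := ((tendsto_sum_nat_add fun i => segProb a (i + 1) ^ 2).const_mul ((ℓ * ℓ : ℕ) : ℝ))
    rw [mul_zero] at this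
    simpa using ENNReal.tendsto_ofReal this
  obtain ⟨m, hm1, hmδ⟩ := ((eventually_ge_atTop 1).and
    (htail.eventually (ge_mem_nhds hδ))).exists
  filter_upwards [eventually_ge_atTop m, hN.eventually_gt_atTop 0,
    hN.eventually_gt_atTop (totalLength a m / ε)] with n hmn hN0 hNε
  have hn := hm1.trans hmn
  rw [div_lt_iff₀ hε] at hNε
  refine le_trans ?_ hmδ
  let B : Fin ℓ × Fin ℓ → Set Ω := fun e => if e.1 = e.2 then ∅ else
    {ω | totalLength a m < gromovHeight (fun i => glue i ω) n (X n e.1 ω) (X n e.2 ω)}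
  have hsub : {ω | ε ≤ ‖maxBranchHeight a (fun i => glue i ω) n (fun j => X n j ω) / N n - 0‖} ≤ᵐ[P]
      (⋃ e ∈ (Finset.univ : Finset (Fin ℓ × Fin ℓ)), B e : Set Ω) := by
    filter_upwards [hX.maxBranchHeight_ae_eq ha n, hX.ae_valid ha n, hX.ae_mark_mem hn]
      with ω h1 h2 h3 hω
    have hω : ε ≤ ‖maxBranchHeight a (fun i => glue i ω) n (fun j => X n j ω) / N n - 0‖ := hω
    rw [h1, sub_zero, norm_div, Real.norm_of_nonneg hN0.le, le_div_iff₀ hN0] at hω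
    have hA := totalLength_pos ha hm1
    by_cases hne : Nonempty {e : Fin ℓ × Fin ℓ // e.1 ≠ e.2}
    · obtain ⟨e, he⟩ := exists_eq_ciSup_of_finite
        (f := fun e : {e : Fin ℓ × Fin ℓ // e.1 ≠ e.2} =>
          gromovHeight (fun i => glue i ω) n (X n e.1.1 ω) (X n e.1.2 ω))
      have hmax : maxGromov glue X n ω =
          gromovHeight (fun i => glue i ω) n (X n e.1.1 ω) (X n e.1.2 ω) := he.symm
      rw [hmax, Real.norm_of_nonneg (gromovHeight_nonneg ha h2 (h3 _) (h3 _))] at hω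
      refine Set.mem_iUnion₂.2 ⟨e.1, Finset.mem_univ _, ?_⟩
      simp only [B, if_neg e.2]
      show totalLength a m < _
      linarith
    -- With no pair of distinct marks the supremum is 0 by convention, so the event is empty.
    · rw [not_nonempty_iff] at hne
      rw [maxGromov, Real.iSup_of_isEmpty, norm_zero] at hω
      nlinarith
  refine (measure_mono_ae hsub).trans ((measure_biUnion_finset_le _ _).trans ?_)
  have hsum0 : ∑ i ∈ Finset.Ico m n, segProb a (i + 1) ^ 2 ≤ ∑' k, segProb a (k + m + 1) ^ 2 := by
    rw [Finset.sum_Ico_eq_sum_range]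
    have hs' : Summable fun k => segProb a (k + m + 1) ^ 2 :=
      (summable_nat_add_iff (f := fun i => segProb a (i + 1) ^ 2) m).2 hs
    refine le_trans (le_of_eq ?_) (hs'.sum_le_tsum (Finset.range (n - m))
      fun i _ => by positivity)
    exact Finset.sum_congr rfl fun i _ => by rw [add_comm m i]
  have hB : ∀ e ∈ (Finset.univ : Finset (Fin ℓ × Fin ℓ)),
      P (B e) ≤ ENNReal.ofReal (∑' k, segProb a (k + m + 1) ^ 2) := by
    intro e _
    simp only [B]
    split_ifs with he
    · simp
    · exact (hX.measure_gromov_gt_le ha hm1 hmn he).trans (ENNReal.ofReal_le_ofReal hsum0)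
  refine (Finset.sum_le_sum hB).trans ?_
  rw [Finset.sum_const, Finset.card_univ, Fintype.card_prod, Fintype.card_fin, nsmul_eq_mul,
    ENNReal.ofReal_mul (by positivity), ENNReal.ofReal_natCast]

end IsMarkedGluing

/-! ### Convergence in probability to constants -/

lemma MeasureTheory.TendstoInDistribution.tendstoInMeasure_const {Ω Ω' E : Type*} [MeasurableSpace Ω]
    [MeasurableSpace Ω'] {P : Measure Ω} [IsProbabilityMeasure P] {Q : Measure Ω'}
    [IsProbabilityMeasure Q] [PseudoEMetricSpace E] [MeasurableSpace E] [BorelSpace E]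
    {Y : ℕ → Ω → E} {Z : Ω' → E} {c : E}
    (h : TendstoInDistribution Y atTop Z (fun _ => P) Q) (hZ : ∀ᵐ x ∂Q, Z x = c) :
    TendstoInMeasure P Y atTop fun _ => c := by
  intro ε hε
  -- Portmanteau for this closed set, which the limit law does not charge.
  have hF : IsClosed {x : E | ε ≤ edist x c} :=
    isClosed_le continuous_const (by fun_prop)
  have h1 := ProbabilityMeasure.limsup_measure_closed_le_of_tendsto h.tendsto hF
  simp only [ProbabilityMeasure.coe_mk] at h1
  have h2 : ∀ n, P.map (Y n) {x : E | ε ≤ edist x c} = P {ω | ε ≤ edist (Y n ω) c} := fun n =>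
    Measure.map_apply_of_aemeasurable (h.forall_aemeasurable n) hF.measurableSet
  have h3 : Q.map Z {x : E | ε ≤ edist x c} = 0 := by
    rw [Measure.map_apply_of_aemeasurable h.aemeasurable_limit hF.measurableSet]
    refine measure_mono_null (fun x hx => ?_) (ae_iff.1 hZ)
    rintro hxc
    have hx : ε ≤ edist (Z x) c := hx
    rw [hxc, edist_self] at hx
    exact absurd hx (not_le.2 hε)
  simp only [h2, h3] at h1
  exact tendsto_of_le_liminf_of_limsup_le (by simp) h1

lemma MeasureTheory.TendstoInMeasure.prodMk_const {Ω E F : Type*} [MeasurableSpace Ω] {P : Measure Ω}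
    [PseudoEMetricSpace E] [PseudoEMetricSpace F] {Y : ℕ → Ω → E} {Z : ℕ → Ω → F} {c : E} {d : F}
    (hY : TendstoInMeasure P Y atTop fun _ => c) (hZ : TendstoInMeasure P Z atTop fun _ => d) :
    TendstoInMeasure P (fun n ω => (Y n ω, Z n ω)) atTop fun _ => (c, d) := by
  intro ε hε
  have h := (hY ε hε).add (hZ ε hε)
  rw [add_zero] at h
  refine tendsto_of_tendsto_of_tendsto_of_le_of_le tendsto_const_nhds h (fun _ => zero_le) ?_
  intro n
  refine (measure_mono ?_).trans (measure_union_le _ _)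
  intro ω hω
  have hω : ε ≤ max (edist (Y n ω) c) (edist (Z n ω) d) := hω
  exact le_max_iff.1 hω

/-! ### Existence of the limit law and the case of index 0 -/

namespace IsMarkedGluing

variable {Ω : Type*} [MeasurableSpace Ω] {P : Measure Ω} {a : ℕ → ℝ} {ℓ : ℕ}
  {glue : ℕ → Ω → ℕ × ℝ} {X : ℕ → Fin ℓ → Ω → ℕ × ℝ} {n : ℕ}

lemma lintegral_exp_height [IsProbabilityMeasure P] (ha : ∀ n, 1 ≤ n → 0 < a n)
    (hX : IsMarkedGluing P a ℓ glue X) (hn : 1 ≤ n) (j : Fin ℓ) (t : ℝ) :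
    ∫⁻ ω, ENNReal.ofReal (Real.exp (t * treeDist (fun i => glue i ω) n (X n j ω) treeRoot)) ∂P =
      heightMgf a t n := by
  have := isProbabilityMeasure_unifLaw ha hn
  have hm : Measurable fun x : (ℕ → ℕ × ℝ) × (ℕ × ℝ) =>
      ENNReal.ofReal (Real.exp (t * treeDist x.1 n x.2 treeRoot)) := by fun_prop
  have h1 := lintegral_map hm ((hX.measurable_truncGlue n).prodMk (hX.measurable_mark n j))
    (μ := P)
  simp only [treeDist_truncGlue] at h1
  rw [← h1, hX.map_truncGlue_mark hn, lintegral_prod _ hm.aemeasurable, heightMgf]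

/-- The limit law of the rescaled height of a uniform point. -/
lemma exists_isXiLaw [IsProbabilityMeasure P] (ha : ∀ n, 1 ≤ n → 0 < a n)
    (hX : IsMarkedGluing P a ℓ glue X) (j₀ : Fin ℓ) {α : ℝ} (hα : 0 < α)
    (h : RegularlyVarying a α) :
    ∃ ν : ProbabilityMeasure ℝ, IsXiLaw α ν ∧ ∀ t : ℝ,
      Tendsto (fun n => heightProd a (t * Complex.I / a n) n) atTop
        (𝓝 (charFun (ν : Measure ℝ) t)) := by
  have hs := h.summable_segProb_sq ha hα.le
  have hlim := fun t : ℝ => h.tendsto_heightProd_of_pos ha hα (t * Complex.I)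
  have hY : ∀ n, Measurable fun ω =>
      treeDist (fun i => glue i ω) n (X n j₀ ω) treeRoot / a n := fun n =>
    (hX.measurable_height n j₀).div_const _
  suffices hex : ∃ ν : ProbabilityMeasure ℝ, (∀ t : ℝ, charFun (ν : Measure ℝ) t =
      Complex.exp (∫ x in (0 : ℝ)..1,
        ((α + 1) / x) • (unifMgf ((t : ℂ) * Complex.I * (x ^ α : ℝ)) - 1))) ∧
      ∀ t, mgf id (ν : Measure ℝ) t = Real.exp (xiExponent α t) by
    obtain ⟨ν, hν, hν'⟩ := hex
    exact ⟨ν, hν', fun t => by rw [hν]; exact hlim t⟩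
  refine exists_charFun_mgf_limit
    (μ := fun n => ⟨P.map fun ω => treeDist (fun i => glue i ω) n (X n j₀ ω) treeRoot / a n,
      Measure.isProbabilityMeasure_map (hY n).aemeasurable⟩)
    (continuousAt_exponent hα) ?_ (fun t => (Real.exp_pos _).le) ?_
  · intro t
    -- Putting the argument `t` at `j₀` and 0 elsewhere reduces the joint statement to one mark: the
    -- other factors are 1.
    have h1 := hX.tendsto_integral_prod_exp_height ha hs (h.tendsto_atTop_of_pos ha hα) hlim
      (Pi.single j₀ t)
    rw [Finset.prod_eq_single j₀ (fun j _ hj => by simp [Pi.single_eq_of_ne hj, unifMgf])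
      (by simp), Pi.single_eq_same] at h1
    refine h1.congr fun n => ?_
    rw [ProbabilityMeasure.coe_mk, charFun_apply_real,
      integral_map (hY n).aemeasurable (by fun_prop)]
    refine integral_congr_ae (.of_forall fun ω => ?_)
    simp only
    rw [Finset.prod_eq_single j₀ (fun j _ hj => by simp [Pi.single_eq_of_ne hj])
      (by simp), Pi.single_eq_same]
  · intro t
    -- The same product limit, at a real argument, gives the exponential moments.
    have h1 := h.tendsto_heightProd_of_pos ha hα t
    rw [integral_exponent_eq_xiExponent hα, ← Complex.ofReal_exp] at h1
    have h2 := (Complex.continuous_re.tendsto _).comp h1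
    rw [Complex.ofReal_re] at h2
    refine (ENNReal.tendsto_ofReal h2).congr' ?_
    filter_upwards [eventually_ge_atTop 1] with n hn
    rw [ProbabilityMeasure.coe_mk, lintegral_map (by fun_prop) (hY n)]
    have h3 : ∀ ω, t * (treeDist (fun i => glue i ω) n (X n j₀ ω) treeRoot / a n) =
        t / a n * treeDist (fun i => glue i ω) n (X n j₀ ω) treeRoot := fun ω => by ring
    simp only [h3]
    rw [hX.lintegral_exp_height ha hn, heightMgf_eq ha hn, Function.comp_apply, heightProd]
    have h4 : ∀ i, unifMgf ((t : ℂ) / a n * a i) = (unifMgfReal (t / a n * a i) : ℂ) := fun i => by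
      rw [← unifMgf_ofReal]
      push_cast
      rfl
    simp only [h4]
    congr 1
    norm_cast

lemma tendstoInMeasure_heights [IsProbabilityMeasure P] (ha : ∀ n, 1 ≤ n → 0 < a n)
    (hX : IsMarkedGluing P a ℓ glue X) (h : RegularlyVarying a 0)
    (hS : Tendsto (harmonicSum a) atTop atTop) :
    TendstoInMeasure P (fun (n : ℕ) (ω : Ω) (j : Fin ℓ) =>
      treeDist (fun i => glue i ω) n (X n j ω) treeRoot / harmonicSum a n) atTop
      fun _ _ => (1 / 2 : ℝ) := by
  let ν : ProbabilityMeasure ℝ := ⟨Measure.dirac (1 / 2), inferInstance⟩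
  refine (hX.tendstoInDistribution_heights ha (h.summable_segProb_sq ha le_rfl) hS ν
    fun t => ?_).tendstoInMeasure_const ?_
  · have h1 : charFun (ν : Measure ℝ) t = Complex.exp (t * Complex.I / 2) := by
      simp only [ν, ProbabilityMeasure.coe_mk, charFun_dirac]
      congr 1
      simp
      ring
    rw [h1]
    exact h.tendsto_heightProd_of_zero ha hS (t * Complex.I)
  · have h1 : ∀ j : Fin ℓ, ∀ᵐ x ∂(Measure.pi fun _ : Fin ℓ => (ν : Measure ℝ)), x j = 1 / 2 :=
      fun j => (Measure.quasiMeasurePreserving_eval (fun _ : Fin ℓ => (ν : Measure ℝ)) j).ae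
        (p := fun y => y = 1 / 2) ((ae_dirac_iff (measurableSet_singleton (1 / 2 : ℝ))).2 rfl)
    filter_upwards [ae_all_iff.2 h1] with x hx using funext hx

end IsMarkedGluing

/-! ### The theorem -/

theorem mainTheorem5 {Ω : Type*} [MeasurableSpace Ω] (P : Measure Ω) [IsProbabilityMeasure P]
    (a : ℕ → ℝ) (ha : ∀ n, 1 ≤ n → 0 < a n) (ℓ : ℕ) (hℓ : 1 ≤ ℓ)
    (glue : ℕ → Ω → ℕ × ℝ) (X : ℕ → Fin ℓ → Ω → ℕ × ℝ)
    (hX : IsMarkedGluing P a ℓ glue X) :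
    (∀ α : ℝ, 0 < α → RegularlyVarying a α →
      (∃! ν : ProbabilityMeasure ℝ, IsXiLaw α ν) ∧
      ∀ ν : ProbabilityMeasure ℝ, IsXiLaw α ν →
        TendstoInDistribution
          (fun (n : ℕ) (ω : Ω) =>
            ((fun j : Fin ℓ => treeDist (fun i => glue i ω) n (X n j ω) treeRoot / a n),
              maxBranchHeight a (fun i => glue i ω) n (fun j => X n j ω) / a n))
          atTop
          (fun y : Fin ℓ → ℝ => (y, (0 : ℝ)))
          (fun _ => P)
          (Measure.pi fun _ : Fin ℓ => (ν : Measure ℝ))) ∧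
    (RegularlyVarying a 0 → Tendsto (harmonicSum a) atTop atTop →
      TendstoInMeasure P
        (fun (n : ℕ) (ω : Ω) =>
          ((fun j : Fin ℓ =>
              treeDist (fun i => glue i ω) n (X n j ω) treeRoot / harmonicSum a n),
            maxBranchHeight a (fun i => glue i ω) n (fun j => X n j ω) / harmonicSum a n))
        atTop
        (fun _ => ((fun _ : Fin ℓ => (1 / 2 : ℝ)), (0 : ℝ))) ∧
      (Tendsto a atTop atTop →
        TendstoInMeasure P
          (fun (n : ℕ) (ω : Ω) =>
            ((fun j : Fin ℓ =>
                treeDist (fun i => glue i ω) n (X n j ω) treeRoot / harmonicSum a n),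
              maxBranchHeight a (fun i => glue i ω) n (fun j => X n j ω) / a n))
          atTop
          (fun _ => ((fun _ : Fin ℓ => (1 / 2 : ℝ)), (0 : ℝ))))) := by
  refine ⟨fun α hα h => ?_, fun h hS => ?_⟩
  -- The law is constructed from the height of the first mark, which exists because ℓ ≥ 1.
  · obtain ⟨ν₀, hν₀, hlim⟩ := hX.exists_isXiLaw ha ⟨0, hℓ⟩ hα h
    refine ⟨⟨ν₀, hν₀, fun ν hν => hν.unique hν₀⟩, fun ν hν => ?_⟩
    obtain rfl := hν.unique hν₀
    have hs := h.summable_segProb_sq ha hα.le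
    have hN := h.tendsto_atTop_of_pos ha hα
    refine TendstoInDistribution.prodMk_of_tendstoInMeasure_const _ _ _
      (hX.tendstoInDistribution_heights ha hs hN ν hlim)
      (hX.tendstoInMeasure_maxBranchHeight ha hs hN) fun n => ?_
    exact (((hX.measurable_maxGromov n).aemeasurable.congr
      (hX.maxBranchHeight_ae_eq ha n).symm).div_const _)
  · have hs := h.summable_segProb_sq ha le_rfl
    have hh := hX.tendstoInMeasure_heights ha h hS
    exact ⟨hh.prodMk_const (hX.tendstoInMeasure_maxBranchHeight ha hs hS),
      fun hN => hh.prodMk_const (hX.tendstoInMeasure_maxBranchHeight ha hs hN)⟩
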